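/- Let $n,m\ge 0$ be integers and let $\rho<0$ be real. Let $\xi\in\mathbb R^n$, $\eta\in\mathbb R^m$ satisfy $\xi_n>\dots>\xi_1>\eta_m>\dots>\eta_1$ and $\sqrt{-\rho}\,\xi_i\neq\eta_j$ for all $i,j$. Then the integral $$ M=\frac{1}{(2\pi)^{\frac{m+n}{2}}}\int_{\mathbb R^n+i\xi}dt\int_{\mathbb R^m+i\eta}d\tau\; \frac{\prod_{1\le i<j\le n}(t_i-t_j)^{2/\rho}\,\prod_{1\le i<j\le m}(\tau_i-\tau_j)^{2\rho}\; e^{-\frac12\sum_{j=1}^m\tau_j^2-\frac12\sum_{i=1}^n t_i^2}} {\prod_{j=1}^m\prod_{i=1}^n(\sqrt{-\rho}\,t_i-\tau_j)^2}, $$ where the complex powers are taken with the principal branch (positive on the positive half-line; the bases lie in the open lower half-plane), converges absolutely, and $$ M=\varepsilon\prod_{i=1}^n\frac{\Gamma(1-1/\rho)}{\Gamma(1-i/\rho)}\prod_{j=1}^m\frac{\Gamma(1-\rho)}{\Gamma(n+1-j\rho)} =\varepsilon\prod_{j=1}^m\prod_{i=1}^n\frac{1}{i-j\rho}\;\prod_{i=1}^n\frac{\Gamma(1-1/\rho)}{\Gamma(1-i/\rho)}\prod_{j=1}^m\frac{\Gamma(1-\rho)}{\Gamma(1-j\rho)},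 $$ where $$ \varepsilon=(-1)^{nm}\,e^{-\pi i\left(\frac{m(m-1)\rho}{2}+\frac{n(n-1)}{2\rho}\right)}. $$ -/

import Mathlib

open MeasureTheory

noncomputable section

/-- The integrand of the deformed `A(n,m)` Macdonald-Mehta integral, at `t ∈ ℂⁿ`, `τ ∈ ℂᵐ`:
`∏_{i<j} (t_i - t_j)^{2/ρ} ∏_{i<j} (τ_i - τ_j)^{2ρ} e^{-½ ∑ τ_j² - ½ ∑ t_i²}`
divided by `∏_j ∏_i (√(-ρ) t_i - τ_j)²`. The complex powers are principal branches. -/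
def mehtaIntegrand (n m : ℕ) (ρ : ℝ) (t : Fin n → ℂ) (τ : Fin m → ℂ) : ℂ :=
  ((∏ i : Fin n, ∏ j ∈ Finset.Ioi i, (t i - t j) ^ ((2 / ρ : ℝ) : ℂ)) *
    (∏ i : Fin m, ∏ j ∈ Finset.Ioi i, (τ i - τ j) ^ ((2 * ρ : ℝ) : ℂ)) *
    Complex.exp (-(1 / 2) * (∑ j : Fin m, τ j ^ 2) - (1 / 2) * (∑ i : Fin n, t i ^ 2))) /
  (∏ j : Fin m, ∏ i : Fin n, ((Real.sqrt (-ρ) : ℂ) * t i - τ j) ^ 2)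

/-- The point `x + iξ` of the shifted real space `ℝᵏ + iξ`. -/
def shiftedPoint {k : ℕ} (ξ x : Fin k → ℝ) : Fin k → ℂ :=
  fun i => (x i : ℂ) + Complex.I * (ξ i : ℂ)

/-- The deformed `A(n,m)` Macdonald-Mehta integral
`M = (2π)^{-(m+n)/2} ∫_{ℝⁿ+iξ} dt ∫_{ℝᵐ+iη} dτ (integrand)`. -/
def mehtaIntegral (n m : ℕ) (ρ : ℝ) (ξ : Fin n → ℝ) (η : Fin m → ℝ) : ℂ :=
  (1 / ((2 * Real.pi) ^ (((m : ℝ) + n) / 2) : ℝ) : ℂ) *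
    ∫ x : Fin n → ℝ, ∫ y : Fin m → ℝ,
      mehtaIntegrand n m ρ (shiftedPoint ξ x) (shiftedPoint η y)

/-- The constant `ε = (-1)^{nm} e^{-πi (m(m-1)ρ/2 + n(n-1)/(2ρ))}`. -/
def mehtaPhase (n m : ℕ) (ρ : ℝ) : ℂ :=
  (-1) ^ (n * m) *
    Complex.exp (-(Real.pi : ℂ) * Complex.I *
      ((((m : ℝ) * ((m : ℝ) - 1) * ρ / 2 + (n : ℝ) * ((n : ℝ) - 1) / (2 * ρ) : ℝ)) : ℂ))

end

noncomputable section

open Set Filter Topology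

/-! ### Mellin–Laplace transforms and the Kummer connection formula. -/

/-- The Mellin–Laplace transform `∫₀^∞ v^{a-1} e^{-pv} G(v) dv`. -/
def mellinLaplace (a p : ℝ) (G : ℝ → ℂ) : ℂ :=
  ∫ v in Ioi (0 : ℝ), ((v ^ (a - 1) * Real.exp (-p * v) : ℝ) : ℂ) * G v

theorem one_add_rpow_le {Q v : ℝ} (hQ : 0 ≤ Q) (hv : 0 < v) :
    (1 + v) ^ Q ≤ 2 ^ Q * (1 + v ^ Q) := by
  have h2 : (0 : ℝ) ≤ 2 ^ Q := by positivity
  have hvQ : 0 ≤ v ^ Q := by positivity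
  rcases le_total v 1 with h | h
  · have : (1 + v) ^ Q ≤ 2 ^ Q := Real.rpow_le_rpow (by positivity) (by linarith) hQ
    nlinarith
  · have : (1 + v) ^ Q ≤ (2 * v) ^ Q := Real.rpow_le_rpow (by positivity) (by linarith) hQ
    rw [Real.mul_rpow (by norm_num) hv.le] at this
    nlinarith

theorem integrableOn_rpow_mul_exp_mul_one_add_rpow {a p Q : ℝ} (ha : 0 < a) (hp : 0 < p)
    (hQ : 0 ≤ Q) :
    IntegrableOn (fun v : ℝ => v ^ (a - 1) * Real.exp (-p * v) * (1 + v) ^ Q) (Ioi 0) := by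
  have h1 := integrableOn_rpow_mul_exp_neg_mul_rpow (s := a - 1) (p := 1) (b := p)
    (by linarith) one_pos hp
  have h2 := integrableOn_rpow_mul_exp_neg_mul_rpow (s := a + Q - 1) (p := 1) (b := p)
    (by linarith) one_pos hp
  refine Integrable.mono' ((h1.add h2).const_mul (2 ^ Q)) ?_ ?_
  · refine ContinuousOn.aestronglyMeasurable (fun v hv => ?_) measurableSet_Ioi
    have hv : 0 < v := hv
    refine ContinuousAt.continuousWithinAt ?_
    refine ((Real.continuousAt_rpow_const _ _ (Or.inl hv.ne')).mul (by fun_prop)).mul ?_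
    exact ContinuousAt.rpow_const (by fun_prop) (Or.inl (by positivity))
  · refine (ae_restrict_mem measurableSet_Ioi).mono fun v hv => ?_
    have hv : 0 < v := hv
    rw [Real.norm_of_nonneg (by positivity)]
    simp only [Pi.add_apply, Real.rpow_one]
    rw [show a + Q - 1 = (a - 1) + Q by ring, Real.rpow_add hv]
    have := one_add_rpow_le hQ hv
    have h0 : 0 ≤ v ^ (a - 1) * Real.exp (-p * v) := by positivity
    nlinarith [mul_le_mul_of_nonneg_left this h0]

theorem integrableOn_mellinLaplace {a p Q C : ℝ} {G : ℝ → ℂ} (ha : 0 < a) (hp : 0 < p)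
    (hQ : 0 ≤ Q) (hG : ContinuousOn G (Ioi 0)) (hb : ∀ v > 0, ‖G v‖ ≤ C * (1 + v) ^ Q) :
    IntegrableOn (fun v : ℝ => ((v ^ (a - 1) * Real.exp (-p * v) : ℝ) : ℂ) * G v) (Ioi 0) := by
  refine Integrable.mono' ((integrableOn_rpow_mul_exp_mul_one_add_rpow ha hp hQ).const_mul C) ?_ ?_
  · refine ContinuousOn.aestronglyMeasurable (ContinuousOn.mul (fun v hv => ?_) hG)
      measurableSet_Ioi
    refine ContinuousAt.continuousWithinAt ?_
    refine Complex.continuous_ofReal.continuousAt.comp ?_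
    exact (Real.continuousAt_rpow_const _ _ (Or.inl (ne_of_gt hv))).mul (by fun_prop)
  · refine (ae_restrict_mem measurableSet_Ioi).mono fun v hv => ?_
    have hv : 0 < v := hv
    have h0 : 0 ≤ v ^ (a - 1) * Real.exp (-p * v) := by positivity
    rw [norm_mul, Complex.norm_real, Real.norm_of_nonneg h0]
    nlinarith [mul_le_mul_of_nonneg_left (hb v hv) h0]

/-- This is the integral over (0, ∞) of the derivative of v^b e^{-pv} F(v). Both boundary values
vanish: at 0 because b > 0 and F is bounded there, at infinity because p > 0 and F grows
polynomially. -/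
theorem mellinLaplace_integral_by_parts {b p Q C : ℝ} {F F' : ℝ → ℂ} (hb : 0 < b) (hp : 0 < p)
    (hQ : 0 ≤ Q) (hF : ∀ v > 0, HasDerivAt F (F' v) v) (bF : ∀ v > 0, ‖F v‖ ≤ C * (1 + v) ^ Q)
    (hint : IntegrableOn (fun v : ℝ => ((v ^ (b + 1 - 1) * Real.exp (-p * v) : ℝ) : ℂ) * F' v)
      (Ioi 0)) :
    b * mellinLaplace b p F - p * mellinLaplace (b + 1) p F + mellinLaplace (b + 1) p F' = 0 := by
  have hC : 0 ≤ C := by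
    have := (norm_nonneg _).trans (bF 1 one_pos)
    have h2 : (0 : ℝ) < (1 + 1) ^ Q := by positivity
    exact nonneg_of_mul_nonneg_left this h2
  have hFc : ContinuousOn F (Ioi 0) := fun v hv => (hF v hv).continuousAt.continuousWithinAt
  have i1 := integrableOn_mellinLaplace hb hp hQ hFc bF
  have i2 := integrableOn_mellinLaplace (a := b + 1) (by linarith) hp hQ hFc bF
  set f : ℝ → ℂ := fun v => ((v ^ b * Real.exp (-p * v) : ℝ) : ℂ) * F v with hf
  have hder : ∀ v ∈ Ioi (0 : ℝ), HasDerivAt f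
      (b * (((v ^ (b - 1) * Real.exp (-p * v) : ℝ) : ℂ) * F v)
        - p * (((v ^ (b + 1 - 1) * Real.exp (-p * v) : ℝ) : ℂ) * F v)
        + ((v ^ (b + 1 - 1) * Real.exp (-p * v) : ℝ) : ℂ) * F' v) v := by
    intro v hv
    have hv' : v ≠ 0 := ne_of_gt hv
    have h1 := (Real.hasDerivAt_rpow_const (p := b) (Or.inl hv')).mul
      (((hasDerivAt_id v).const_mul (-p)).exp)
    have h2 := (h1.ofReal_comp).mul (hF v hv)
    refine h2.congr_deriv ?_
    simp only [id_eq, mul_one, add_sub_cancel_right]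
    push_cast
    simp only [Pi.mul_apply]
    push_cast
    ring
  have hbound : ∀ v > 0, ‖f v‖ ≤ v ^ b * Real.exp (-p * v) * (C * (1 + v) ^ Q) := by
    intro v hv
    have h0 : 0 ≤ v ^ b * Real.exp (-p * v) := by positivity
    rw [hf]
    simp only [norm_mul, Complex.norm_real]
    rw [← norm_mul, Real.norm_of_nonneg h0]
    exact mul_le_mul_of_nonneg_left (bF v hv) h0
  -- No limit of F at 0 is needed: v^b vanishes there, and f 0 = 0 whatever the value F 0.
  have hcont : ContinuousWithinAt f (Ici 0) 0 := by
    have h0 : f 0 = 0 := by simp [hf, Real.zero_rpow hb.ne']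
    rw [ContinuousWithinAt, h0]
    have hlim : Tendsto (fun v : ℝ => v ^ b * Real.exp (-p * v) * (C * (1 + v) ^ Q))
        (𝓝[Ici 0] 0) (𝓝 0) := by
      have : ContinuousAt (fun v : ℝ => v ^ b * Real.exp (-p * v) * (C * (1 + v) ^ Q)) 0 := by
        refine ((Real.continuousAt_rpow_const _ _ (Or.inr hb.le)).mul (by fun_prop)).mul ?_
        exact continuousAt_const.mul (ContinuousAt.rpow_const (by fun_prop) (Or.inl (by norm_num)))
      have h := this.tendsto
      simp only [Real.zero_rpow hb.ne', zero_mul] at h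
      exact h.mono_left nhdsWithin_le_nhds
    refine squeeze_zero_norm' ?_ hlim
    filter_upwards [self_mem_nhdsWithin] with v hv
    rcases eq_or_lt_of_le (show (0 : ℝ) ≤ v from hv) with h | h
    · rw [← h, h0]; simp [Real.zero_rpow hb.ne']
    · exact hbound v h
  have hinf : Tendsto f atTop (𝓝 0) := by
    have t1 : Tendsto (fun v : ℝ => 2 ^ Q * C * (v ^ b * Real.exp (-p * v)
        + v ^ (b + Q) * Real.exp (-p * v))) atTop (𝓝 0) := by
      have := ((tendsto_rpow_mul_exp_neg_mul_atTop_nhds_zero b p hp).add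
        (tendsto_rpow_mul_exp_neg_mul_atTop_nhds_zero (b + Q) p hp)).const_mul (2 ^ Q * C)
      simpa using this
    refine squeeze_zero_norm' ?_ t1
    filter_upwards [eventually_gt_atTop 0] with v hv
    refine (hbound v hv).trans ?_
    rw [Real.rpow_add hv]
    have h0 : 0 ≤ v ^ b * Real.exp (-p * v) * C := by positivity
    nlinarith [mul_le_mul_of_nonneg_left (one_add_rpow_le hQ hv) h0]
  have i12 : IntegrableOn (fun v : ℝ => b * (((v ^ (b - 1) * Real.exp (-p * v) : ℝ) : ℂ) * F v)
      - p * (((v ^ (b + 1 - 1) * Real.exp (-p * v) : ℝ) : ℂ) * F v)) (Ioi 0) :=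
    (i1.const_mul (b : ℂ)).sub (i2.const_mul (p : ℂ))
  have key := integral_Ioi_of_hasDerivAt_of_tendsto hcont hder (i12.add hint) hinf
  rw [integral_add i12 hint,
    integral_sub (i1.const_mul (b : ℂ)) (i2.const_mul (p : ℂ)), integral_const_mul,
    integral_const_mul] at key
  have h0 : f 0 = 0 := by simp [hf, Real.zero_rpow hb.ne']
  rw [h0, sub_zero] at key
  exact key

theorem hasDerivAt_mellinLaplace {b p Q C : ℝ} {G : ℝ → ℂ} (hb : 0 < b) (hp : 0 < p)
    (hQ : 0 ≤ Q) (hG : ContinuousOn G (Ioi 0)) (bG : ∀ v > 0, ‖G v‖ ≤ C * (1 + v) ^ Q) :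
    HasDerivAt (fun p => mellinLaplace b p G) (-mellinLaplace (b + 1) p G) p := by
  have hm : ∀ (a t : ℝ), AEStronglyMeasurable
      (fun v : ℝ => ((v ^ (a - 1) * Real.exp (-t * v) : ℝ) : ℂ) * G v)
      (volume.restrict (Ioi 0)) := by
    intro a t
    refine ContinuousOn.aestronglyMeasurable (ContinuousOn.mul (fun v hv => ?_) hG)
      measurableSet_Ioi
    refine ContinuousAt.continuousWithinAt ?_
    refine Complex.continuous_ofReal.continuousAt.comp ?_
    exact (Real.continuousAt_rpow_const _ _ (Or.inl (ne_of_gt hv))).mul (by fun_prop)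
  have key := hasDerivAt_integral_of_dominated_loc_of_deriv_le (μ := volume.restrict (Ioi (0 : ℝ)))
    (F := fun (t v : ℝ) => ((v ^ (b - 1) * Real.exp (-t * v) : ℝ) : ℂ) * G v)
    (F' := fun (t v : ℝ) => -(((v ^ (b + 1 - 1) * Real.exp (-t * v) : ℝ) : ℂ) * G v))
    (x₀ := p) (s := Ioi (p / 2)) (Ioi_mem_nhds (by linarith))
    (bound := fun v => C * (v ^ (b + 1 - 1) * Real.exp (-(p / 2) * v) * (1 + v) ^ Q))
    (Eventually.of_forall fun t => hm b t)
    (integrableOn_mellinLaplace hb hp hQ hG bG) (hm (b + 1) p).neg ?_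
    ((integrableOn_rpow_mul_exp_mul_one_add_rpow (by linarith) (by linarith) hQ).const_mul C) ?_
  · have h := key.2
    rw [integral_neg] at h
    exact h
  · refine (ae_restrict_mem measurableSet_Ioi).mono fun v hv t ht => ?_
    have hv : 0 < v := hv
    have ht : p / 2 < t := ht
    have h0 : 0 ≤ v ^ (b + 1 - 1) * Real.exp (-t * v) := by positivity
    rw [norm_neg, norm_mul, Complex.norm_real, Real.norm_of_nonneg h0]
    have h1 : Real.exp (-t * v) ≤ Real.exp (-(p / 2) * v) := by
      apply Real.exp_le_exp.mpr; nlinarith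
    calc _ ≤ (v ^ (b + 1 - 1) * Real.exp (-(p / 2) * v)) * (C * (1 + v) ^ Q) := by
          refine mul_le_mul ?_ (bG v hv) (norm_nonneg _) (by positivity)
          exact mul_le_mul_of_nonneg_left h1 (by positivity)
      _ = _ := by ring
  · refine (ae_restrict_mem measurableSet_Ioi).mono fun v hv t ht => ?_
    have hv : 0 < v := hv
    have h1 : HasDerivAt (fun t : ℝ => v ^ (b - 1) * Real.exp (-t * v))
        (v ^ (b - 1) * (Real.exp (-t * v) * (-1 * v))) t :=
      (((hasDerivAt_id t).neg.mul_const v).exp).const_mul _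
    refine (h1.ofReal_comp.mul_const (G v)).congr_deriv ?_
    rw [show b + 1 - 1 = (b - 1) + 1 by ring, Real.rpow_add hv, Real.rpow_one]
    push_cast
    ring

/-- The substitution u = pv moves p into the argument of G, so p → ∞ reads off G near 0 and p → 0
reads off G near infinity. -/
theorem mellinLaplace_eq_scaled {b p : ℝ} (G : ℝ → ℂ) (hp : 0 < p) :
    ((p ^ b : ℝ) : ℂ) * mellinLaplace b p G =
      ∫ u in Ioi (0 : ℝ), ((u ^ (b - 1) * Real.exp (-u) : ℝ) : ℂ) * G (u / p) := by
  have h := integral_comp_mul_left_Ioi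
    (fun u : ℝ => ((u ^ (b - 1) * Real.exp (-u) : ℝ) : ℂ) * G (u / p)) 0 hp
  have h2 : ∫ u in Ioi (0 : ℝ), ((u ^ (b - 1) * Real.exp (-u) : ℝ) : ℂ) * G (u / p) =
      p • ∫ v in Ioi (0 : ℝ),
        (((p * v) ^ (b - 1) * Real.exp (-(p * v)) : ℝ) : ℂ) * G (p * v / p) := by
    rw [h, mul_zero, smul_smul, mul_inv_cancel₀ hp.ne', one_smul]
  rw [h2, mellinLaplace, ← integral_const_mul, ← integral_smul]
  refine setIntegral_congr_fun measurableSet_Ioi fun v hv => ?_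
  have hv : 0 < v := hv
  simp only [Complex.real_smul]
  rw [mul_div_cancel_left₀ v hp.ne', Real.mul_rpow hp.le hv.le, ← neg_mul,
    show b = 1 + (b - 1) by ring, Real.rpow_add hp, Real.rpow_one, add_sub_cancel_left]
  push_cast
  ring

theorem Gamma_eq_integral_ofReal {b : ℝ} (hb : 0 < b) (z : ℂ) :
    ∫ u in Ioi (0 : ℝ), ((u ^ (b - 1) * Real.exp (-u) : ℝ) : ℂ) * z = Real.Gamma b * z := by
  rw [integral_mul_const, integral_complex_ofReal, Real.Gamma_eq_integral hb]
  simp_rw [mul_comm]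

theorem aestronglyMeasurable_mellin_integrand {b p : ℝ} {G : ℝ → ℂ} (hp : 0 < p)
    (hG : ContinuousOn G (Ioi 0)) :
    AEStronglyMeasurable (fun u : ℝ => ((u ^ (b - 1) * Real.exp (-u) : ℝ) : ℂ) * G (u / p))
      (volume.restrict (Ioi 0)) := by
  refine ContinuousOn.aestronglyMeasurable (ContinuousOn.mul (fun v hv => ?_) ?_)
    measurableSet_Ioi
  · refine ContinuousAt.continuousWithinAt ?_
    refine Complex.continuous_ofReal.continuousAt.comp ?_
    exact (Real.continuousAt_rpow_const _ _ (Or.inl (ne_of_gt hv))).mul (by fun_prop)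
  · exact hG.comp (by fun_prop) fun u hu => div_pos hu hp

/-- Abelian theorem at 0. For p ≥ 1 one has (1 + u/p)^Q ≤ (1 + u)^Q, which dominates the rescaled
integrand. -/
theorem tendsto_rpow_mul_mellinLaplace_atTop {b Q C : ℝ} {G : ℝ → ℂ} {G0 : ℂ} (hb : 0 < b)
    (hQ : 0 ≤ Q) (hG : ContinuousOn G (Ioi 0)) (bG : ∀ v > 0, ‖G v‖ ≤ C * (1 + v) ^ Q)
    (h0 : Tendsto G (𝓝[>] 0) (𝓝 G0)) :
    Tendsto (fun p : ℝ => ((p ^ b : ℝ) : ℂ) * mellinLaplace b p G) atTop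
      (𝓝 (Real.Gamma b * G0)) := by
  have hC : 0 ≤ C := by
    have := (norm_nonneg _).trans (bG 1 one_pos)
    have h2 : (0 : ℝ) < (1 + 1) ^ Q := by positivity
    exact nonneg_of_mul_nonneg_left this h2
  rw [← Gamma_eq_integral_ofReal hb]
  have : Tendsto (fun p : ℝ =>
      ∫ u in Ioi (0 : ℝ), ((u ^ (b - 1) * Real.exp (-u) : ℝ) : ℂ) * G (u / p)) atTop
      (𝓝 (∫ u in Ioi (0 : ℝ), ((u ^ (b - 1) * Real.exp (-u) : ℝ) : ℂ) * G0)) := by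
    refine tendsto_integral_filter_of_dominated_convergence
      (fun u => C * (u ^ (b - 1) * Real.exp (-1 * u) * (1 + u) ^ Q)) ?_ ?_
      ((integrableOn_rpow_mul_exp_mul_one_add_rpow hb one_pos hQ).const_mul C) ?_
    · filter_upwards [eventually_gt_atTop 0] with p hp
      exact aestronglyMeasurable_mellin_integrand hp hG
    · filter_upwards [eventually_ge_atTop 1] with p hp
      refine (ae_restrict_mem measurableSet_Ioi).mono fun u hu => ?_
      have hu : 0 < u := hu
      have h0 : 0 ≤ u ^ (b - 1) * Real.exp (-u) := by positivity
      rw [norm_mul, Complex.norm_real, Real.norm_of_nonneg h0, neg_one_mul]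
      have h1 : (1 + u / p) ^ Q ≤ (1 + u) ^ Q := by
        refine Real.rpow_le_rpow (by positivity) ?_ hQ
        linarith [div_le_self hu.le hp]
      calc _ ≤ u ^ (b - 1) * Real.exp (-u) * (C * (1 + u) ^ Q) := by
            refine mul_le_mul_of_nonneg_left ((bG _ (by positivity)).trans ?_) h0
            exact mul_le_mul_of_nonneg_left h1 hC
        _ = _ := by ring
    · refine (ae_restrict_mem measurableSet_Ioi).mono fun u hu => ?_
      have hu : 0 < u := hu
      refine Tendsto.const_mul _ (h0.comp ?_)
      refine tendsto_nhdsWithin_iff.mpr ⟨tendsto_const_nhds.div_atTop tendsto_id, ?_⟩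
      filter_upwards [eventually_gt_atTop 0] with p hp
      exact div_pos hu hp
  refine this.congr' ?_
  filter_upwards [eventually_gt_atTop 0] with p hp
  exact (mellinLaplace_eq_scaled G hp).symm

/-- Abelian theorem at infinity. The extra p^Q absorbs the growth of G: p^Q (1 + u/p)^Q = (p + u)^Q
≤ (1 + u)^Q for p < 1. -/
theorem tendsto_rpow_mul_mellinLaplace_zero {b Q C : ℝ} {G : ℝ → ℂ} {A : ℂ} (hb : 0 < b)
    (hQ : 0 ≤ Q) (hG : ContinuousOn G (Ioi 0)) (bG : ∀ v > 0, ‖G v‖ ≤ C * (1 + v) ^ Q)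
    (hA : Tendsto (fun v : ℝ => G v / ((v ^ Q : ℝ) : ℂ)) atTop (𝓝 A)) :
    Tendsto (fun p : ℝ => ((p ^ (b + Q) : ℝ) : ℂ) * mellinLaplace b p G) (𝓝[>] 0)
      (𝓝 (Real.Gamma (b + Q) * A)) := by
  have hC : 0 ≤ C := by
    have := (norm_nonneg _).trans (bG 1 one_pos)
    have h2 : (0 : ℝ) < (1 + 1) ^ Q := by positivity
    exact nonneg_of_mul_nonneg_left this h2
  rw [← Gamma_eq_integral_ofReal (by linarith : 0 < b + Q)]
  have : Tendsto (fun p : ℝ => ∫ u in Ioi (0 : ℝ),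
      ((p ^ Q : ℝ) : ℂ) * (((u ^ (b - 1) * Real.exp (-u) : ℝ) : ℂ) * G (u / p))) (𝓝[>] 0)
      (𝓝 (∫ u in Ioi (0 : ℝ), ((u ^ (b + Q - 1) * Real.exp (-u) : ℝ) : ℂ) * A)) := by
    refine tendsto_integral_filter_of_dominated_convergence
      (fun u => C * (u ^ (b - 1) * Real.exp (-1 * u) * (1 + u) ^ Q)) ?_ ?_
      ((integrableOn_rpow_mul_exp_mul_one_add_rpow hb one_pos hQ).const_mul C) ?_
    · filter_upwards [self_mem_nhdsWithin] with p hp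
      exact (aestronglyMeasurable_mellin_integrand hp hG).const_mul _
    · filter_upwards [self_mem_nhdsWithin, mem_nhdsWithin_of_mem_nhds (Iio_mem_nhds (zero_lt_one' ℝ))] with p hp hp1
      have hp : 0 < p := hp
      refine (ae_restrict_mem measurableSet_Ioi).mono fun u hu => ?_
      have hu : 0 < u := hu
      have h0 : 0 ≤ u ^ (b - 1) * Real.exp (-u) := by positivity
      have hpQ : 0 ≤ p ^ Q := by positivity
      rw [norm_mul, norm_mul, Complex.norm_real, Complex.norm_real, Real.norm_of_nonneg h0,
        Real.norm_of_nonneg hpQ, neg_one_mul]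
      have h1 : p ^ Q * (1 + u / p) ^ Q ≤ (1 + u) ^ Q := by
        rw [← Real.mul_rpow hp.le (by positivity)]
        refine Real.rpow_le_rpow (by positivity) ?_ hQ
        have : p * (1 + u / p) = p + u := by field_simp
        linarith [show p < 1 from hp1]
      calc _ ≤ p ^ Q * (u ^ (b - 1) * Real.exp (-u) * (C * (1 + u / p) ^ Q)) := by
            refine mul_le_mul_of_nonneg_left (mul_le_mul_of_nonneg_left ?_ h0) hpQ
            exact bG _ (by positivity)
        _ = C * (u ^ (b - 1) * Real.exp (-u)) * (p ^ Q * (1 + u / p) ^ Q) := by ring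
        _ ≤ C * (u ^ (b - 1) * Real.exp (-u)) * (1 + u) ^ Q :=
            mul_le_mul_of_nonneg_left h1 (by positivity)
        _ = _ := by ring
    · refine (ae_restrict_mem measurableSet_Ioi).mono fun u hu => ?_
      have hu : 0 < u := hu
      have ht : Tendsto (fun p : ℝ => u / p) (𝓝[>] 0) atTop :=
        Tendsto.const_mul_atTop hu tendsto_inv_nhdsGT_zero
      have h3 := (hA.comp ht).const_mul ((u ^ (b + Q - 1) * Real.exp (-u) : ℝ) : ℂ)
      refine h3.congr' ?_
      filter_upwards [self_mem_nhdsWithin] with p hp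
      have hp : 0 < p := hp
      have hpQ : ((p ^ Q : ℝ) : ℂ) ≠ 0 := by
        exact_mod_cast (Real.rpow_pos_of_pos hp Q).ne'
      have huQ : ((u ^ Q : ℝ) : ℂ) ≠ 0 := by
        exact_mod_cast (Real.rpow_pos_of_pos hu Q).ne'
      simp only [Function.comp_apply]
      rw [Real.div_rpow hu.le hp.le, show b + Q - 1 = (b - 1) + Q by ring, Real.rpow_add hu]
      simp only [Complex.ofReal_mul, Complex.ofReal_div]
      field_simp
  refine this.congr' ?_
  filter_upwards [self_mem_nhdsWithin] with p hp
  rw [integral_const_mul, ← mellinLaplace_eq_scaled G hp, ← mul_assoc, add_comm b Q,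
    Real.rpow_add hp]
  push_cast
  ring

/-- The connection formula between the regular solution at `0` and its growth at `∞` for
`v G'' + (b + R v) G' = R Q G`. -/
theorem kummer_connection {G G1 G2 : ℝ → ℂ} {b R Q C : ℝ} {G0 A : ℂ} (hb : 0 < b) (hR : 0 < R)
    (hQ : 0 ≤ Q) (hG : ∀ v > 0, HasDerivAt G (G1 v) v) (hG1 : ∀ v > 0, HasDerivAt G1 (G2 v) v)
    (bG : ∀ v > 0, ‖G v‖ ≤ C * (1 + v) ^ Q) (bG1 : ∀ v > 0, ‖G1 v‖ ≤ C * (1 + v) ^ Q)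
    (ode : ∀ v : ℝ, 0 < v → v * G2 v + (b + R * v) * G1 v - R * Q * G v = 0)
    (h0 : Tendsto G (𝓝[>] 0) (𝓝 G0))
    (hA : Tendsto (fun v : ℝ => G v / ((v ^ Q : ℝ) : ℂ)) atTop (𝓝 A)) :
    Real.Gamma (b + Q) * A = ((R ^ Q : ℝ) : ℂ) * (Real.Gamma b * G0) := by
  have hGc : ContinuousOn G (Ioi 0) := fun v hv => (hG v hv).continuousAt.continuousWithinAt
  have hG1c : ContinuousOn G1 (Ioi 0) := fun v hv => (hG1 v hv).continuousAt.continuousWithinAt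
  -- Integrating by parts once with G and once with G1, and eliminating the transforms of G1 and G2
  -- by the equation, leaves a relation between the transforms of G of orders b and b + 1.
  have rel : ∀ p : ℝ, 0 < p → (p + R : ℂ) * (p * mellinLaplace (b + 1) p G) =
      ((p + R) * b + R * Q) * mellinLaplace b p G := by
    intro p hp
    have j0 := integrableOn_mellinLaplace hb hp hQ hGc bG
    have j1 := integrableOn_mellinLaplace hb hp hQ hG1c bG1
    have j2 := integrableOn_mellinLaplace (a := b + 1) (by linarith) hp hQ hG1c bG1
    have j3 := integrableOn_mellinLaplace (a := b + 1) (by linarith) hp hQ hGc bG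
    have e1 := mellinLaplace_integral_by_parts hb hp hQ hG bG j2
    have hcg : ∀ v ∈ Ioi (0 : ℝ),
        R * Q * (((v ^ (b - 1) * Real.exp (-p * v) : ℝ) : ℂ) * G v)
        - b * (((v ^ (b - 1) * Real.exp (-p * v) : ℝ) : ℂ) * G1 v)
        - R * (((v ^ (b + 1 - 1) * Real.exp (-p * v) : ℝ) : ℂ) * G1 v)
        = ((v ^ (b + 1 - 1) * Real.exp (-p * v) : ℝ) : ℂ) * G2 v := by
      intro v hv
      have hv : 0 < v := hv
      have := ode v hv
      rw [show b + 1 - 1 = (b - 1) + 1 by ring, Real.rpow_add hv, Real.rpow_one]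
      push_cast
      linear_combination (-((v ^ (b - 1) : ℝ) : ℂ) * Complex.exp (-p * v)) * this
    have j12 : IntegrableOn (fun v : ℝ =>
        R * Q * (((v ^ (b - 1) * Real.exp (-p * v) : ℝ) : ℂ) * G v)
        - b * (((v ^ (b - 1) * Real.exp (-p * v) : ℝ) : ℂ) * G1 v)) (Ioi 0) :=
      (j0.const_mul (R * Q : ℂ)).sub (j1.const_mul (b : ℂ))
    have e2 := mellinLaplace_integral_by_parts hb hp hQ hG1 bG1
      (IntegrableOn.congr_fun (j12.sub (j2.const_mul (R : ℂ))) hcg measurableSet_Ioi)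
    have e3 : mellinLaplace (b + 1) p G2 = R * Q * mellinLaplace b p G -
        b * mellinLaplace b p G1 - R * mellinLaplace (b + 1) p G1 := by
      rw [mellinLaplace, ← setIntegral_congr_fun measurableSet_Ioi hcg,
        integral_sub j12 (j2.const_mul (R : ℂ)),
        integral_sub (j0.const_mul (R * Q : ℂ)) (j1.const_mul (b : ℂ)), integral_const_mul,
        integral_const_mul, integral_const_mul]
      rfl
    rw [e3] at e2
    linear_combination (-(p + R) : ℂ) * e1 - e2
  -- As the transform of order b + 1 is minus the p-derivative of that of order b, `rel` is the
  -- first-order equation M'/M = -(b + Q)/p + Q/(p + R). Its integrating factor is p^{b+Q} (p +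
  -- R)^{-Q}.
  have hder : ∀ p ∈ Ioi (0 : ℝ), HasDerivAt (fun p : ℝ =>
      ((p ^ (b + Q) * (p + R) ^ (-Q) : ℝ) : ℂ) * mellinLaplace b p G) 0 p := by
    intro p hp
    have hp : 0 < p := hp
    have hpR : 0 < p + R := by linarith
    have d1 := (Real.hasDerivAt_rpow_const (p := b + Q) (Or.inl hp.ne')).mul
      (((hasDerivAt_id p).add_const R).rpow_const (p := -Q) (Or.inl hpR.ne'))
    refine ((d1.ofReal_comp).mul (hasDerivAt_mellinLaplace hb hp hQ hGc bG)).congr_deriv ?_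
    have hr := rel p hp
    have hp0 : (p : ℂ) ≠ 0 := by exact_mod_cast hp.ne'
    have hpR0 : (p + R : ℂ) ≠ 0 := by exact_mod_cast hpR.ne'
    have hr2 : mellinLaplace (b + 1) p G = ((p + R) * b + R * Q) * mellinLaplace b p G
        / ((p + R) * p) := by
      rw [eq_div_iff (mul_ne_zero hpR0 hp0), ← hr]; ring
    simp only [id, Pi.mul_apply]
    rw [hr2, Real.rpow_sub_one hp.ne', Real.rpow_sub_one hpR.ne']
    push_cast
    field_simp
    ring
  have hconst : ∀ p ∈ Ioi (0 : ℝ), ((p ^ (b + Q) * (p + R) ^ (-Q) : ℝ) : ℂ) * mellinLaplace b p G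
      = (((1 : ℝ) ^ (b + Q) * (1 + R) ^ (-Q) : ℝ) : ℂ) * mellinLaplace b 1 G := by
    intro p hp
    exact isOpen_Ioi.is_const_of_deriv_eq_zero isPreconnected_Ioi
      (fun x hx => (hder x hx).differentiableAt.differentiableWithinAt)
      (fun x hx => (hder x hx).deriv) hp (mem_Ioi.mpr (zero_lt_one' ℝ))
  -- The constant value K is computed twice: p → ∞ gives Γ(b) G0, and p → 0+ gives R^{-Q} Γ(b + Q)
  -- A.
  set K := (((1 : ℝ) ^ (b + Q) * (1 + R) ^ (-Q) : ℝ) : ℂ) * mellinLaplace b 1 G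
  have l1 : Tendsto (fun _ : ℝ => K) atTop (𝓝 (((1 : ℝ) : ℂ) * (Real.Gamma b * G0))) := by
    have hq : Tendsto (fun p : ℝ => (((1 + R / p) ^ (-Q) : ℝ) : ℂ)) atTop (𝓝 ((1 : ℝ) : ℂ)) := by
      have h1 : Tendsto (fun p : ℝ => 1 + R / p) atTop (𝓝 1) := by
        simpa using (tendsto_const_nhds (x := (1 : ℝ))).add
          (tendsto_const_nhds (x := R).div_atTop tendsto_id)
      have := h1.rpow_const (p := -Q) (Or.inl one_ne_zero)
      rw [Real.one_rpow] at this
      exact (Complex.continuous_ofReal.tendsto 1).comp this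
    refine (hq.mul (tendsto_rpow_mul_mellinLaplace_atTop hb hQ hGc bG h0)).congr' ?_
    filter_upwards [eventually_gt_atTop 0] with p hp
    rw [← hconst p hp, show 1 + R / p = (p + R) / p by field_simp,
      Real.div_rpow (by positivity) hp.le, Real.rpow_add hp, Real.rpow_neg hp.le]
    have : ((p ^ Q : ℝ) : ℂ) ≠ 0 := by exact_mod_cast (Real.rpow_pos_of_pos hp Q).ne'
    push_cast
    field_simp
  have l2 : Tendsto (fun _ : ℝ => K) (𝓝[>] 0)
      (𝓝 (((R ^ (-Q) : ℝ) : ℂ) * (Real.Gamma (b + Q) * A))) := by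
    have hq : Tendsto (fun p : ℝ => (((p + R) ^ (-Q) : ℝ) : ℂ)) (𝓝[>] 0)
        (𝓝 ((R ^ (-Q) : ℝ) : ℂ)) := by
      have h1 : Tendsto (fun p : ℝ => p + R) (𝓝[>] 0) (𝓝 R) := by
        have : Tendsto (fun p : ℝ => p + R) (𝓝 0) (𝓝 (0 + R)) :=
          (continuous_id.add continuous_const).tendsto 0
        rw [zero_add] at this
        exact this.mono_left nhdsWithin_le_nhds
      exact (Complex.continuous_ofReal.tendsto _).comp (h1.rpow_const (Or.inl hR.ne'))
    refine (hq.mul (tendsto_rpow_mul_mellinLaplace_zero hb hQ hGc bG hA)).congr' ?_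
    filter_upwards [self_mem_nhdsWithin] with p hp
    rw [← hconst p hp]
    push_cast
    ring
  have e1 := tendsto_nhds_unique l1 tendsto_const_nhds
  have e2 := tendsto_nhds_unique l2 tendsto_const_nhds
  rw [Complex.ofReal_one, one_mul] at e1
  rw [e1, ← e2, Real.rpow_neg hR.le]
  have : ((R ^ Q : ℝ) : ℂ) ≠ 0 := by exact_mod_cast (Real.rpow_pos_of_pos hR Q).ne'
  push_cast
  field_simp

/-! ### Bent contours and their separation. -/

/-- The profile `√(1+y²) - 1` along which integration contours are bent to the left. -/
def bend (y : ℝ) : ℝ := Real.sqrt (1 + y ^ 2) - 1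

/-- The contour `y ↦ c - δ (√(1+y²) - 1) + i y`. -/
def bent (δ c y : ℝ) : ℂ := ((c - δ * bend y : ℝ) : ℂ) + (y : ℂ) * Complex.I

/-- The derivative of `bent δ c`. -/
def bentDeriv (δ y : ℝ) : ℂ := ((-(δ * (y / Real.sqrt (1 + y ^ 2))) : ℝ) : ℂ) + Complex.I

@[simp] theorem bent_re (δ c y : ℝ) : (bent δ c y).re = c - δ * bend y := by
  simp only [bent, Complex.add_re, Complex.ofReal_re, Complex.re_ofReal_mul, Complex.I_re,
    mul_zero, add_zero]

@[simp] theorem bent_im (δ c y : ℝ) : (bent δ c y).im = y := by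
  simp only [bent, Complex.add_im, Complex.ofReal_im, Complex.im_ofReal_mul, Complex.I_im,
    mul_one, zero_add]

@[simp] theorem bend_zero : bend 0 = 0 := by simp [bend]

theorem bent_zero_zero (δ : ℝ) : bent δ 0 0 = 0 := by simp [bent]

theorem bent_add (δ c v y : ℝ) : bent δ c y + v = bent δ (c + v) y := by
  simp only [bent]; push_cast; ring

theorem bend_nonneg (y : ℝ) : 0 ≤ bend y := by
  unfold bend
  have := Real.one_le_sqrt.mpr (show (1 : ℝ) ≤ 1 + y ^ 2 by nlinarith [sq_nonneg y])
  linarith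

theorem abs_sub_one_le_bend (y : ℝ) : |y| - 1 ≤ bend y := by
  unfold bend
  have := Real.abs_le_sqrt (show y ^ 2 ≤ 1 + y ^ 2 by linarith)
  linarith

/-- Cauchy–Schwarz in the form 1 + xy ≤ √(1+x²) √(1+y²). The Lipschitz constant 1 is what keeps
contours with different c uniformly apart. -/
theorem abs_bend_sub_le (x y : ℝ) : |bend x - bend y| ≤ |x - y| := by
  unfold bend
  set a := Real.sqrt (1 + x ^ 2) with ha
  set b := Real.sqrt (1 + y ^ 2) with hb
  have ha2 : a ^ 2 = 1 + x ^ 2 := Real.sq_sqrt (by positivity)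
  have hb2 : b ^ 2 = 1 + y ^ 2 := Real.sq_sqrt (by positivity)
  have ha0 : 0 ≤ a := Real.sqrt_nonneg _
  have hb0 : 0 ≤ b := Real.sqrt_nonneg _
  have hab : 1 + x * y ≤ a * b := by
    rw [ha, hb, ← Real.sqrt_mul (by positivity)]
    apply Real.le_sqrt_of_sq_le
    nlinarith [sq_nonneg (x - y)]
  rw [show a - 1 - (b - 1) = a - b by ring]
  apply sq_le_sq.mp
  nlinarith

theorem bend_le_abs (y : ℝ) : bend y ≤ |y| := by
  have := abs_bend_sub_le y 0
  rw [bend_zero, sub_zero, sub_zero, abs_of_nonneg (bend_nonneg y)] at this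
  exact this

@[fun_prop] theorem continuous_bend : Continuous bend := by
  unfold bend; fun_prop

@[fun_prop] theorem continuous_bent (δ c : ℝ) : Continuous (bent δ c) := by
  unfold bent; fun_prop

@[fun_prop] theorem continuous_bentDeriv (δ : ℝ) : Continuous (bentDeriv δ) := by
  unfold bentDeriv
  have : ∀ y : ℝ, Real.sqrt (1 + y ^ 2) ≠ 0 := fun y => (Real.sqrt_pos.mpr (by positivity)).ne'
  fun_prop (disch := exact this _)

theorem hasDerivAt_bend (y : ℝ) : HasDerivAt bend (y / Real.sqrt (1 + y ^ 2)) y := by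
  have h : HasDerivAt (fun y : ℝ => 1 + y ^ 2) (2 * y) y := by
    simpa using (hasDerivAt_pow 2 y).const_add 1
  refine ((h.sqrt (by positivity)).sub_const 1).congr_deriv ?_
  field_simp

theorem hasDerivAt_bent (δ c y : ℝ) : HasDerivAt (bent δ c) (bentDeriv δ y) y := by
  have h1 := (((hasDerivAt_bend y).const_mul δ).const_sub c).ofReal_comp
  have h2 := ((hasDerivAt_id y).ofReal_comp).mul_const Complex.I
  refine (h1.add h2).congr_deriv ?_
  simp [bentDeriv]

theorem bentDeriv_ne_zero (δ y : ℝ) : bentDeriv δ y ≠ 0 := by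
  intro h
  have := congrArg Complex.im h
  simp [bentDeriv] at this

theorem one_le_norm_bentDeriv (δ y : ℝ) : 1 ≤ ‖bentDeriv δ y‖ := by
  have := Complex.abs_im_le_norm (bentDeriv δ y)
  simpa only [bentDeriv, Complex.add_im, Complex.ofReal_im, Complex.I_im, zero_add, abs_one]
    using this

theorem norm_bentDeriv_le {δ : ℝ} (hδ : 0 ≤ δ) (y : ℝ) : ‖bentDeriv δ y‖ ≤ 1 + δ := by
  unfold bentDeriv
  refine (norm_add_le _ _).trans ?_
  rw [Complex.norm_real, Complex.norm_I, norm_neg, Real.norm_eq_abs, abs_mul, abs_div,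
    abs_of_nonneg hδ, abs_of_nonneg (Real.sqrt_nonneg _)]
  have h1 : |y| / Real.sqrt (1 + y ^ 2) ≤ 1 := by
    rw [div_le_one (Real.sqrt_pos.mpr (by positivity))]
    exact Real.abs_le_sqrt (by linarith)
  nlinarith

/-- The contours are horizontal translates of one another, so the difference is real only at equal
heights, where it equals c' - c > 0. -/
theorem bent_sub_mem_slitPlane {δ c c' : ℝ} (h : c < c') (y y' : ℝ) :
    bent δ c' y' - bent δ c y ∈ Complex.slitPlane := by
  rw [Complex.mem_slitPlane_iff]
  by_cases hy : y' = y
  · left; subst hy; simp only [Complex.sub_re, bent_re]; linarith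
  · right; simp only [Complex.sub_im, bent_im]; exact sub_ne_zero.mpr hy

/-- The horizontal gap is at least c' - c - δ|y' - y|. It and the vertical gap |y' - y| are both at
most the norm, so (1 + δ) times the norm is at least c' - c. -/
theorem le_norm_bent_sub {δ c c' : ℝ} (hδ : 0 ≤ δ) (y y' : ℝ) :
    (c' - c) / (1 + δ) ≤ ‖bent δ c' y' - bent δ c y‖ := by
  have h1 := Complex.abs_im_le_norm (bent δ c' y' - bent δ c y)
  have h2 := Complex.re_le_norm (bent δ c' y' - bent δ c y)
  simp only [Complex.sub_re, bent_re, Complex.sub_im, bent_im] at h1 h2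
  have h3 := le_of_abs_le (abs_bend_sub_le y' y)
  rw [div_le_iff₀ (by positivity)]
  nlinarith

theorem bent_mem_slitPlane {δ c : ℝ} (h : 0 < c) (y : ℝ) : bent δ c y ∈ Complex.slitPlane := by
  -- The origin is itself the point y = 0 of the contour with c = 0.
  have := bent_sub_mem_slitPlane (δ := δ) h 0 y
  rwa [bent_zero_zero, sub_zero] at this

theorem le_norm_bent {δ c : ℝ} (hδ : 0 ≤ δ) (y : ℝ) : c / (1 + δ) ≤ ‖bent δ c y‖ := by
  have := le_norm_bent_sub (c := 0) (c' := c) hδ 0 y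
  rwa [bent_zero_zero, sub_zero, sub_zero] at this

theorem neg_le_norm_bent {δ c : ℝ} (hδ : 0 ≤ δ) (y : ℝ) : -c / (1 + δ) ≤ ‖bent δ c y‖ := by
  have := le_norm_bent_sub (c := c) (c' := 0) hδ y 0
  rwa [bent_zero_zero, zero_sub, zero_sub, norm_neg] at this

theorem abs_le_norm_bent (δ c y : ℝ) : |y| ≤ ‖bent δ c y‖ := by
  simpa only [bent_im] using Complex.abs_im_le_norm (bent δ c y)

theorem norm_bent_le {δ : ℝ} (hδ : 0 ≤ δ) (c y : ℝ) : ‖bent δ c y‖ ≤ |c| + (1 + δ) * |y| := by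
  refine (Complex.norm_le_abs_re_add_abs_im _).trans ?_
  rw [bent_re, bent_im]
  have h1 : |c - δ * bend y| ≤ |c| + δ * |y| := by
    refine (abs_sub _ _).trans ?_
    rw [abs_mul, abs_of_nonneg hδ, abs_of_nonneg (bend_nonneg y)]
    nlinarith [bend_le_abs y]
  linarith

/-! ### Moving contours to the left: Cauchy's theorem and a residue. -/

/-- The open region to the left of the contour `bent δ c`. -/
def leftOf (δ c : ℝ) : Set ℂ := {z | z.re + δ * bend z.im < c}

theorem isOpen_leftOf (δ c : ℝ) : IsOpen (leftOf δ c) := by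
  refine isOpen_lt ?_ continuous_const
  exact Complex.continuous_re.add (continuous_const.mul (continuous_bend.comp Complex.continuous_im))

theorem bent_mem_leftOf {δ c c' : ℝ} (y : ℝ) : bent δ c y ∈ leftOf δ c' ↔ c < c' := by
  simp [leftOf]

theorem eq_bent_of_mem_leftOf {δ c : ℝ} {z : ℂ} (hz : z ∈ leftOf δ c) :
    ∃ c' < c, z = bent δ c' z.im :=
  ⟨z.re + δ * bend z.im, hz, by apply Complex.ext <;> simp⟩

/-- Cauchy's theorem pulled back to the parameters (c, y): the field (f ∂_y z, -f ∂_c z), with ∂_c z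
= 1, is divergence free because both mixed terms equal f'(z) ∂_y z. The divergence theorem on a
rectangle then suffices. -/
theorem intervalIntegral_bent_shift {f : ℂ → ℂ} {δ c₁ c₂ c₃ : ℝ} (h12 : c₁ ≤ c₂) (h23 : c₂ < c₃)
    (hf : DifferentiableOn ℂ f (leftOf δ c₃)) (Y : ℝ) :
    (∫ y in -Y..Y, f (bent δ c₂ y) * bentDeriv δ y) -
      ∫ y in -Y..Y, f (bent δ c₁ y) * bentDeriv δ y =
    (∫ c in c₁..c₂, f (bent δ c Y)) - ∫ c in c₁..c₂, f (bent δ c (-Y)) := by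
  have hB : Differentiable ℝ (fun p : ℝ × ℝ => bent δ p.1 p.2) := by
    intro p
    have h1 : DifferentiableAt ℝ (fun p : ℝ × ℝ => bend p.2) p :=
      (hasDerivAt_bend p.2).differentiableAt.comp p differentiableAt_snd
    unfold bent
    fun_prop
  have hD : Differentiable ℝ (fun p : ℝ × ℝ => bentDeriv δ p.2) := by
    intro p
    have h1 : Real.sqrt (1 + p.2 ^ 2) ≠ 0 := (Real.sqrt_pos.mpr (by positivity)).ne'
    have h2 : 1 + p.2 ^ 2 ≠ 0 := by positivity
    unfold bentDeriv
    fun_prop (disch := assumption)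
  have hfd : ∀ p : ℝ × ℝ, p.1 ≤ c₂ → DifferentiableAt ℂ f (bent δ p.1 p.2) := fun p hp =>
    hf.differentiableAt ((isOpen_leftOf δ c₃).mem_nhds ((bent_mem_leftOf _).mpr (by linarith)))
  have hF1 : ∀ p : ℝ × ℝ, p.1 ≤ c₂ →
      DifferentiableAt ℝ (fun p : ℝ × ℝ => f (bent δ p.1 p.2)) p := fun p hp =>
    ((hfd p hp).restrictScalars ℝ).comp p (hB p)
  have hF : ∀ p : ℝ × ℝ, p.1 ≤ c₂ →
      DifferentiableAt ℝ (fun p : ℝ × ℝ => f (bent δ p.1 p.2) * bentDeriv δ p.2) p :=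
    fun p hp => (hF1 p hp).mul (hD p)
  have hle : ∀ p ∈ uIcc c₁ c₂ ×ˢ uIcc (-Y) Y, p.1 ≤ c₂ := by
    intro p hp; rw [uIcc_of_le h12] at hp; exact hp.1.2
  have hdiv : ∀ p : ℝ × ℝ, p.1 ≤ c₂ →
      fderiv ℝ (fun p : ℝ × ℝ => f (bent δ p.1 p.2) * bentDeriv δ p.2) p (1, 0) +
      fderiv ℝ (fun p : ℝ × ℝ => -f (bent δ p.1 p.2)) p (0, 1) = 0 := by
    intro p hp
    have e1 := (hF p hp).hasFDerivAt.comp_hasDerivAt p.1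
      ((hasDerivAt_id p.1).prodMk (hasDerivAt_const p.1 p.2))
    have e2 := ((hF1 p hp).neg).hasFDerivAt.comp_hasDerivAt p.2
      ((hasDerivAt_const p.2 p.1).prodMk (hasDerivAt_id p.2))
    have b1 : HasDerivAt (fun c : ℝ => bent δ c p.2) 1 p.1 := by
      unfold bent
      simpa using (((hasDerivAt_id p.1).sub_const (δ * bend p.2)).ofReal_comp).add_const
        ((p.2 : ℂ) * Complex.I)
    have d1 := ((hfd p hp).hasDerivAt.comp p.1 b1).mul_const (bentDeriv δ p.2)
    have d2 := ((hfd p hp).hasDerivAt.comp p.2 (hasDerivAt_bent δ p.1 p.2)).neg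
    have u1 := e1.unique d1
    have u2 := e2.unique d2
    have v1 : fderiv ℝ (fun p : ℝ × ℝ => f (bent δ p.1 p.2) * bentDeriv δ p.2) p (1, 0) =
      deriv f (bent δ p.1 p.2) * 1 * bentDeriv δ p.2 := u1
    have v2 : fderiv ℝ (fun p : ℝ × ℝ => -f (bent δ p.1 p.2)) p (0, 1) =
      -(deriv f (bent δ p.1 p.2) * bentDeriv δ p.2) := u2
    rw [v1, v2]; ring
  have hmin : ∀ p ∈ Ioo (min c₁ c₂) (max c₁ c₂) ×ˢ Ioo (min (-Y) Y) (max (-Y) Y),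
      (p : ℝ × ℝ).1 ≤ c₂ := by
    intro p hp
    have := hp.1.2
    rw [max_eq_right h12] at this
    exact this.le
  have key := integral2_divergence_prod_of_hasFDerivAt
    (fun p : ℝ × ℝ => f (bent δ p.1 p.2) * bentDeriv δ p.2)
    (fun p : ℝ × ℝ => -f (bent δ p.1 p.2))
    (fderiv ℝ (fun p : ℝ × ℝ => f (bent δ p.1 p.2) * bentDeriv δ p.2))
    (fderiv ℝ (fun p : ℝ × ℝ => -f (bent δ p.1 p.2))) c₁ (-Y) c₂ Y
    (fun p hp => (hF p (hle p hp)).continuousAt.continuousWithinAt)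
    (fun p hp => (hF1 p (hle p hp)).neg.continuousAt.continuousWithinAt)
    (fun p hp => (hF p (hmin p hp)).hasFDerivAt)
    (fun p hp => ((hF1 p (hmin p hp)).neg).hasFDerivAt)
    (IntegrableOn.congr_fun integrableOn_zero (fun p hp => (hdiv p (hle p hp)).symm)
      (measurableSet_uIcc.prod measurableSet_uIcc))
  have hz : (∫ x in c₁..c₂, ∫ y in -Y..Y,
      fderiv ℝ (fun p : ℝ × ℝ => f (bent δ p.1 p.2) * bentDeriv δ p.2) (x, y) (1, 0) +
      fderiv ℝ (fun p : ℝ × ℝ => -f (bent δ p.1 p.2)) (x, y) (0, 1)) = 0 := by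
    have : ∀ x ∈ uIcc c₁ c₂, (∫ y in -Y..Y,
      fderiv ℝ (fun p : ℝ × ℝ => f (bent δ p.1 p.2) * bentDeriv δ p.2) (x, y) (1, 0) +
      fderiv ℝ (fun p : ℝ × ℝ => -f (bent δ p.1 p.2)) (x, y) (0, 1)) = 0 := by
      intro x hx
      rw [uIcc_of_le h12] at hx
      rw [intervalIntegral.integral_congr (g := fun _ => 0) (fun y _ => hdiv (x, y) hx.2)]
      simp
    rw [intervalIntegral.integral_congr (g := fun _ => 0) this]
    simp
  rw [hz] at key
  simp only [intervalIntegral.integral_neg] at key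
  linear_combination -key

theorem integrable_of_norm_le_div_one_add_sq {g : ℝ → ℂ} (hg : Continuous g) {K r : ℝ}
    (hK : 0 ≤ K) (h : ∀ y, r ≤ |y| → ‖g y‖ ≤ K / (1 + y ^ 2)) : Integrable g := by
  obtain ⟨M, hM⟩ := (isCompact_Icc (a := -r) (b := r)).exists_bound_of_continuousOn hg.continuousOn
  refine Integrable.mono' (integrable_inv_one_add_sq.const_mul (|M| * (1 + r ^ 2) + K))
    hg.aestronglyMeasurable (Eventually.of_forall fun y => ?_)
  rw [← div_eq_mul_inv]
  rcases le_or_gt r |y| with hy | hy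
  · refine (h y hy).trans ?_
    gcongr
    linarith [show 0 ≤ |M| * (1 + r ^ 2) by positivity]
  · rw [le_div_iff₀ (by positivity)]
    have h1 := (hM y (abs_le.mp hy.le)).trans (le_abs_self M)
    have h2 : y ^ 2 ≤ r ^ 2 := sq_le_sq.mpr (hy.le.trans (le_abs_self r))
    have h3 : ‖g y‖ * (1 + y ^ 2) ≤ |M| * (1 + r ^ 2) := by gcongr
    linarith

/-- Decay of order |z|⁻² makes the horizontal sides negligible, so the contour can be moved to c =
-n. There |z| ≥ n/(1 + δ) everywhere, and the integral tends to 0 by domination. -/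
theorem integral_bent_eq_zero {f : ℂ → ℂ} {δ c₀ c₃ B r : ℝ} (hδ : 0 < δ) (h03 : c₀ < c₃)
    (hr : 1 ≤ r) (hf : DifferentiableOn ℂ f (leftOf δ c₃))
    (hB : ∀ c ≤ c₀, ∀ y, r ≤ ‖bent δ c y‖ → ‖f (bent δ c y)‖ ≤ B / ‖bent δ c y‖ ^ 2) :
    Integrable (fun y => f (bent δ c₀ y) * bentDeriv δ y) ∧
      ∫ y, f (bent δ c₀ y) * bentDeriv δ y = 0 := by
  have hB0 : 0 ≤ B := by
    have h1 := hB c₀ le_rfl r ((le_abs_self r).trans (abs_le_norm_bent δ c₀ r))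
    have h2 : 0 < ‖bent δ c₀ r‖ := by
      have := (le_abs_self r).trans (abs_le_norm_bent δ c₀ r)
      linarith
    have h3 := (norm_nonneg _).trans h1
    rw [le_div_iff₀ (by positivity)] at h3
    linarith
  have hcont : ∀ c ≤ c₀, Continuous fun y => f (bent δ c y) * bentDeriv δ y := by
    intro c hc
    refine Continuous.mul (continuous_iff_continuousAt.mpr fun y => ?_) (continuous_bentDeriv δ)
    refine ContinuousAt.comp ?_ (continuous_bent δ c).continuousAt
    exact (hf.differentiableAt ((isOpen_leftOf δ c₃).mem_nhds
      ((bent_mem_leftOf y).mpr (by linarith)))).continuousAt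
  have hbd : ∀ c ≤ c₀, ∀ y, r ≤ ‖bent δ c y‖ →
      ‖f (bent δ c y) * bentDeriv δ y‖ ≤ (2 * B * (1 + δ)) / (1 + y ^ 2) := by
    intro c hc y hy
    have h1 : 1 + y ^ 2 ≤ 2 * ‖bent δ c y‖ ^ 2 := by
      have := abs_le_norm_bent δ c y
      have h4 : y ^ 2 ≤ ‖bent δ c y‖ ^ 2 := by
        rw [← sq_abs]; gcongr
      nlinarith
    rw [norm_mul]
    calc _ ≤ B / ‖bent δ c y‖ ^ 2 * (1 + δ) := by
          refine mul_le_mul (hB c hc y hy) (norm_bentDeriv_le hδ.le y) (norm_nonneg _) ?_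
          positivity
      _ = (2 * B * (1 + δ)) / (2 * ‖bent δ c y‖ ^ 2) := by field_simp
      _ ≤ _ := by gcongr
  have hint : ∀ c ≤ c₀, Integrable fun y => f (bent δ c y) * bentDeriv δ y := fun c hc =>
    integrable_of_norm_le_div_one_add_sq (hcont c hc) (by positivity)
      fun y hy => hbd c hc y (hy.trans (abs_le_norm_bent δ c y))
  have hshift : ∀ c₁ ≤ c₀, ∫ y, f (bent δ c₀ y) * bentDeriv δ y =
      ∫ y, f (bent δ c₁ y) * bentDeriv δ y := by
    intro c₁ h1
    have t1 := (intervalIntegral_tendsto_integral (hint c₀ le_rfl) tendsto_neg_atTop_atBot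
      tendsto_id).sub (intervalIntegral_tendsto_integral (hint c₁ h1) tendsto_neg_atTop_atBot
      tendsto_id)
    have t2 : Tendsto (fun Y : ℝ => 2 * (B * |c₀ - c₁|) * (Y⁻¹) ^ 2) atTop (𝓝 0) := by
      simpa using (tendsto_inv_atTop_zero.pow 2).const_mul (2 * (B * |c₀ - c₁|))
    refine sub_eq_zero.mp (tendsto_nhds_unique t1 (squeeze_zero_norm' ?_ t2))
    filter_upwards [eventually_ge_atTop r] with Y hY
    have hY0 : 0 < Y := by linarith
    simp only [id]
    rw [intervalIntegral_bent_shift h1 h03 hf Y]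
    have hside : ∀ Y' : ℝ, |Y'| = Y →
        ‖∫ c in c₁..c₀, f (bent δ c Y')‖ ≤ B / Y ^ 2 * |c₀ - c₁| := by
      intro Y' hY'
      refine intervalIntegral.norm_integral_le_of_norm_le_const fun c hc => ?_
      rw [uIoc_of_le h1] at hc
      have h2 : Y ≤ ‖bent δ c Y'‖ := hY' ▸ abs_le_norm_bent δ c Y'
      refine (hB c hc.2 Y' (hY.trans h2)).trans ?_
      gcongr
    refine (norm_sub_le _ _).trans ((add_le_add (hside Y (abs_of_pos hY0))
      (hside (-Y) (by rw [abs_neg, abs_of_pos hY0]))).trans (le_of_eq ?_))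
    field_simp
    ring
  have t3 : Tendsto (fun n : ℕ => ∫ y, f (bent δ (-(n : ℝ)) y) * bentDeriv δ y) atTop
      (𝓝 (∫ _ : ℝ, (0 : ℂ))) := by
    have hn : ∀ᶠ n : ℕ in atTop, -(n : ℝ) ≤ c₀ ∧ (1 + δ) * r ≤ n := by
      filter_upwards [tendsto_natCast_atTop_atTop.eventually_ge_atTop (-c₀),
        tendsto_natCast_atTop_atTop.eventually_ge_atTop ((1 + δ) * r)] with n h1 h2
      exact ⟨by linarith, h2⟩
    have hlow : ∀ n : ℕ, ∀ y : ℝ, (n : ℝ) / (1 + δ) ≤ ‖bent δ (-(n : ℝ)) y‖ := by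
      intro n y
      have := neg_le_norm_bent (c := -(n : ℝ)) hδ.le y
      rwa [neg_neg] at this
    have hrn : ∀ n : ℕ, (1 + δ) * r ≤ n → ∀ y : ℝ, r ≤ ‖bent δ (-(n : ℝ)) y‖ := by
      intro n hn y
      refine le_trans ?_ (hlow n y)
      rw [le_div_iff₀ (by positivity)]; linarith
    refine tendsto_integral_filter_of_dominated_convergence
      (fun y => (2 * B * (1 + δ)) * (1 + y ^ 2)⁻¹) ?_ ?_
      (integrable_inv_one_add_sq.const_mul _) ?_
    · filter_upwards [hn] with n hn
      exact (hcont _ hn.1).aestronglyMeasurable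
    · filter_upwards [hn] with n hn
      refine Eventually.of_forall fun y => ?_
      rw [← div_eq_mul_inv]
      exact hbd _ hn.1 y (hrn n hn.2 y)
    · refine Eventually.of_forall fun y => ?_
      have t4 : Tendsto (fun n : ℕ => B * (1 + δ) ^ 3 * ((n : ℝ)⁻¹) ^ 2) atTop (𝓝 0) := by
        have := ((tendsto_inv_atTop_nhds_zero_nat (𝕜 := ℝ)).pow 2).const_mul (B * (1 + δ) ^ 3)
        rwa [zero_pow two_ne_zero, mul_zero] at this
      refine squeeze_zero_norm' ?_ t4
      filter_upwards [hn] with n hn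
      have hn0 : 0 < (n : ℝ) := lt_of_lt_of_le (by positivity) hn.2
      rw [norm_mul]
      calc _ ≤ B / ‖bent δ (-(n : ℝ)) y‖ ^ 2 * (1 + δ) :=
            mul_le_mul (hB _ hn.1 y (hrn n hn.2 y)) (norm_bentDeriv_le hδ.le y) (norm_nonneg _)
              (by positivity)
        _ ≤ B / ((n : ℝ) / (1 + δ)) ^ 2 * (1 + δ) := by
            have := hlow n y
            gcongr
        _ = _ := by field_simp
  rw [integral_zero] at t3
  refine ⟨hint c₀ le_rfl, ?_⟩
  refine tendsto_nhds_unique (tendsto_const_nhds.congr' ?_) t3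
  filter_upwards [tendsto_natCast_atTop_atTop.eventually_ge_atTop (-c₀)] with n hn
  exact hshift _ (by linarith)

theorem tendsto_bent_div_sub {δ c a : ℝ} (l : Filter ℝ) (hl : Tendsto (fun y : ℝ => |y|) l atTop) :
    Tendsto (fun y => bent δ c y / (a - bent δ c y)) l (𝓝 (-1)) := by
  have h1 : Tendsto (fun y => ‖bent δ c y‖) l atTop :=
    tendsto_atTop_mono (fun y => abs_le_norm_bent δ c y) hl
  have h2 : Tendsto (fun y => (a : ℂ) / bent δ c y) l (𝓝 0) := by
    refine tendsto_zero_iff_norm_tendsto_zero.mpr ?_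
    simp only [norm_div]
    exact tendsto_const_nhds.div_atTop h1
  have h3 : Tendsto (fun y => 1 / ((a : ℂ) / bent δ c y - 1)) l (𝓝 (1 / (0 - 1))) :=
    tendsto_const_nhds.div (h2.sub_const 1) (by norm_num)
  rw [show (1 : ℂ) / (0 - 1) = -1 by norm_num] at h3
  refine h3.congr' ?_
  filter_upwards [h1.eventually_gt_atTop 0] with y hy
  have : bent δ c y ≠ 0 := norm_pos_iff.mp hy
  rw [div_sub_one this, one_div_div]

theorem bent_div_sub_im (δ c a y : ℝ) :
    (bent δ c y / (a - bent δ c y)).im = a * y / Complex.normSq (a - bent δ c y) := by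
  rw [Complex.div_im, ← sub_div]
  congr 1
  simp
  ring

/-- A primitive of the integrand is log(z/(a - z)). Along the contour z/(a - z) avoids the negative
axis and travels from -1 back to -1, its argument going from -π to π. -/
theorem integral_bent_kernel {δ c a : ℝ} (hδ : 0 ≤ δ) (hc : 0 < c) (ha : c < a) :
    Integrable (fun y => (a / (bent δ c y * (a - bent δ c y))) * bentDeriv δ y) ∧
      ∫ y, (a / (bent δ c y * (a - bent δ c y))) * bentDeriv δ y = 2 * Real.pi * Complex.I := by
  have haz : ∀ y, (a : ℂ) - bent δ c y ∈ Complex.slitPlane := by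
    intro y
    have := bent_sub_mem_slitPlane (δ := δ) ha y 0
    have e : bent δ a 0 = a := by simp [bent]
    rwa [e] at this
  have hz0 : ∀ y, bent δ c y ≠ 0 := fun y => Complex.slitPlane_ne_zero (bent_mem_slitPlane hc y)
  have haz0 : ∀ y, (a : ℂ) - bent δ c y ≠ 0 := fun y => Complex.slitPlane_ne_zero (haz y)
  have hns : ∀ y, 0 < Complex.normSq (a - bent δ c y) := fun y => Complex.normSq_pos.mpr (haz0 y)
  have ha0 : 0 < a := hc.trans ha
  have hw : ∀ y, bent δ c y / (a - bent δ c y) ∈ Complex.slitPlane := by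
    intro y
    rw [Complex.mem_slitPlane_iff]
    by_cases hy : y = 0
    · left
      subst hy
      have : bent δ c 0 = c := by simp [bent]
      rw [this, ← Complex.ofReal_sub, ← Complex.ofReal_div, Complex.ofReal_re]
      exact div_pos hc (by linarith)
    · right
      rw [bent_div_sub_im]
      exact div_ne_zero (mul_ne_zero ha0.ne' hy) (hns y).ne'
  have hder : ∀ y, HasDerivAt (fun y => Complex.log (bent δ c y / (a - bent δ c y)))
      ((a / (bent δ c y * (a - bent δ c y))) * bentDeriv δ y) y := by
    intro y
    have h1 := (hasDerivAt_bent δ c y).fun_div ((hasDerivAt_bent δ c y).const_sub (a : ℂ)) (haz0 y)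
    refine (h1.clog_real (hw y)).congr_deriv ?_
    have := hz0 y
    have := haz0 y
    field_simp
    ring
  have hint : Integrable fun y => (a / (bent δ c y * (a - bent δ c y))) * bentDeriv δ y := by
    refine integrable_of_norm_le_div_one_add_sq (K := 2 * a * (1 + δ)) (r := 1) ?_
      (by positivity) fun y hy => ?_
    · refine (continuous_const.div (by fun_prop) fun y => mul_ne_zero (hz0 y) (haz0 y)).mul
        (continuous_bentDeriv δ)
    · have h2 : |y| ≤ ‖(a : ℂ) - bent δ c y‖ := by
        have := Complex.abs_im_le_norm ((a : ℂ) - bent δ c y)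
        simpa only [Complex.sub_im, Complex.ofReal_im, bent_im, zero_sub, abs_neg] using this
      have h3 : (1 + y ^ 2) / 2 ≤ ‖bent δ c y‖ * ‖(a : ℂ) - bent δ c y‖ := by
        have := mul_le_mul (abs_le_norm_bent δ c y) h2 (abs_nonneg y) (norm_nonneg _)
        rw [abs_mul_abs_self] at this
        have h5 : 1 ≤ y ^ 2 := by rw [← sq_abs]; nlinarith
        nlinarith
      rw [norm_mul, norm_div, norm_mul, Complex.norm_real, Real.norm_of_nonneg ha0.le]
      calc _ ≤ a / ((1 + y ^ 2) / 2) * (1 + δ) := by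
            refine mul_le_mul ?_ (norm_bentDeriv_le hδ y) (norm_nonneg _) (by positivity)
            gcongr
        _ = _ := by field_simp
  -- The imaginary part of z/(a - z) has the sign of y, so -1 is approached from above the cut as y
  -- → +∞ and from below as y → -∞.
  have htop : Tendsto (fun y => Complex.log (bent δ c y / (a - bent δ c y))) atTop
      (𝓝 (Real.pi * Complex.I)) := by
    have h := Complex.tendsto_log_nhdsWithin_im_nonneg_of_re_neg_of_im_zero
      (z := (-1 : ℂ)) (by norm_num) (by norm_num)
    simp only [norm_neg, norm_one, Real.log_one, Complex.ofReal_zero, zero_add] at h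
    refine h.comp (tendsto_nhdsWithin_iff.mpr
      ⟨tendsto_bent_div_sub _ tendsto_abs_atTop_atTop, ?_⟩)
    filter_upwards [eventually_ge_atTop 0] with y hy
    rw [bent_div_sub_im]
    have := hns y
    positivity
  have hbot : Tendsto (fun y => Complex.log (bent δ c y / (a - bent δ c y))) atBot
      (𝓝 (-(Real.pi * Complex.I))) := by
    have h := Complex.tendsto_log_nhdsWithin_im_neg_of_re_neg_of_im_zero
      (z := (-1 : ℂ)) (by norm_num) (by norm_num)
    simp only [norm_neg, norm_one, Real.log_one, Complex.ofReal_zero, zero_sub] at h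
    refine h.comp (tendsto_nhdsWithin_iff.mpr
      ⟨tendsto_bent_div_sub _ tendsto_abs_atBot_atTop, ?_⟩)
    filter_upwards [eventually_lt_atBot 0] with y hy
    rw [bent_div_sub_im]
    exact div_neg_of_neg_of_pos (mul_neg_of_pos_of_neg ha0 hy) (hns y)
  refine ⟨hint, ?_⟩
  rw [integral_of_hasDerivAt_of_tendsto hder hint hbot htop]
  ring

/-- Residue at the origin for a contour that can be closed to the left. -/
theorem integral_bent_exp_mul_div {h : ℂ → ℂ} {δ c₀ c₃ q C : ℝ} (hδ : 0 < δ) (hc : 0 < c₀)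
    (h03 : c₀ < c₃) (hq : 0 < q) (hh : DifferentiableOn ℂ h (leftOf δ c₃))
    (hC : ∀ c ≤ c₀, ∀ y, ‖h (bent δ c y)‖ ≤ C) :
    ∫ y, (Complex.exp (q * bent δ c₀ y) * h (bent δ c₀ y) / bent δ c₀ y) * bentDeriv δ y =
      2 * Real.pi * Complex.I * h 0 := by
  have h30 : 0 < c₃ := hc.trans h03
  have hC0 : 0 ≤ C := (norm_nonneg _).trans (hC c₀ le_rfl 0)
  -- The subtracted term makes K vanish at 0, so K(z)/z extends holomorphically. Its pole c₃ lies
  -- outside `leftOf δ c₃`, and its own contribution is `integral_bent_kernel`.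
  set K : ℂ → ℂ := fun z => Complex.exp (q * z) * h z - h 0 * (c₃ / (c₃ - z)) with hK
  have hne : ∀ z ∈ leftOf δ c₃, (c₃ : ℂ) - z ≠ 0 := by
    intro z hz h0
    rw [← sub_eq_zero.mp h0] at hz
    simp [leftOf] at hz
  have hKd : DifferentiableOn ℂ K (leftOf δ c₃) := by
    refine DifferentiableOn.sub (DifferentiableOn.mul (by fun_prop) hh) ?_
    refine DifferentiableOn.const_mul (DifferentiableOn.div (by fun_prop) (by fun_prop) hne) _
  have h0mem : (0 : ℂ) ∈ leftOf δ c₃ := by simpa [leftOf] using h30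
  have hK0 : K 0 = 0 := by
    have : (c₃ : ℂ) ≠ 0 := by exact_mod_cast h30.ne'
    simp [hK, this]
  have hds : DifferentiableOn ℂ (dslope K 0) (leftOf δ c₃) :=
    (Complex.differentiableOn_dslope ((isOpen_leftOf δ c₃).mem_nhds h0mem)).mpr hKd
  have hdsv : ∀ z : ℂ, z ≠ 0 → dslope K 0 z = K z / z := by
    intro z hz
    rw [dslope_of_ne _ hz, slope_def_field, hK0, sub_zero, sub_zero]
  set M : ℝ := Real.exp (q * c₀) * (c₀ + 1 + (1 + 1 / δ) / q) with hM
  have hM0 : 0 ≤ M := by positivity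
  -- With x = c₀ - Re z, the slope δ forces |z| to be at most linear in x, and x e^{-qx} ≤ 1/q
  -- produces M. Hence e^{qz} h(z) = O(1/|z|) and K(z)/z = O(|z|⁻²).
  have hexp : ∀ c ≤ c₀, ∀ y, ‖Complex.exp (q * bent δ c y)‖ * ‖bent δ c y‖ ≤ M := by
    intro c hcc y
    rw [Complex.norm_exp, Complex.re_ofReal_mul, bent_re]
    set R := c - δ * bend y with hR
    have hx : 0 ≤ c₀ - R := by
      have := mul_nonneg hδ.le (bend_nonneg y); linarith
    have h1 : ‖bent δ c y‖ ≤ c₀ + 1 + (c₀ - R) * (1 + 1 / δ) := by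
      refine (Complex.norm_le_abs_re_add_abs_im _).trans ?_
      rw [bent_re, bent_im, ← hR]
      have h2 : |R| ≤ c₀ + (c₀ - R) := abs_le.mpr ⟨by linarith, by linarith⟩
      have h3 : |y| ≤ 1 + (c₀ - R) / δ := by
        have := abs_sub_one_le_bend y
        have h4 : bend y ≤ (c₀ - R) / δ := by
          rw [le_div_iff₀ hδ]; linarith
        linarith
      have h4 : (c₀ - R) * (1 + 1 / δ) = (c₀ - R) + (c₀ - R) / δ := by ring
      linarith
    have h2 : Real.exp (q * R) = Real.exp (q * c₀) * Real.exp (-(q * (c₀ - R))) := by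
      rw [← Real.exp_add]; ring_nf
    have h3 : Real.exp (-(q * (c₀ - R))) ≤ 1 := Real.exp_le_one_iff.mpr (by nlinarith)
    have h4 : Real.exp (-(q * (c₀ - R))) * (c₀ - R) ≤ 1 / q := by
      have h5 := Real.add_one_le_exp (q * (c₀ - R))
      rw [Real.exp_neg, inv_mul_eq_div, div_le_div_iff₀ (Real.exp_pos _) hq]
      linarith
    calc _ ≤ Real.exp (q * R) * (c₀ + 1 + (c₀ - R) * (1 + 1 / δ)) := by gcongr
      _ = Real.exp (q * c₀) * (Real.exp (-(q * (c₀ - R))) * (c₀ + 1) +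
            Real.exp (-(q * (c₀ - R))) * (c₀ - R) * (1 + 1 / δ)) := by rw [h2]; ring
      _ ≤ Real.exp (q * c₀) * (1 * (c₀ + 1) + 1 / q * (1 + 1 / δ)) := by gcongr
      _ = M := by rw [hM]; ring
  have hmain : Integrable (fun y => dslope K 0 (bent δ c₀ y) * bentDeriv δ y) ∧
      ∫ y, dslope K 0 (bent δ c₀ y) * bentDeriv δ y = 0 := by
    refine integral_bent_eq_zero (B := M * C + ‖h 0‖ * (2 * c₃)) (r := 1 + 2 * c₃) hδ h03
      (by linarith) hds fun c hcc y hy => ?_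
    have hzpos : 0 < ‖bent δ c y‖ := by linarith
    have hz : bent δ c y ≠ 0 := norm_pos_iff.mp hzpos
    have hcz : ‖bent δ c y‖ / 2 ≤ ‖(c₃ : ℂ) - bent δ c y‖ := by
      have := norm_sub_norm_le (bent δ c y) c₃
      rw [norm_sub_rev, Complex.norm_real, Real.norm_of_nonneg h30.le] at this
      linarith
    rw [hdsv _ hz, hK, sub_div]
    refine (norm_sub_le _ _).trans ?_
    rw [add_div]
    refine add_le_add ?_ ?_
    · rw [norm_div, norm_mul, div_le_div_iff₀ hzpos (by positivity)]
      calc _ = (‖Complex.exp (q * bent δ c y)‖ * ‖bent δ c y‖) * ‖h (bent δ c y)‖ *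
            ‖bent δ c y‖ := by ring
        _ ≤ M * C * ‖bent δ c y‖ := by
            have := hexp c hcc y
            have := hC c hcc y
            gcongr
    · rw [norm_div, norm_mul, norm_div, Complex.norm_real, Real.norm_of_nonneg h30.le]
      calc _ ≤ ‖h 0‖ * (c₃ / (‖bent δ c y‖ / 2)) / ‖bent δ c y‖ := by gcongr
        _ = _ := by field_simp
  have hz0 : ∀ y, bent δ c₀ y ≠ 0 := fun y => Complex.slitPlane_ne_zero (bent_mem_slitPlane hc y)
  have hsplit : ∀ y, (Complex.exp (q * bent δ c₀ y) * h (bent δ c₀ y) / bent δ c₀ y) *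
      bentDeriv δ y = dslope K 0 (bent δ c₀ y) * bentDeriv δ y +
      h 0 * ((c₃ / (bent δ c₀ y * (c₃ - bent δ c₀ y))) * bentDeriv δ y) := by
    intro y
    have h1 := hne _ ((bent_mem_leftOf y).mpr h03)
    have h2 := hz0 y
    rw [hdsv _ h2, hK]
    field_simp
    ring
  obtain ⟨k1, k2⟩ := integral_bent_kernel hδ.le hc h03
  simp_rw [hsplit]
  rw [integral_add hmain.1 (k1.const_mul _), hmain.2, integral_const_mul, k2]
  ring

/-! ### Laguerre-type densities: continuity and integrable majorants. -/

/-- The interaction factor `∏_{c_i < c_j} (z_j - z_i)^{2ρ q_i q_j}` of particles with charges `q`. -/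
def pairWeight {ι : Type*} [Fintype ι] (ρ : ℝ) (q c : ι → ℝ) (z : ι → ℂ) : ℂ :=
  ∏ i, ∏ j, if c i < c j then (z j - z i) ^ ((2 * ρ * q i * q j : ℝ) : ℂ) else 1

/-- The point with coordinates `bent δ (c i) (y i)`. -/
def bentPoint {ι : Type*} (δ : ℝ) (c y : ι → ℝ) : ι → ℂ := fun i => bent δ (c i) (y i)

/-- Real charges and contour positions for which the Laguerre-type integrals make sense. -/
structure Admissible {ι : Type*} (ρ δ : ℝ) (q c : ι → ℝ) : Prop where
  ρ_neg : ρ < 0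
  δ_pos : 0 < δ
  q_pos : ∀ i, 0 < q i
  c_pos : ∀ i, 0 < c i
  inj : Function.Injective c

/-- All exponents 2ρ q_i q_j are negative, so lower bounds on distances become upper bounds on the
weight. -/
theorem norm_pairWeight_le {ι : Type*} [Fintype ι] {ρ : ℝ} {q c : ι → ℝ} {z : ι → ℂ}
    (hρ : ρ < 0) (hq : ∀ i, 0 < q i) {d : ι → ι → ℝ} (hd : ∀ i j, c i < c j → 0 < d i j)
    (h : ∀ i j, c i < c j → d i j ≤ ‖z j - z i‖) :
    ‖pairWeight ρ q c z‖ ≤ ∏ i, ∏ j, if c i < c j then d i j ^ (2 * ρ * q i * q j) else 1 := by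
  unfold pairWeight
  rw [norm_prod]
  refine Finset.prod_le_prod (fun i _ => norm_nonneg _) fun i _ => ?_
  rw [norm_prod]
  refine Finset.prod_le_prod (fun i _ => norm_nonneg _) fun j _ => ?_
  split_ifs with hij
  · rw [Complex.norm_cpow_real]
    refine Real.rpow_le_rpow_of_nonpos (hd i j hij) (h i j hij) ?_
    have := mul_pos (hq i) (hq j)
    nlinarith
  · simp

theorem continuous_pairWeight_comp {ι X : Type*} [Fintype ι] [TopologicalSpace X] {ρ : ℝ}
    {q c : ι → ℝ} {Z : X → ι → ℂ} (hZ : ∀ i, Continuous fun x => Z x i)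
    (hs : ∀ x i j, c i < c j → Z x j - Z x i ∈ Complex.slitPlane) :
    Continuous fun x => pairWeight ρ q c (Z x) := by
  unfold pairWeight
  refine continuous_finsetProd _ fun i _ => continuous_finsetProd _ fun j _ => ?_
  split_ifs with hij
  · exact ((hZ j).sub (hZ i)).cpow continuous_const fun x => hs x i j hij
  · exact continuous_const

theorem integrable_one_add_abs_rpow_mul_exp {K ε : ℝ} (hK : 0 ≤ K) (hε : 0 < ε) :
    Integrable fun y : ℝ => (1 + |y|) ^ K * Real.exp (-ε * |y|) := by
  have h := integrableOn_rpow_mul_exp_mul_one_add_rpow (a := 1) one_pos hε hK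
  have h1 : IntegrableOn (fun y : ℝ => (1 + |y|) ^ K * Real.exp (-ε * |y|)) (Ioi 0) := by
    refine h.congr_fun (fun y hy => ?_) measurableSet_Ioi
    simp only [sub_self, Real.rpow_zero, one_mul]
    rw [abs_of_pos hy, mul_comm]
  have h2 : IntegrableOn (fun y : ℝ => (1 + |y|) ^ K * Real.exp (-ε * |y|)) (Iic 0) := by
    rw [← Measure.map_neg_eq_self (volume : Measure ℝ)]
    let m : MeasurableEmbedding fun x : ℝ => -x := (Homeomorph.neg ℝ).measurableEmbedding
    rw [m.integrableOn_map_iff]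
    simp_rw [Function.comp_def, abs_neg, neg_preimage, neg_Iic, neg_zero]
    exact Iff.mpr integrableOn_Ici_iff_integrableOn_Ioi h1
  have := h2.union h1
  rwa [Iic_union_Ioi, integrableOn_univ] at this

/-- The one-particle factor `z^{-sq} (z+v)^{λq} e^{qz}`. -/
def oneBody (s lam v q : ℝ) (z : ℂ) : ℂ :=
  z ^ ((-(s * q) : ℝ) : ℂ) * (z + v) ^ ((lam * q : ℝ) : ℂ) * Complex.exp (q * z)

/-- A bound, uniform in `v` up to `(1+v)^{λq}`, for `oneBody` along a bent contour. -/
def oneBodyBound (δ s lam q c y : ℝ) : ℝ :=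
  (c / (1 + δ)) ^ (-(s * q)) * (2 + c + δ) ^ (lam * q) * Real.exp (q * (c + δ)) * (1 + δ) *
    ((1 + |y|) ^ (lam * q) * Real.exp (-(q * δ) * |y|))

/-- The power z^{-sq} is bounded because the contour stays away from 0. The bending makes Re z ≤ c +
δ - δ|y|, so e^{qz} decays exponentially and absorbs the polynomial factor. -/
theorem norm_oneBody_mul_le {δ s lam v q c : ℝ} (hδ : 0 < δ) (hs : 0 < s) (hl : 0 ≤ lam)
    (hv : 0 ≤ v) (hq : 0 < q) (hc : 0 < c) (y : ℝ) :
    ‖oneBody s lam v q (bent δ c y) * bentDeriv δ y‖ ≤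
      (1 + v) ^ (lam * q) * oneBodyBound δ s lam q c y := by
  have h1 : ‖bent δ c y‖ ^ (-(s * q)) ≤ (c / (1 + δ)) ^ (-(s * q)) :=
    Real.rpow_le_rpow_of_nonpos (by positivity) (le_norm_bent hδ.le y)
      (by have := mul_pos hs hq; linarith)
  have h2 : ‖bent δ c y + v‖ ^ (lam * q) ≤ (1 + v) ^ (lam * q) * ((2 + c + δ) ^ (lam * q) *
      (1 + |y|) ^ (lam * q)) := by
    rw [← Real.mul_rpow (by positivity) (by positivity), ← Real.mul_rpow (by positivity)
      (by positivity)]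
    refine Real.rpow_le_rpow (norm_nonneg _) ?_ (by positivity)
    refine (norm_add_le _ _).trans ?_
    have h3 := norm_bent_le hδ.le c y
    rw [abs_of_pos hc] at h3
    rw [Complex.norm_real, Real.norm_of_nonneg hv]
    have h4 : 1 ≤ (2 + c + δ) * (1 + |y|) := by nlinarith [abs_nonneg y]
    have h5 : ‖bent δ c y‖ ≤ (2 + c + δ) * (1 + |y|) := by nlinarith [abs_nonneg y]
    nlinarith
  have h3 : ‖Complex.exp (q * bent δ c y)‖ ≤
      Real.exp (q * (c + δ)) * Real.exp (-(q * δ) * |y|) := by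
    rw [Complex.norm_exp, Complex.re_ofReal_mul, bent_re, ← Real.exp_add]
    apply Real.exp_le_exp.mpr
    have := mul_le_mul_of_nonneg_left (abs_sub_one_le_bend y) (mul_pos hq hδ).le
    linarith
  unfold oneBody oneBodyBound
  rw [norm_mul, norm_mul, norm_mul, Complex.norm_cpow_real, Complex.norm_cpow_real]
  calc _ ≤ (c / (1 + δ)) ^ (-(s * q)) * ((1 + v) ^ (lam * q) * ((2 + c + δ) ^ (lam * q) *
      (1 + |y|) ^ (lam * q))) * (Real.exp (q * (c + δ)) * Real.exp (-(q * δ) * |y|)) * (1 + δ) := by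
        gcongr
        exact norm_bentDeriv_le hδ.le y
    _ = _ := by ring

theorem integrable_oneBodyBound {δ s lam q c : ℝ} (hδ : 0 < δ) (hl : 0 ≤ lam) (hq : 0 < q) :
    Integrable (oneBodyBound δ s lam q c) :=
  (integrable_one_add_abs_rpow_mul_exp (mul_nonneg hl hq.le) (mul_pos hq hδ)).const_mul _

/-- The density whose integral is the Laguerre-type integral with an inserted external point `-v`
of strength `lam`. -/
def laguerreDensity {ι : Type*} [Fintype ι] (ρ δ s lam v : ℝ) (q c y : ι → ℝ) : ℂ :=
  pairWeight ρ q c (bentPoint δ c y) *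
    ∏ i, (oneBody s lam v (q i) (bent δ (c i) (y i)) * bentDeriv δ (y i))

/-- The constant bounding `pairWeight` along bent contours. -/
def pairBound {ι : Type*} [Fintype ι] (ρ δ : ℝ) (q c : ι → ℝ) : ℝ :=
  ∏ i, ∏ j, if c i < c j then ((c j - c i) / (1 + δ)) ^ (2 * ρ * q i * q j) else 1

theorem norm_pairWeight_bentPoint_le {ι : Type*} [Fintype ι] {ρ δ : ℝ} {q c : ι → ℝ}
    (hρ : ρ < 0) (hδ : 0 ≤ δ) (hq : ∀ i, 0 < q i) (y : ι → ℝ) :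
    ‖pairWeight ρ q c (bentPoint δ c y)‖ ≤ pairBound ρ δ q c :=
  norm_pairWeight_le hρ hq (fun i j hij => div_pos (sub_pos.mpr hij) (by positivity))
    fun i j _ => le_norm_bent_sub hδ _ _

theorem continuous_pairWeight_bentPoint {ι : Type*} [Fintype ι] (ρ δ : ℝ) (q c : ι → ℝ) :
    Continuous fun y => pairWeight ρ q c (bentPoint δ c y) :=
  continuous_pairWeight_comp (fun i => (continuous_bent δ (c i)).comp (continuous_apply i))
    fun _ _ _ hij => bent_sub_mem_slitPlane hij _ _

theorem continuous_oneBody_bent {δ s lam v q c : ℝ} (hv : 0 ≤ v) (hc : 0 < c) :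
    Continuous fun y => oneBody s lam v q (bent δ c y) := by
  unfold oneBody
  refine ((((continuous_bent δ c).cpow continuous_const
    fun y => bent_mem_slitPlane hc y)).mul ?_).mul (by fun_prop)
  refine ((continuous_bent δ c).add continuous_const).cpow continuous_const fun y => ?_
  simp only [Pi.add_apply, bent_add]
  exact bent_mem_slitPlane (by linarith) y

section
variable {ι : Type*} [Fintype ι] {ρ δ : ℝ} {q c : ι → ℝ}

theorem Admissible.continuous_density (h : Admissible ρ δ q c) {s lam v : ℝ} (hv : 0 ≤ v) :
    Continuous (laguerreDensity ρ δ s lam v q c) := by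
  refine (continuous_pairWeight_bentPoint ρ δ q c).mul (continuous_finsetProd _ fun i _ => ?_)
  exact ((continuous_oneBody_bent hv (h.c_pos i)).comp (continuous_apply i)).mul
    ((continuous_bentDeriv δ).comp (continuous_apply i))

theorem Admissible.pairBound_nonneg (h : Admissible ρ δ q c) : 0 ≤ pairBound ρ δ q c :=
  (norm_nonneg _).trans (norm_pairWeight_bentPoint_le h.ρ_neg h.δ_pos.le h.q_pos 0)

theorem Admissible.norm_density_le (h : Admissible ρ δ q c) {s lam v : ℝ} (hs : 0 < s)
    (hl : 0 ≤ lam) (hv : 0 ≤ v) (y : ι → ℝ) :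
    ‖laguerreDensity ρ δ s lam v q c y‖ ≤ (1 + v) ^ (lam * ∑ i, q i) *
      (pairBound ρ δ q c * ∏ i, oneBodyBound δ s lam (q i) (c i) (y i)) := by
  unfold laguerreDensity
  rw [norm_mul, norm_prod]
  have h1 : ∏ i, ‖oneBody s lam v (q i) (bent δ (c i) (y i)) * bentDeriv δ (y i)‖ ≤
      ∏ i, ((1 + v) ^ (lam * q i) * oneBodyBound δ s lam (q i) (c i) (y i)) :=
    Finset.prod_le_prod (fun i _ => norm_nonneg _) fun i _ =>
      norm_oneBody_mul_le h.δ_pos hs hl hv (h.q_pos i) (h.c_pos i) (y i)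
  rw [Finset.prod_mul_distrib, ← Real.rpow_sum_of_pos (by positivity), ← Finset.mul_sum] at h1
  calc _ ≤ pairBound ρ δ q c * ((1 + v) ^ (lam * ∑ i, q i) *
        ∏ i, oneBodyBound δ s lam (q i) (c i) (y i)) :=
        mul_le_mul (norm_pairWeight_bentPoint_le h.ρ_neg h.δ_pos.le h.q_pos y) h1
          (Finset.prod_nonneg fun i _ => norm_nonneg _) h.pairBound_nonneg
    _ = _ := by ring

theorem Admissible.integrable_bound (h : Admissible ρ δ q c) {s lam : ℝ} (hl : 0 ≤ lam) :
    Integrable fun y : ι → ℝ =>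
      pairBound ρ δ q c * ∏ i, oneBodyBound δ s lam (q i) (c i) (y i) :=
  (Integrable.fintype_prod fun i => integrable_oneBodyBound h.δ_pos hl (h.q_pos i)).const_mul _

theorem Admissible.integrable_density (h : Admissible ρ δ q c) {s lam v : ℝ} (hs : 0 < s)
    (hl : 0 ≤ lam) (hv : 0 ≤ v) : Integrable (laguerreDensity ρ δ s lam v q c) :=
  Integrable.mono' ((h.integrable_bound hl).const_mul _)
    (h.continuous_density hv).aestronglyMeasurable
    (Eventually.of_forall (h.norm_density_le hs hl hv))

end

/-! ### Bounded multipliers and logarithmic derivatives. -/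

/-- Bounded continuous complex functions. -/
def BddCont {X : Type*} [TopologicalSpace X] (B : X → ℂ) : Prop :=
  Continuous B ∧ ∃ C, ∀ y, ‖B y‖ ≤ C

section
variable {X : Type*} [TopologicalSpace X] {A B : X → ℂ}

theorem BddCont.const (a : ℂ) : BddCont fun _ : X => a :=
  ⟨continuous_const, ‖a‖, fun _ => le_rfl⟩

theorem BddCont.add (hA : BddCont A) (hB : BddCont B) : BddCont fun y => A y + B y := by
  obtain ⟨hA, a, ha⟩ := hA
  obtain ⟨hB, b, hb⟩ := hB
  exact ⟨hA.add hB, a + b, fun y => (norm_add_le _ _).trans (add_le_add (ha y) (hb y))⟩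

theorem BddCont.mul (hA : BddCont A) (hB : BddCont B) : BddCont fun y => A y * B y := by
  obtain ⟨hA, a, ha⟩ := hA
  obtain ⟨hB, b, hb⟩ := hB
  refine ⟨hA.mul hB, a * b, fun y => ?_⟩
  rw [norm_mul]
  exact mul_le_mul (ha y) (hb y) (norm_nonneg _) ((norm_nonneg _).trans (ha y))

theorem BddCont.sub (hA : BddCont A) (hB : BddCont B) : BddCont fun y => A y - B y := by
  simpa [sub_eq_add_neg] using hA.add ((BddCont.const (-1)).mul hB)

theorem BddCont.pow (hA : BddCont A) (n : ℕ) : BddCont fun y => A y ^ n := by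
  induction n with
  | zero => simpa using BddCont.const 1
  | succ n ih => simpa [pow_succ] using ih.mul hA

theorem BddCont.sum {κ : Type*} (S : Finset κ) {A : κ → X → ℂ} (h : ∀ i ∈ S, BddCont (A i)) :
    BddCont fun y => ∑ i ∈ S, A i y := by
  classical
  induction S using Finset.induction_on with
  | empty => simpa using BddCont.const 0
  | insert a S ha ih =>
    simp only [Finset.sum_insert ha]
    exact (h a (Finset.mem_insert_self a S)).add
      (ih fun i hi => h i (Finset.mem_insert_of_mem hi))

theorem BddCont.inv {d : ℝ} (hd : 0 < d) (hB : Continuous B) (h : ∀ y, d ≤ ‖B y‖) :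
    BddCont fun y => (B y)⁻¹ := by
  refine ⟨hB.inv₀ fun y hy => ?_, d⁻¹, fun y => ?_⟩
  · have := h y
    rw [hy, norm_zero] at this
    linarith
  · rw [norm_inv]
    exact inv_anti₀ hd (h y)

theorem integrable_mul_bddCont [MeasurableSpace X] [OpensMeasurableSpace X]
    [SecondCountableTopology X] {μ : Measure X} {f : X → ℂ} (hf : Integrable f μ)
    (hB : BddCont B) : Integrable (fun y => f y * B y) μ := by
  obtain ⟨h1, C, hC⟩ := hB
  exact hf.mul_bdd (c := C) h1.aestronglyMeasurable (Eventually.of_forall hC)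

end

theorem hasDerivAt_finset_prod_of_log {κ : Type*} (S : Finset κ) {f : κ → ℝ → ℂ} {l : κ → ℂ}
    {t : ℝ} (h : ∀ i ∈ S, HasDerivAt (f i) (f i t * l i) t) :
    HasDerivAt (fun x => ∏ i ∈ S, f i x) ((∏ i ∈ S, f i t) * ∑ i ∈ S, l i) t := by
  classical
  induction S using Finset.induction_on with
  | empty => simpa using hasDerivAt_const t (1 : ℂ)
  | insert a S ha ih =>
    simp only [Finset.prod_insert ha, Finset.sum_insert ha]
    refine ((h a (Finset.mem_insert_self a S)).mul
      (ih fun i hi => h i (Finset.mem_insert_of_mem hi))).congr_deriv ?_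
    ring

theorem HasDerivAt.cpow_const_log {g : ℝ → ℂ} {g' : ℂ} {t : ℝ} (a : ℂ) (hg : HasDerivAt g g' t)
    (hs : g t ∈ Complex.slitPlane) :
    HasDerivAt (fun x => g x ^ a) (g t ^ a * (a * (g t)⁻¹ * g')) t := by
  have h0 : g t ≠ 0 := Complex.slitPlane_ne_zero hs
  have := (Complex.hasStrictDerivAt_cpow_const (c := a) hs).hasDerivAt.comp t hg
  refine this.congr_deriv ?_
  rw [Complex.cpow_sub _ _ h0, Complex.cpow_one]
  field_simp

/-- The summand is symmetric in i, j and zero on the diagonal, so the ordered sum is half the full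
one. The diagonal terms on the right are zero because 0⁻¹ = 0. In this way the ordering of the
contours disappears from the derivative of `pairWeight`. -/
theorem sum_pairs_antisymm {ι : Type*} [Fintype ι] {c : ι → ℝ} (hc : Function.Injective c)
    {a : ι → ι → ℂ} (ha : ∀ i j, a i j = a j i) (z w : ι → ℂ) :
    (∑ i, ∑ j, if c i < c j then a i j * (z j - z i)⁻¹ * (w j - w i) else 0) =
      ∑ i, w i * ∑ j, a i j * (z i - z j)⁻¹ := by
  set A : ι → ι → ℂ := fun i j => a i j * (z j - z i)⁻¹ * (w j - w i) with hA
  have hsymm : ∀ i j, A i j = A j i := by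
    intro i j
    simp only [hA]
    rw [ha i j, ← neg_sub (z i) (z j), inv_neg]
    ring
  have hdiag : ∀ i, A i i = 0 := by intro i; simp [hA]
  have h1 : ∑ i, ∑ j, A i j = (∑ i, ∑ j, if c i < c j then A i j else 0) +
      ∑ i, ∑ j, if c j < c i then A i j else 0 := by
    rw [← Finset.sum_add_distrib]
    refine Finset.sum_congr rfl fun i _ => ?_
    rw [← Finset.sum_add_distrib]
    refine Finset.sum_congr rfl fun j _ => ?_
    rcases lt_trichotomy (c i) (c j) with h | h | h
    · simp [h, h.le]
    · have := hc h; subst this; simp [hdiag]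
    · simp [h, h.le]
  have h2 : (∑ i, ∑ j, if c j < c i then A i j else 0) =
      ∑ i, ∑ j, if c i < c j then A i j else 0 := by
    rw [Finset.sum_comm]
    refine Finset.sum_congr rfl fun i _ => Finset.sum_congr rfl fun j _ => ?_
    rw [hsymm]
  have h3 : ∑ i, ∑ j, A i j = 2 * ∑ i, w i * ∑ j, a i j * (z i - z j)⁻¹ := by
    have e1 : ∑ i, ∑ j, A i j = (∑ i, ∑ j, a i j * (z j - z i)⁻¹ * w j) -
        ∑ i, ∑ j, a i j * (z j - z i)⁻¹ * w i := by
      simp only [hA, mul_sub, Finset.sum_sub_distrib]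
    have e2 : (∑ i, ∑ j, a i j * (z j - z i)⁻¹ * w j) =
        ∑ i, w i * ∑ j, a i j * (z i - z j)⁻¹ := by
      rw [Finset.sum_comm]
      refine Finset.sum_congr rfl fun i _ => ?_
      rw [Finset.mul_sum]
      refine Finset.sum_congr rfl fun j _ => ?_
      rw [ha j i]; ring
    have e3 : (∑ i, ∑ j, a i j * (z j - z i)⁻¹ * w i) =
        -∑ i, w i * ∑ j, a i j * (z i - z j)⁻¹ := by
      rw [← Finset.sum_neg_distrib]
      refine Finset.sum_congr rfl fun i _ => ?_
      rw [Finset.mul_sum, ← Finset.sum_neg_distrib]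
      refine Finset.sum_congr rfl fun j _ => ?_
      rw [← neg_sub (z i) (z j), inv_neg]
      ring
    rw [e1, e2, e3]; ring
  have h4 : (∑ i, ∑ j, if c i < c j then A i j else 0) =
      ∑ i, w i * ∑ j, a i j * (z i - z j)⁻¹ := by
    rw [h2, h3] at h1
    linear_combination -h1 / 2
  exact h4

theorem hasDerivAt_pairWeight {ι : Type*} [Fintype ι] {ρ : ℝ} {q c : ι → ℝ}
    (hc : Function.Injective c) {Z : ℝ → ι → ℂ} {w : ι → ℂ} {t : ℝ}
    (hZ : ∀ i, HasDerivAt (fun x => Z x i) (w i) t)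
    (hs : ∀ i j, c i < c j → Z t j - Z t i ∈ Complex.slitPlane) :
    HasDerivAt (fun x => pairWeight ρ q c (Z x)) (pairWeight ρ q c (Z t) *
      ∑ i, w i * ∑ j, (2 * ρ * q i * q j : ℝ) * (Z t i - Z t j)⁻¹) t := by
  rw [← sum_pairs_antisymm hc (a := fun i j => ((2 * ρ * q i * q j : ℝ) : ℂ))
    (fun i j => by push_cast; ring) (Z t) w]
  unfold pairWeight
  refine hasDerivAt_finset_prod_of_log _ fun i _ => ?_
  refine hasDerivAt_finset_prod_of_log _ fun j _ => ?_
  split_ifs with hij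
  · exact ((hZ j).sub (hZ i)).cpow_const_log _ (hs i j hij)
  · simpa using hasDerivAt_const t (1 : ℂ)

theorem hasDerivAt_oneBody {Z : ℝ → ℂ} {w : ℂ} {t : ℝ} (s lam v q : ℝ) (hZ : HasDerivAt Z w t)
    (h1 : Z t ∈ Complex.slitPlane) (h2 : Z t + v ∈ Complex.slitPlane) :
    HasDerivAt (fun x => oneBody s lam v q (Z x)) (oneBody s lam v q (Z t) *
      ((-(s * q) * (Z t)⁻¹ + lam * q * (Z t + v)⁻¹ + q) * w)) t := by
  unfold oneBody
  refine (((hZ.cpow_const_log _ h1).mul ((hZ.add_const (v : ℂ)).cpow_const_log _ h2)).mul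
    ((hZ.const_mul (q : ℂ)).cexp)).congr_deriv ?_
  simp only [Pi.mul_apply]
  push_cast
  ring

section
variable {ι : Type*} {ρ δ : ℝ} {q c : ι → ℝ}

theorem Admissible.bddCont_inv_add (h : Admissible ρ δ q c) {v : ℝ} (hv : 0 ≤ v) (i : ι) :
    BddCont fun y : ι → ℝ => (bent δ (c i) (y i) + v)⁻¹ := by
  have hδ := h.δ_pos
  have hc := h.c_pos i
  refine BddCont.inv (d := c i / (1 + δ)) (by positivity)
    (((continuous_bent δ (c i)).comp (continuous_apply i)).add continuous_const) fun y => ?_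
  rw [bent_add]
  refine le_trans ?_ (le_norm_bent hδ.le _)
  gcongr
  linarith

theorem Admissible.bddCont_inv (h : Admissible ρ δ q c) (i : ι) :
    BddCont fun y : ι → ℝ => (bent δ (c i) (y i))⁻¹ := by
  simpa using h.bddCont_inv_add le_rfl i

theorem Admissible.bddCont_inv_sub (h : Admissible ρ δ q c) (i j : ι) :
    BddCont fun y : ι → ℝ => (bent δ (c i) (y i) - bent δ (c j) (y j))⁻¹ := by
  have hδ := h.δ_pos
  have hcont : Continuous fun y : ι → ℝ => bent δ (c i) (y i) - bent δ (c j) (y j) :=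
    ((continuous_bent δ (c i)).comp (continuous_apply i)).sub
      ((continuous_bent δ (c j)).comp (continuous_apply j))
  rcases lt_trichotomy (c i) (c j) with hij | hij | hij
  · refine BddCont.inv (d := (c j - c i) / (1 + δ))
      (div_pos (sub_pos.mpr hij) (by positivity)) hcont fun y => ?_
    rw [norm_sub_rev]
    exact le_norm_bent_sub hδ.le _ _
  · have := h.inj hij
    subst this
    simpa using BddCont.const 0
  · exact BddCont.inv (d := (c i - c j) / (1 + δ))
      (div_pos (sub_pos.mpr hij) (by positivity)) hcont fun y => le_norm_bent_sub hδ.le _ _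

theorem Admissible.norm_inv_add_le (h : Admissible ρ δ q c) {v : ℝ} (hv : 0 ≤ v) (y : ι → ℝ)
    (i : ι) : ‖(bent δ (c i) (y i) + v)⁻¹‖ ≤ (c i / (1 + δ))⁻¹ := by
  have hδ := h.δ_pos
  have hc := h.c_pos i
  rw [norm_inv, bent_add]
  refine inv_anti₀ (by positivity) (le_trans ?_ (le_norm_bent hδ.le _))
  gcongr
  linarith

theorem bddCont_inv_bentDeriv (δ : ℝ) (i : ι) :
    BddCont fun y : ι → ℝ => (bentDeriv δ (y i))⁻¹ :=
  BddCont.inv one_pos ((continuous_bentDeriv δ).comp (continuous_apply i))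
    fun _ => one_le_norm_bentDeriv δ _

theorem Admissible.add_ne_zero (h : Admissible ρ δ q c) {v : ℝ} (hv : 0 ≤ v) (y : ι → ℝ) (i : ι) :
    bent δ (c i) (y i) + v ≠ 0 := by
  rw [bent_add]
  exact Complex.slitPlane_ne_zero (bent_mem_slitPlane (by linarith [h.c_pos i]) _)

theorem Admissible.ne_zero (h : Admissible ρ δ q c) (y : ι → ℝ) (i : ι) :
    bent δ (c i) (y i) ≠ 0 :=
  Complex.slitPlane_ne_zero (bent_mem_slitPlane (h.c_pos i) _)

theorem Admissible.sub_ne_zero (h : Admissible ρ δ q c) (y : ι → ℝ) {i j : ι} (hij : i ≠ j) :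
    bent δ (c i) (y i) - bent δ (c j) (y j) ≠ 0 := by
  rcases lt_trichotomy (c i) (c j) with h1 | h1 | h1
  · rw [← neg_sub]
    exact neg_ne_zero.mpr (Complex.slitPlane_ne_zero (bent_sub_mem_slitPlane h1 _ _))
  · exact absurd (h.inj h1) hij
  · exact Complex.slitPlane_ne_zero (bent_sub_mem_slitPlane h1 _ _)

end

/-! ### Ward identities for the log-gas. -/

section
variable {ι : Type*} [Fintype ι] {ρ δ : ℝ} {q c : ι → ℝ}

/-- Integration by parts against the constant 1. -/
theorem integral_eq_zero_of_hasLineDerivAt {f f' : (ι → ℝ) → ℂ} {e : ι → ℝ} (hf : Integrable f)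
    (hf' : Integrable f') (h : ∀ y, HasLineDerivAt ℝ f (f' y) y e) : ∫ y, f' y = 0 := by
  have := integral_bilinear_hasLineDerivAt_right_eq_neg_left_of_integrable
    (μ := (volume : Measure (ι → ℝ))) (B := ContinuousLinearMap.mul ℝ ℂ) (f := f) (f' := f')
    (g := fun _ => 1) (g' := fun _ => 0) (v := e)
    (by simpa using hf') (by simp) (by simpa using hf)
    (fun x _ => h x) (fun _ _ => by
      unfold HasLineDerivAt
      exact hasDerivAt_const _ _)
  simpa using this

/-- Sum over particles of the charge-weighted resolvent at `-v`. -/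
def resolventSum (δ v : ℝ) (q c y : ι → ℝ) : ℂ :=
  ∑ i, (q i : ℂ) * (bent δ (c i) (y i) + v)⁻¹

/-- Sum over particles of the charge-weighted squared resolvent at `-v`. -/
def resolventSqSum (δ v : ℝ) (q c y : ι → ℝ) : ℂ :=
  ∑ i, (q i : ℂ) * (bent δ (c i) (y i) + v)⁻¹ ^ 2

/-- The logarithmic derivative of `z_k / (z_k + v) · (weight)` in the `k`-th variable,
times `z_k / (z_k + v)`. -/
def wardTerm (ρ δ s lam v : ℝ) (q c y : ι → ℝ) (k : ι) : ℂ :=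
  v * (bent δ (c k) (y k) + v)⁻¹ ^ 2 + (1 - v * (bent δ (c k) (y k) + v)⁻¹) *
    ((∑ j, ((2 * ρ * q k * q j : ℝ) : ℂ) * (bent δ (c k) (y k) - bent δ (c j) (y j))⁻¹) +
      (-(s * q k) * (bent δ (c k) (y k))⁻¹ + lam * q k * (bent δ (c k) (y k) + v)⁻¹ + q k))

theorem Admissible.bddCont_wardTerm (h : Admissible ρ δ q c) {v : ℝ} (hv : 0 ≤ v) (s lam : ℝ)
    (k : ι) : BddCont fun y => wardTerm ρ δ s lam v q c y k := by
  unfold wardTerm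
  have hu := h.bddCont_inv_add hv k
  have h1 : BddCont fun y : ι → ℝ => ∑ j, ((2 * ρ * q k * q j : ℝ) : ℂ) *
      (bent δ (c k) (y k) - bent δ (c j) (y j))⁻¹ :=
    BddCont.sum _ fun j _ => (BddCont.const _).mul (h.bddCont_inv_sub k j)
  exact ((BddCont.const _).mul (hu.pow 2)).add (((BddCont.const 1).sub ((BddCont.const _).mul hu)).mul
    (h1.add ((((BddCont.const _).mul (h.bddCont_inv k)).add ((BddCont.const _).mul hu)).add
      (BddCont.const _))))

/-- The multiplier 1 - v(z_k + v)⁻¹ is z_k/(z_k + v). Dividing by `bentDeriv` removes the k-th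
Jacobian before differentiating; the chain rule puts it back, so no derivative of `bentDeriv`
occurs. -/
theorem Admissible.hasLineDerivAt_density [DecidableEq ι] (h : Admissible ρ δ q c)
    {s lam v : ℝ} (hv : 0 ≤ v) (k : ι) (y : ι → ℝ) :
    HasLineDerivAt ℝ (fun y => laguerreDensity ρ δ s lam v q c y *
      ((1 - v * (bent δ (c k) (y k) + v)⁻¹) * (bentDeriv δ (y k))⁻¹))
      (laguerreDensity ρ δ s lam v q c y * wardTerm ρ δ s lam v q c y k) y (Pi.single k 1) := by
  have hF : (fun y => laguerreDensity ρ δ s lam v q c y *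
      ((1 - v * (bent δ (c k) (y k) + v)⁻¹) * (bentDeriv δ (y k))⁻¹)) = fun y : ι → ℝ =>
      pairWeight ρ q c (bentPoint δ c y) * ((∏ i, oneBody s lam v (q i) (bent δ (c i) (y i))) *
        ((1 - v * (bent δ (c k) (y k) + v)⁻¹) * ∏ i ∈ Finset.univ.erase k, bentDeriv δ (y i))) := by
    funext y
    unfold laguerreDensity
    rw [Finset.prod_mul_distrib,
      (Finset.mul_prod_erase Finset.univ (fun i => bentDeriv δ (y i)) (Finset.mem_univ k)).symm]
    have := bentDeriv_ne_zero δ (y k)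
    field_simp
  rw [hF]
  unfold HasLineDerivAt
  set Y : ℝ → ι → ℝ := fun t => y + t • Pi.single k (1 : ℝ) with hY
  have hY0 : Y 0 = y := by simp [hY]
  set e : ι → ℝ := Pi.single k 1 with he
  have hYd : ∀ i, HasDerivAt (fun t => Y t i) (e i) 0 := by
    intro i
    simpa [hY] using ((hasDerivAt_id (0 : ℝ)).mul_const (e i)).const_add (y i)
  have hZ : ∀ i, HasDerivAt (fun t => bentPoint δ c (Y t) i) (e i * bentDeriv δ (y i)) 0 := by
    intro i
    have := (hasDerivAt_bent δ (c i) (Y 0 i)).scomp 0 (hYd i)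
    rw [hY0, Complex.real_smul] at this
    exact this
  have hconst : ∀ t, ∏ i ∈ Finset.univ.erase k, bentDeriv δ (Y t i) =
      ∏ i ∈ Finset.univ.erase k, bentDeriv δ (y i) := by
    intro t
    refine Finset.prod_congr rfl fun i hi => ?_
    simp [hY, he, Finset.ne_of_mem_erase hi]
  have hslit : ∀ i, bent δ (c i) (y i) + v ∈ Complex.slitPlane := fun i => by
    rw [bent_add]; exact bent_mem_slitPlane (by linarith [h.c_pos i]) _
  have d1 := hasDerivAt_pairWeight (ρ := ρ) (q := q) h.inj hZ
    (fun i j hij => bent_sub_mem_slitPlane hij _ _)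
  have d2 : HasDerivAt (fun t => ∏ i, oneBody s lam v (q i) (bentPoint δ c (Y t) i)) _ 0 :=
    hasDerivAt_finset_prod_of_log Finset.univ fun i _ => hasDerivAt_oneBody s lam v (q i) (hZ i)
      (bent_mem_slitPlane (h.c_pos i) _) (by rw [hY0]; exact hslit i)
  have d3 := (((((hZ k).add_const (v : ℂ)).fun_inv (by
    rw [hY0]; exact Complex.slitPlane_ne_zero (hslit k))).const_mul (v : ℂ)).const_sub 1).mul_const
      (∏ i ∈ Finset.univ.erase k, bentDeriv δ (y i))
  have d := d1.mul (d2.mul d3)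
  have hek : ∀ g : ι → ℂ, ∑ i, (e i : ℂ) * g i = g k := by
    intro g
    rw [Finset.sum_eq_single k]
    · simp [he]
    · intro i _ hi; simp [he, hi]
    · simp
  have hek1 : (e k : ℂ) = 1 := by simp [he]
  have hZ0 : bentPoint δ c (Y 0) = bentPoint δ c y := by rw [hY0]
  refine (d.congr_deriv ?_).congr_of_eventuallyEq (Eventually.of_forall fun t => ?_)
  · simp only [hZ0, Pi.mul_apply, hek1]
    simp only [mul_assoc, hek]
    have hl : ∀ X : ι → ℂ, (∑ i, X i * ((e i : ℂ) * bentDeriv δ (y i))) = X k * bentDeriv δ (y k) := by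
      intro X
      rw [← hek fun i => X i * bentDeriv δ (y i)]
      exact Finset.sum_congr rfl fun i _ => by ring
    rw [hl]
    unfold laguerreDensity wardTerm
    rw [Finset.prod_mul_distrib,
      (Finset.mul_prod_erase Finset.univ (fun i => bentDeriv δ (y i)) (Finset.mem_univ k)).symm]
    simp only [bentPoint]
    simp only [← mul_assoc, div_eq_mul_inv, ← inv_pow]
    ring
  · simp only [Pi.mul_apply]
    change pairWeight ρ q c (bentPoint δ c (Y t)) * _ = _
    rw [hconst t]
    rfl

/-- Exchanging k and j replaces the multiplier by a difference quotient, and z_k/(z_k+v) -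
z_j/(z_j+v) = v(z_k - z_j)/((z_k+v)(z_j+v)). The double sum becomes the square of a single sum,
minus the missing diagonal. -/
theorem Admissible.sum_pair_resolvent (h : Admissible ρ δ q c) {v : ℝ} (hv : 0 ≤ v)
    (y : ι → ℝ) :
    ∑ k, (1 - v * (bent δ (c k) (y k) + v)⁻¹) * ∑ j, ((2 * ρ * q k * q j : ℝ) : ℂ) *
      (bent δ (c k) (y k) - bent δ (c j) (y j))⁻¹ =
    ρ * v * (resolventSum δ v q c y ^ 2 -
      ∑ k, (q k : ℂ) ^ 2 * (bent δ (c k) (y k) + v)⁻¹ ^ 2) := by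
  classical
  set z : ι → ℂ := fun i => bent δ (c i) (y i) with hz
  set u : ι → ℂ := fun i => (z i + v)⁻¹ with hu
  have hzu : ∀ i, z i + v ≠ 0 := fun i => h.add_ne_zero hv y i
  have hX : ∑ k, (1 - v * u k) * ∑ j, ((2 * ρ * q k * q j : ℝ) : ℂ) * (z k - z j)⁻¹ =
      ∑ k, ∑ j, ((2 * ρ * q k * q j : ℝ) : ℂ) * (z k - z j)⁻¹ * (1 - v * u k) := by
    refine Finset.sum_congr rfl fun k _ => ?_
    rw [Finset.mul_sum]
    exact Finset.sum_congr rfl fun j _ => by ring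
  have hX' : ∑ k, ∑ j, ((2 * ρ * q k * q j : ℝ) : ℂ) * (z k - z j)⁻¹ * (1 - v * u k) =
      ∑ k, ∑ j, -(((2 * ρ * q k * q j : ℝ) : ℂ) * (z k - z j)⁻¹ * (1 - v * u j)) := by
    rw [Finset.sum_comm]
    refine Finset.sum_congr rfl fun k _ => Finset.sum_congr rfl fun j _ => ?_
    rw [← neg_sub (z k) (z j), inv_neg]
    push_cast
    ring
  have hterm : ∀ k j, ((2 * ρ * q k * q j : ℝ) : ℂ) * (z k - z j)⁻¹ * (1 - v * u k) +
      -(((2 * ρ * q k * q j : ℝ) : ℂ) * (z k - z j)⁻¹ * (1 - v * u j)) =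
      2 * ρ * v * ((q k * u k) * (q j * u j) - if k = j then (q k : ℂ) ^ 2 * u k ^ 2 else 0) := by
    intro k j
    by_cases hkj : k = j
    · subst hkj; simp; right; ring
    · have h1 : z k - z j ≠ 0 := h.sub_ne_zero y hkj
      have h2 : u j - u k = (z k - z j) * (u k * u j) := by
        have := hzu k
        have := hzu j
        simp only [hu]
        field_simp
        ring
      rw [if_neg hkj]
      have : ((2 * ρ * q k * q j : ℝ) : ℂ) * (z k - z j)⁻¹ * (1 - v * u k) +
        -(((2 * ρ * q k * q j : ℝ) : ℂ) * (z k - z j)⁻¹ * (1 - v * u j)) =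
        ((2 * ρ * q k * q j : ℝ) : ℂ) * (z k - z j)⁻¹ * (v * (u j - u k)) := by ring
      rw [this, h2]
      push_cast
      field_simp
      ring
  have hsum : 2 * (∑ k, ∑ j, ((2 * ρ * q k * q j : ℝ) : ℂ) * (z k - z j)⁻¹ * (1 - v * u k)) =
      2 * (ρ * v * ((∑ i, (q i : ℂ) * u i) ^ 2 - ∑ k, (q k : ℂ) ^ 2 * u k ^ 2)) := by
    rw [two_mul]
    nth_rw 2 [hX']
    rw [← Finset.sum_add_distrib]
    simp_rw [← Finset.sum_add_distrib, hterm, ← Finset.mul_sum, Finset.sum_sub_distrib,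
      Finset.sum_ite_eq, Finset.mem_univ, if_true, sq (∑ i, (q i : ℂ) * u i), Finset.sum_mul_sum]
    ring
  exact hX.trans (mul_left_cancel₀ two_ne_zero hsum)

/-- With u = (z_k + v)⁻¹, the total coefficient of u² is v(1 - λq - ρq²). The condition `hq` turns
it into -(ρ/λ) v q, linear in q, so the squares assemble into `resolventSqSum`. The pole at 0
disappears because (1 - vu)/z_k = u. -/
theorem Admissible.sum_wardTerm (h : Admissible ρ δ q c) {s lam v : ℝ} (hv : 0 ≤ v)
    (hl : 0 < lam) (hq : ∀ k, ρ * q k ^ 2 + lam * q k - ρ / lam * q k = 1) (y : ι → ℝ) :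
    ((lam ^ 2 / ρ : ℝ) : ℂ) * ∑ k, wardTerm ρ δ s lam v q c y k =
      v * ((lam * resolventSum δ v q c y) ^ 2 - lam * resolventSqSum δ v q c y) +
      (((-lam / ρ * (s - lam) : ℝ) : ℂ) + ((-lam / ρ : ℝ) : ℂ) * v) *
        (lam * resolventSum δ v q c y) -
      ((-lam / ρ : ℝ) : ℂ) * ((lam * ∑ i, q i : ℝ) : ℂ) := by
  have hρ : (ρ : ℂ) ≠ 0 := by exact_mod_cast h.ρ_neg.ne
  have hl0 : (lam : ℂ) ≠ 0 := by exact_mod_cast hl.ne'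
  have hterm : ∀ k, wardTerm ρ δ s lam v q c y k =
      (1 - v * (bent δ (c k) (y k) + v)⁻¹) * (∑ j, ((2 * ρ * q k * q j : ℝ) : ℂ) *
        (bent δ (c k) (y k) - bent δ (c j) (y j))⁻¹) +
      (v * ((ρ : ℂ) * ((q k : ℂ) ^ 2 * (bent δ (c k) (y k) + v)⁻¹ ^ 2)) -
        v * (ρ / lam) * ((q k : ℂ) * (bent δ (c k) (y k) + v)⁻¹ ^ 2)
        + (lam - s - v) * ((q k : ℂ) * (bent δ (c k) (y k) + v)⁻¹) + q k) := by
    intro k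
    have hzv := h.add_ne_zero hv y k
    have hz := h.ne_zero y k
    have hqk : (ρ : ℂ) * q k ^ 2 + lam * q k - ρ / lam * q k = 1 := by exact_mod_cast hq k
    have h1 : (1 - v * (bent δ (c k) (y k) + v)⁻¹) * (bent δ (c k) (y k))⁻¹ =
        (bent δ (c k) (y k) + v)⁻¹ := by
      field_simp
      ring
    unfold wardTerm
    linear_combination (-(s * q k : ℂ)) * h1 - (v * (bent δ (c k) (y k) + v)⁻¹ ^ 2) * hqk
  simp_rw [hterm]
  rw [Finset.sum_add_distrib, h.sum_pair_resolvent hv y]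
  simp only [Finset.sum_add_distrib, Finset.sum_sub_distrib, ← Finset.mul_sum]
  change _ * (_ + (_ - _ * resolventSqSum δ v q c y + _ * resolventSum δ v q c y + _)) = _
  push_cast
  field_simp
  ring

theorem Admissible.bddCont_resolventSum (h : Admissible ρ δ q c) {v : ℝ} (hv : 0 ≤ v) :
    BddCont (resolventSum δ v q c) :=
  BddCont.sum _ fun i _ => (BddCont.const _).mul (h.bddCont_inv_add hv i)

theorem Admissible.bddCont_resolventSqSum (h : Admissible ρ δ q c) {v : ℝ} (hv : 0 ≤ v) :
    BddCont (resolventSqSum δ v q c) :=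
  BddCont.sum _ fun i _ => (BddCont.const _).mul ((h.bddCont_inv_add hv i).pow 2)

/-- With G(v) the integral of the density, the first two integrals are G'' and G': `lam *
resolventSum` is the logarithmic v-derivative of the density, and the v-derivative of `resolventSum`
is `-resolventSqSum`. The statement is therefore v G'' + (b + Rv) G' = RQ G with R = -λ/ρ, b = R(s -
λ) and Q = λ∑q. -/
theorem Admissible.ward_identity (h : Admissible ρ δ q c) {s lam v : ℝ} (hs : 0 < s)
    (hv : 0 ≤ v) (hl : 0 < lam) (hq : ∀ k, ρ * q k ^ 2 + lam * q k - ρ / lam * q k = 1) :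
    v * (∫ y, laguerreDensity ρ δ s lam v q c y *
        ((lam * resolventSum δ v q c y) ^ 2 - lam * resolventSqSum δ v q c y)) +
      (((-lam / ρ * (s - lam) : ℝ) : ℂ) + ((-lam / ρ : ℝ) : ℂ) * v) *
        (∫ y, laguerreDensity ρ δ s lam v q c y * (lam * resolventSum δ v q c y)) -
      ((-lam / ρ : ℝ) : ℂ) * ((lam * ∑ i, q i : ℝ) : ℂ) *
        ∫ y, laguerreDensity ρ δ s lam v q c y = 0 := by
  classical
  have hΨ := h.integrable_density hs hl.le hv
  have hS := h.bddCont_resolventSum hv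
  have hS1 := (BddCont.const (lam : ℂ)).mul hS
  have hS2 := (hS1.pow 2).sub ((BddCont.const (lam : ℂ)).mul (h.bddCont_resolventSqSum hv))
  have hk : ∀ k, ∫ y, laguerreDensity ρ δ s lam v q c y * wardTerm ρ δ s lam v q c y k = 0 := by
    intro k
    refine integral_eq_zero_of_hasLineDerivAt ?_
      (integrable_mul_bddCont hΨ (h.bddCont_wardTerm hv s lam k))
      (h.hasLineDerivAt_density hv k)
    exact integrable_mul_bddCont hΨ (((BddCont.const 1).sub ((BddCont.const _).mul
      (h.bddCont_inv_add hv k))).mul (bddCont_inv_bentDeriv δ k))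
  have hsum : ∫ y, laguerreDensity ρ δ s lam v q c y *
      (((lam ^ 2 / ρ : ℝ) : ℂ) * ∑ k, wardTerm ρ δ s lam v q c y k) = 0 := by
    have : ∀ y, laguerreDensity ρ δ s lam v q c y *
        (((lam ^ 2 / ρ : ℝ) : ℂ) * ∑ k, wardTerm ρ δ s lam v q c y k) =
        ((lam ^ 2 / ρ : ℝ) : ℂ) *
          ∑ k, laguerreDensity ρ δ s lam v q c y * wardTerm ρ δ s lam v q c y k := by
      intro y; rw [← Finset.mul_sum]; ring
    simp_rw [this]
    rw [integral_const_mul, integral_finsetSum _ fun k _ =>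
      integrable_mul_bddCont hΨ (h.bddCont_wardTerm hv s lam k)]
    simp [hk]
  simp_rw [h.sum_wardTerm hv hl hq] at hsum
  rw [← hsum]
  set R : ℂ := ((-lam / ρ : ℝ) : ℂ)
  set b : ℂ := ((-lam / ρ * (s - lam) : ℝ) : ℂ)
  set Q : ℂ := ((lam * ∑ i, q i : ℝ) : ℂ)
  have i2 := (integrable_mul_bddCont hΨ hS2).const_mul (v : ℂ)
  have i1 := (integrable_mul_bddCont hΨ hS1).const_mul (b + R * v)
  have i0 := hΨ.const_mul (R * Q)
  rw [← integral_const_mul, ← integral_const_mul, ← integral_const_mul,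
    ← integral_add i2 i1]
  refine (integral_sub (i2.add i1) i0).symm.trans ?_
  congr 1
  funext y
  simp only [Pi.add_apply]
  ring

end

/-! ### Recursion of the Laguerre-type integral in `s`. -/

theorem ofReal_mul_cpow {r : ℝ} (hr : 0 < r) {z : ℂ} (hz : z ≠ 0) (a : ℝ) :
    ((r : ℂ) * z) ^ (a : ℂ) = ((r ^ a : ℝ) : ℂ) * z ^ (a : ℂ) := by
  have hr0 : (r : ℂ) ≠ 0 := by exact_mod_cast hr.ne'
  rw [Complex.ofReal_cpow hr.le, Complex.cpow_def_of_ne_zero (mul_ne_zero hr0 hz),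
    Complex.cpow_def_of_ne_zero hr0, Complex.cpow_def_of_ne_zero hz, Complex.log_ofReal_mul hr hz,
    ← Complex.exp_add, ← Complex.ofReal_log hr.le]
  ring_nf

/-- The Laguerre-type integral `∫ ∏_{i<j} (z_j-z_i)^{2ρ q_i q_j} ∏ z_i^{-s q_i} e^{q_i z_i} dz`
over bent contours. -/
def laguerreIntegral {ι : Type*} [Fintype ι] (ρ δ s : ℝ) (q c : ι → ℝ) : ℂ :=
  ∫ y, laguerreDensity ρ δ s 0 0 q c y

section
variable {ι : Type*} [Fintype ι] {ρ δ : ℝ} {q c : ι → ℝ}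

/-- At v = 0 the inserted factor is z^{λq}, which merges with z^{-sq}. -/
theorem Admissible.density_zero (h : Admissible ρ δ q c) (s lam : ℝ) (y : ι → ℝ) :
    laguerreDensity ρ δ s lam 0 q c y = laguerreDensity ρ δ (s - lam) 0 0 q c y := by
  unfold laguerreDensity oneBody
  congr 1
  refine Finset.prod_congr rfl fun i _ => ?_
  have := h.ne_zero y i
  simp only [Complex.ofReal_zero, add_zero, zero_mul, Complex.cpow_zero, mul_one]
  rw [← Complex.cpow_add _ _ this]
  congr 3
  push_cast
  ring_nf

/-- A bound for `resolventSum`. -/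
def resolventBound (δ : ℝ) (q c : ι → ℝ) : ℝ := ∑ i, q i * (c i / (1 + δ))⁻¹

/-- A bound for `resolventSqSum`. -/
def resolventSqBound (δ : ℝ) (q c : ι → ℝ) : ℝ := ∑ i, q i * (c i / (1 + δ))⁻¹ ^ 2

theorem Admissible.norm_resolventSum_le (h : Admissible ρ δ q c) {v : ℝ} (hv : 0 ≤ v)
    (y : ι → ℝ) : ‖resolventSum δ v q c y‖ ≤ resolventBound δ q c := by
  refine norm_sum_le_of_le _ fun i _ => ?_
  rw [norm_mul, Complex.norm_real, Real.norm_of_nonneg (h.q_pos i).le]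
  exact mul_le_mul_of_nonneg_left (h.norm_inv_add_le hv y i) (h.q_pos i).le

theorem Admissible.norm_resolventSqSum_le (h : Admissible ρ δ q c) {v : ℝ} (hv : 0 ≤ v)
    (y : ι → ℝ) : ‖resolventSqSum δ v q c y‖ ≤ resolventSqBound δ q c := by
  refine norm_sum_le_of_le _ fun i _ => ?_
  rw [norm_mul, Complex.norm_real, Real.norm_of_nonneg (h.q_pos i).le, norm_pow]
  exact mul_le_mul_of_nonneg_left (pow_le_pow_left₀ (norm_nonneg _) (h.norm_inv_add_le hv y i) 2)
    (h.q_pos i).le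

theorem Admissible.hasDerivAt_density (h : Admissible ρ δ q c) {s lam v : ℝ} (hv : 0 ≤ v)
    (y : ι → ℝ) : HasDerivAt (fun v => laguerreDensity ρ δ s lam v q c y)
      (laguerreDensity ρ δ s lam v q c y * (lam * resolventSum δ v q c y)) v := by
  unfold laguerreDensity
  have hf : ∀ i, HasDerivAt (fun v : ℝ => oneBody s lam v (q i) (bent δ (c i) (y i)) *
      bentDeriv δ (y i)) (oneBody s lam v (q i) (bent δ (c i) (y i)) * bentDeriv δ (y i) *
        ((lam * q i : ℂ) * (bent δ (c i) (y i) + v)⁻¹)) v := by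
    intro i
    have hs : bent δ (c i) (y i) + v ∈ Complex.slitPlane := by
      rw [bent_add]; exact bent_mem_slitPlane (by linarith [h.c_pos i]) _
    have h2 : HasDerivAt (fun v : ℝ => bent δ (c i) (y i) + (v : ℂ)) 1 v := by
      simpa using (hasDerivAt_id v).ofReal_comp.const_add (bent δ (c i) (y i))
    unfold oneBody
    refine ((((h2.cpow_const_log ((lam * q i : ℝ) : ℂ) hs).const_mul _).mul_const _).mul_const
      _).congr_deriv ?_
    push_cast
    ring
  have h1 := hasDerivAt_finset_prod_of_log Finset.univ fun i _ => hf i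
  refine (h1.const_mul _).congr_deriv ?_
  unfold resolventSum
  rw [mul_assoc, Finset.mul_sum (s := Finset.univ) (a := (lam : ℂ))]
  simp only [mul_assoc]

theorem Admissible.hasDerivAt_resolventSum (h : Admissible ρ δ q c) {v : ℝ} (hv : 0 ≤ v)
    (y : ι → ℝ) : HasDerivAt (fun v => resolventSum δ v q c y) (-resolventSqSum δ v q c y) v := by
  unfold resolventSum resolventSqSum
  rw [← Finset.sum_neg_distrib]
  refine HasDerivAt.fun_sum fun i _ => ?_
  have h2 : HasDerivAt (fun v : ℝ => bent δ (c i) (y i) + (v : ℂ)) 1 v := by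
    simpa using (hasDerivAt_id v).ofReal_comp.const_add (bent δ (c i) (y i))
  refine ((h2.fun_inv (h.add_ne_zero hv y i)).const_mul (q i : ℂ)).congr_deriv ?_
  field_simp

/-- Apply `kummer_connection` to the integral as a function of the inserted point v. Its limit at 0
is the integral at s - λ, and its leading coefficient at infinity is the integral at s. -/
theorem Admissible.laguerre_step (h : Admissible ρ δ q c) {s lam : ℝ} (hl : 0 < lam)
    (hs : lam < s) (hq : ∀ k, ρ * q k ^ 2 + lam * q k - ρ / lam * q k = 1) :
    Real.Gamma (-lam / ρ * (s - lam) + lam * ∑ i, q i) * laguerreIntegral ρ δ s q c =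
      (((-lam / ρ) ^ (lam * ∑ i, q i) : ℝ) : ℂ) *
        (Real.Gamma (-lam / ρ * (s - lam)) * laguerreIntegral ρ δ (s - lam) q c) := by
  have hs0 : 0 < s := hl.trans hs
  have hR : 0 < -lam / ρ := div_pos_of_neg_of_neg (by linarith) h.ρ_neg
  have hQ : 0 ≤ lam * ∑ i, q i :=
    mul_nonneg hl.le (Finset.sum_nonneg fun i _ => (h.q_pos i).le)
  set Q := lam * ∑ i, q i with hQdef
  -- A single majorant, up to the factor (1 + v)^Q, serves for the density, both v-derivatives and
  -- both limits, because the resolvents are bounded uniformly in v ≥ 0.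
  set Bd : (ι → ℝ) → ℝ := fun y => pairBound ρ δ q c *
    ∏ i, oneBodyBound δ s lam (q i) (c i) (y i) with hBd
  have hBi : Integrable Bd := h.integrable_bound hl.le
  have hden : ∀ v : ℝ, 0 ≤ v → ∀ y, ‖laguerreDensity ρ δ s lam v q c y‖ ≤ (1 + v) ^ Q * Bd y :=
    fun v hv y => h.norm_density_le hs0 hl.le hv y
  have hBd0 : ∀ y, 0 ≤ Bd y := fun y => by
    have := (norm_nonneg _).trans (hden 0 le_rfl y)
    simpa using this
  set M1 := lam * resolventBound δ q c with hM1
  set M2 := M1 ^ 2 + lam * resolventSqBound δ q c with hM2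
  have hS1 : ∀ v : ℝ, 0 ≤ v → ∀ y, ‖lam * resolventSum δ v q c y‖ ≤ M1 := fun v hv y => by
    rw [norm_mul, Complex.norm_real, Real.norm_of_nonneg hl.le]
    exact mul_le_mul_of_nonneg_left (h.norm_resolventSum_le hv y) hl.le
  have hM10 : 0 ≤ M1 := (norm_nonneg _).trans (hS1 0 le_rfl 0)
  have hS2 : ∀ v : ℝ, 0 ≤ v → ∀ y, ‖(lam * resolventSum δ v q c y) ^ 2 -
      lam * resolventSqSum δ v q c y‖ ≤ M2 := fun v hv y => by
    refine (norm_sub_le _ _).trans (add_le_add ?_ ?_)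
    · rw [norm_pow]; exact pow_le_pow_left₀ (norm_nonneg _) (hS1 v hv y) 2
    · rw [norm_mul, Complex.norm_real, Real.norm_of_nonneg hl.le]
      exact mul_le_mul_of_nonneg_left (h.norm_resolventSqSum_le hv y) hl.le
  have hM20 : 0 ≤ M2 := (norm_nonneg _).trans (hS2 0 le_rfl 0)
  have b1 : ∀ v : ℝ, 0 ≤ v → BddCont fun y : ι → ℝ => lam * resolventSum δ v q c y :=
    fun v hv => (BddCont.const _).mul (h.bddCont_resolventSum hv)
  have b2 : ∀ v : ℝ, 0 ≤ v → BddCont fun y : ι → ℝ => (lam * resolventSum δ v q c y) ^ 2 -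
      lam * resolventSqSum δ v q c y := fun v hv =>
    ((b1 v hv).pow 2).sub ((BddCont.const _).mul (h.bddCont_resolventSqSum hv))
  have i0 : ∀ v : ℝ, 0 ≤ v → Integrable (laguerreDensity ρ δ s lam v q c) := fun v hv =>
    h.integrable_density hs0 hl.le hv
  have hmono : ∀ v0 v : ℝ, v ∈ Ioo 0 (v0 + 1) → (1 + v) ^ Q ≤ (2 + v0) ^ Q := fun v0 v hv =>
    Real.rpow_le_rpow (by linarith [hv.1]) (by linarith [hv.2]) hQ
  have hG : ∀ v > 0, HasDerivAt (fun v => ∫ y, laguerreDensity ρ δ s lam v q c y)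
      (∫ y, laguerreDensity ρ δ s lam v q c y * (lam * resolventSum δ v q c y)) v := by
    intro v hv
    refine (hasDerivAt_integral_of_dominated_loc_of_deriv_le
      (F := fun v y => laguerreDensity ρ δ s lam v q c y)
      (F' := fun v y => laguerreDensity ρ δ s lam v q c y * (lam * resolventSum δ v q c y))
      (bound := fun y => (2 + v) ^ Q * M1 * Bd y)
      (Ioo_mem_nhds hv (by linarith : v < v + 1)) ?_ (i0 v hv.le)
      (integrable_mul_bddCont (i0 v hv.le) (b1 v hv.le)).aestronglyMeasurable
      (Eventually.of_forall fun y t ht => ?_) (hBi.const_mul _)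
      (Eventually.of_forall fun y t ht => h.hasDerivAt_density ht.1.le y)).2
    · filter_upwards [Ioi_mem_nhds hv] with t ht
      exact (i0 t (le_of_lt ht)).aestronglyMeasurable
    · rw [norm_mul]
      calc _ ≤ ((2 + v) ^ Q * Bd y) * M1 := by
            refine mul_le_mul ((hden t ht.1.le y).trans ?_) (hS1 t ht.1.le y) (norm_nonneg _)
              (mul_nonneg (by positivity) (hBd0 y))
            exact mul_le_mul_of_nonneg_right (hmono v t ht) (hBd0 y)
        _ = _ := by ring
  have hG1 : ∀ v > 0, HasDerivAt (fun v => ∫ y, laguerreDensity ρ δ s lam v q c y *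
        (lam * resolventSum δ v q c y))
      (∫ y, laguerreDensity ρ δ s lam v q c y *
        ((lam * resolventSum δ v q c y) ^ 2 - lam * resolventSqSum δ v q c y)) v := by
    intro v hv
    refine (hasDerivAt_integral_of_dominated_loc_of_deriv_le
      (F := fun v y => laguerreDensity ρ δ s lam v q c y * (lam * resolventSum δ v q c y))
      (F' := fun v y => laguerreDensity ρ δ s lam v q c y *
        ((lam * resolventSum δ v q c y) ^ 2 - lam * resolventSqSum δ v q c y))
      (bound := fun y => (2 + v) ^ Q * M2 * Bd y)
      (Ioo_mem_nhds hv (by linarith : v < v + 1)) ?_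
      (integrable_mul_bddCont (i0 v hv.le) (b1 v hv.le))
      (integrable_mul_bddCont (i0 v hv.le) (b2 v hv.le)).aestronglyMeasurable
      (Eventually.of_forall fun y t ht => ?_) (hBi.const_mul _)
      (Eventually.of_forall fun y t ht => ?_)).2
    · filter_upwards [Ioi_mem_nhds hv] with t ht
      exact (integrable_mul_bddCont (i0 t (le_of_lt ht)) (b1 t (le_of_lt ht))).aestronglyMeasurable
    · rw [norm_mul]
      calc _ ≤ ((2 + v) ^ Q * Bd y) * M2 := by
            refine mul_le_mul ((hden t ht.1.le y).trans ?_) (hS2 t ht.1.le y) (norm_nonneg _)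
              (mul_nonneg (by positivity) (hBd0 y))
            exact mul_le_mul_of_nonneg_right (hmono v t ht) (hBd0 y)
        _ = _ := by ring
    · refine ((h.hasDerivAt_density ht.1.le y).mul
        ((h.hasDerivAt_resolventSum ht.1.le y).const_mul (lam : ℂ))).congr_deriv ?_
      ring
  have bG : ∀ v > 0, ‖∫ y, laguerreDensity ρ δ s lam v q c y‖ ≤
      ((1 + M1) * ∫ y, Bd y) * (1 + v) ^ Q := by
    intro v hv
    refine (norm_integral_le_of_norm_le ((hBi.const_mul ((1 + v) ^ Q)).const_mul (1 + M1))
      (Eventually.of_forall fun y => ?_)).trans (le_of_eq ?_)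
    · refine (hden v hv.le y).trans ?_
      have : 0 ≤ (1 + v) ^ Q * Bd y := mul_nonneg (by positivity) (hBd0 y)
      nlinarith
    · rw [integral_const_mul, integral_const_mul]; ring
  have bG1 : ∀ v > 0, ‖∫ y, laguerreDensity ρ δ s lam v q c y *
      (lam * resolventSum δ v q c y)‖ ≤ ((1 + M1) * ∫ y, Bd y) * (1 + v) ^ Q := by
    intro v hv
    refine (norm_integral_le_of_norm_le ((hBi.const_mul ((1 + v) ^ Q)).const_mul (1 + M1))
      (Eventually.of_forall fun y => ?_)).trans (le_of_eq ?_)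
    · rw [norm_mul]
      have h0 : 0 ≤ (1 + v) ^ Q * Bd y := mul_nonneg (by positivity) (hBd0 y)
      have := mul_le_mul (hden v hv.le y) (hS1 v hv.le y) (norm_nonneg _) h0
      nlinarith
    · rw [integral_const_mul, integral_const_mul]; ring
  have h0 : Tendsto (fun v => ∫ y, laguerreDensity ρ δ s lam v q c y) (𝓝[>] 0)
      (𝓝 (laguerreIntegral ρ δ (s - lam) q c)) := by
    have e : laguerreIntegral ρ δ (s - lam) q c = ∫ y, laguerreDensity ρ δ s lam 0 q c y := by
      unfold laguerreIntegral
      simp_rw [h.density_zero s lam]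
    rw [e]
    refine tendsto_integral_filter_of_dominated_convergence (fun y => 2 ^ Q * Bd y) ?_ ?_
      (hBi.const_mul _) (Eventually.of_forall fun y => ?_)
    · filter_upwards [self_mem_nhdsWithin] with v hv
      exact (i0 v (le_of_lt hv)).aestronglyMeasurable
    · filter_upwards [self_mem_nhdsWithin,
        mem_nhdsWithin_of_mem_nhds (Iio_mem_nhds (zero_lt_one' ℝ))] with v hv hv1
      refine Eventually.of_forall fun y => (hden v (le_of_lt hv) y).trans ?_
      have hv : 0 < v := hv
      have hv1 : v < 1 := hv1
      exact mul_le_mul_of_nonneg_right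
        (Real.rpow_le_rpow (by linarith) (by linarith) hQ) (hBd0 y)
    · exact (h.hasDerivAt_density le_rfl y).continuousAt.tendsto.mono_left nhdsWithin_le_nhds
  have hA : Tendsto (fun v : ℝ => (∫ y, laguerreDensity ρ δ s lam v q c y) / ((v ^ Q : ℝ) : ℂ))
      atTop (𝓝 (laguerreIntegral ρ δ s q c)) := by
    simp_rw [← integral_div]
    refine tendsto_integral_filter_of_dominated_convergence (fun y => 2 ^ Q * Bd y) ?_ ?_
      (hBi.const_mul _) (Eventually.of_forall fun y => ?_)
    · filter_upwards [eventually_ge_atTop 0] with v hv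
      exact ((i0 v hv).div_const _).aestronglyMeasurable
    · filter_upwards [eventually_ge_atTop 1] with v hv
      refine Eventually.of_forall fun y => ?_
      have hv0 : 0 < v := by linarith
      rw [norm_div, Complex.norm_real, Real.norm_of_nonneg (by positivity),
        div_le_iff₀ (by positivity)]
      refine (hden v hv0.le y).trans ?_
      have : (1 + v) ^ Q ≤ 2 ^ Q * v ^ Q := by
        rw [← Real.mul_rpow (by norm_num) hv0.le]
        exact Real.rpow_le_rpow (by positivity) (by linarith) hQ
      nlinarith [mul_le_mul_of_nonneg_right this (hBd0 y)]
    -- Distributing v^Q over the particles turns each (z_i + v)^{λ q_i} into (1 + z_i/v)^{λ q_i},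
    -- which tends to 1.
    · have hlim : Tendsto (fun v : ℝ => pairWeight ρ q c (bentPoint δ c y) *
          ∏ i, (bent δ (c i) (y i) ^ ((-(s * q i) : ℝ) : ℂ) *
            (1 + bent δ (c i) (y i) / v) ^ ((lam * q i : ℝ) : ℂ) *
            Complex.exp (q i * bent δ (c i) (y i)) * bentDeriv δ (y i))) atTop
          (𝓝 (laguerreDensity ρ δ s 0 0 q c y)) := by
        unfold laguerreDensity oneBody
        refine Tendsto.const_mul _ (tendsto_finsetProd _ fun i _ => ?_)
        refine Tendsto.mul_const _ (Tendsto.mul_const _ (Tendsto.const_mul _ ?_))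
        rw [zero_mul, Complex.ofReal_zero, Complex.cpow_zero]
        have h1 : Tendsto (fun v : ℝ => 1 + bent δ (c i) (y i) / v) atTop (𝓝 (1 + 0)) := by
          refine Tendsto.const_add _ ?_
          have := (Complex.continuous_ofReal.tendsto 0).comp tendsto_inv_atTop_zero
          simpa [div_eq_mul_inv] using this.const_mul (bent δ (c i) (y i))
        rw [add_zero] at h1
        have h2 : ContinuousAt (fun z : ℂ => z ^ ((lam * q i : ℝ) : ℂ)) 1 :=
          continuousAt_cpow_const (by simp)
        have := h2.tendsto.comp h1
        rwa [Complex.one_cpow] at this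
      refine hlim.congr' ?_
      filter_upwards [eventually_gt_atTop 0] with v hv
      have hv0 : (v : ℂ) ≠ 0 := by exact_mod_cast hv.ne'
      have hvQ : ∀ i, bent δ (c i) (y i) + v ≠ 0 := h.add_ne_zero hv.le y
      have e1 : ((v ^ Q : ℝ) : ℂ) = ∏ i, ((v ^ (lam * q i) : ℝ) : ℂ) := by
        rw [← Complex.ofReal_prod, ← Real.rpow_sum_of_pos hv, ← Finset.mul_sum]
      rw [e1]
      unfold laguerreDensity oneBody
      rw [mul_div_assoc, ← Finset.prod_div_distrib]
      congr 1
      refine Finset.prod_congr rfl fun i _ => ?_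
      have e2 : bent δ (c i) (y i) + v = (v : ℂ) * (1 + bent δ (c i) (y i) / v) := by
        field_simp; ring
      have e3 : (1 + bent δ (c i) (y i) / v) ≠ 0 := by
        intro h0
        apply hvQ i
        rw [e2, h0, mul_zero]
      have e4 : ((v ^ (lam * q i) : ℝ) : ℂ) ≠ 0 := by
        exact_mod_cast (Real.rpow_pos_of_pos hv _).ne'
      rw [e2, ofReal_mul_cpow hv e3, eq_div_iff e4]
      ring
  have ode : ∀ v : ℝ, 0 < v → _ := fun v hv => h.ward_identity hs0 hv.le hl hq
  exact kummer_connection (mul_pos hR (by linarith)) hR hQ hG hG1 bG bG1 ode h0 hA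

end

/-! ### Removing the innermost particle by a residue. -/

theorem pairWeight_succAbove {N : ℕ} {ρ : ℝ} {q c : Fin (N + 1) → ℝ} (i₀ : Fin (N + 1))
    (hmin : ∀ j, c i₀ < c (i₀.succAbove j)) (z : Fin (N + 1) → ℂ) :
    pairWeight ρ q c z = (∏ j, (z (i₀.succAbove j) - z i₀) ^
        ((2 * ρ * q i₀ * q (i₀.succAbove j) : ℝ) : ℂ)) *
      pairWeight ρ (fun j => q (i₀.succAbove j)) (fun j => c (i₀.succAbove j))
        (fun j => z (i₀.succAbove j)) := by
  unfold pairWeight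
  rw [Fin.prod_univ_succAbove _ i₀, Fin.prod_univ_succAbove _ i₀]
  simp only [lt_irrefl, if_false, one_mul, hmin, if_true]
  congr 1
  refine Finset.prod_congr rfl fun i _ => ?_
  rw [Fin.prod_univ_succAbove _ i₀, if_neg (hmin i).not_gt, one_mul]

theorem Admissible.succAbove {N : ℕ} {ρ δ : ℝ} {q c : Fin (N + 1) → ℝ} (h : Admissible ρ δ q c)
    (i₀ : Fin (N + 1)) :
    Admissible ρ δ (fun j => q (i₀.succAbove j)) (fun j => c (i₀.succAbove j)) :=
  ⟨h.ρ_neg, h.δ_pos, fun _ => h.q_pos _, fun _ => h.c_pos _,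
    h.inj.comp Fin.succAbove_right_injective⟩

/-- Closing the innermost contour around the simple pole at the origin. -/
theorem Admissible.laguerre_collapse {N : ℕ} {ρ δ : ℝ} {q c : Fin (N + 1) → ℝ}
    (h : Admissible ρ δ q c) (i₀ : Fin (N + 1)) (hmin : ∀ j, c i₀ < c (i₀.succAbove j)) :
    laguerreIntegral ρ δ (1 / q i₀) q c = 2 * Real.pi * Complex.I *
      laguerreIntegral ρ δ (1 / q i₀ - 2 * ρ * q i₀) (fun j => q (i₀.succAbove j))
        (fun j => c (i₀.succAbove j)) := by
  have hq0 := h.q_pos i₀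
  have hs : 0 < 1 / q i₀ := by positivity
  have hδ := h.δ_pos
  have hint := h.integrable_density hs le_rfl le_rfl
  have hmp := (volume_preserving_piFinSuccAbove (fun _ : Fin (N + 1) => ℝ) i₀).symm
  have h' := h.succAbove i₀
  set q' : Fin N → ℝ := fun j => q (i₀.succAbove j) with hq'
  set c' : Fin N → ℝ := fun j => c (i₀.succAbove j) with hc'
  set F : (Fin N → ℝ) → ℂ := fun y => pairWeight ρ q' c' (bentPoint δ c' y) *
    ∏ j, (oneBody (1 / q i₀) 0 0 (q' j) (bent δ (c' j) (y j)) * bentDeriv δ (y j)) with hF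
  -- The interaction of the innermost particle with the others: holomorphic in z to the left of all
  -- the outer contours, and bounded up to the innermost one.
  set H : (Fin N → ℝ) → ℂ → ℂ := fun y z =>
    ∏ j, (bent δ (c' j) (y j) - z) ^ ((2 * ρ * q i₀ * q' j : ℝ) : ℂ) with hH
  have hfun : ∀ (x : ℝ) (y : Fin N → ℝ), laguerreDensity ρ δ (1 / q i₀) 0 0 q c
      ((MeasurableEquiv.piFinSuccAbove (fun _ : Fin (N + 1) => ℝ) i₀).symm (x, y)) =
      F y * ((Complex.exp (q i₀ * bent δ (c i₀) x) * H y (bent δ (c i₀) x) /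
        bent δ (c i₀) x) * bentDeriv δ x) := by
    intro x y
    have e : (MeasurableEquiv.piFinSuccAbove (fun _ : Fin (N + 1) => ℝ) i₀).symm (x, y) =
        i₀.insertNth x y := rfl
    rw [e]
    unfold laguerreDensity
    rw [pairWeight_succAbove i₀ hmin, Fin.prod_univ_succAbove _ i₀]
    simp only [bentPoint, Fin.insertNth_apply_same, Fin.insertNth_apply_succAbove]
    -- Here s q = 1, so z^{-sq} is the single-valued simple pole z⁻¹.
    have e2 : oneBody (1 / q i₀) 0 0 (q i₀) (bent δ (c i₀) x) =
        Complex.exp (q i₀ * bent δ (c i₀) x) / bent δ (c i₀) x := by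
      unfold oneBody
      rw [one_div_mul_cancel hq0.ne', zero_mul, Complex.ofReal_zero, Complex.cpow_zero,
        Complex.ofReal_neg, Complex.ofReal_one, Complex.cpow_neg_one]
      ring
    rw [e2]
    change (∏ j, (bent δ (c' j) (y j) - bent δ (c i₀) x) ^ ((2 * ρ * q i₀ * q' j : ℝ) : ℂ)) *
      pairWeight ρ q' c' (bentPoint δ c' y) * (Complex.exp (q i₀ * bent δ (c i₀) x) /
        bent δ (c i₀) x * bentDeriv δ x * ∏ j, (oneBody (1 / q i₀) 0 0 (q' j)
          (bent δ (c' j) (y j)) * bentDeriv δ (y j))) = _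
    simp only [hF, hH]
    ring
  have hinner : ∀ y : Fin N → ℝ, ∫ x, F y * ((Complex.exp (q i₀ * bent δ (c i₀) x) *
      H y (bent δ (c i₀) x) / bent δ (c i₀) x) * bentDeriv δ x) =
      2 * Real.pi * Complex.I * (F y * H y 0) := by
    intro y
    -- The next contour position serves as c₃; with no other particle any larger value does.
    obtain ⟨c₃, h03, hc3⟩ : ∃ c₃, c i₀ < c₃ ∧ ∀ j, c₃ ≤ c' j := by
      rcases isEmpty_or_nonempty (Fin N) with hN | hN
      · exact ⟨c i₀ + 1, by linarith, fun j => hN.elim j⟩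
      · exact ⟨Finset.univ.inf' Finset.univ_nonempty c',
          (Finset.lt_inf'_iff _).mpr fun j _ => hmin j,
          fun j => Finset.inf'_le _ (Finset.mem_univ j)⟩
    rw [integral_const_mul, integral_bent_exp_mul_div (h := H y) (c₃ := c₃)
      (C := ∏ j, ((c' j - c i₀) / (1 + δ)) ^ (2 * ρ * q i₀ * q' j)) hδ (h.c_pos i₀) h03 hq0]
    · ring
    · simp only [hH]
      refine DifferentiableOn.fun_finsetProd fun j _ => ?_
      refine DifferentiableOn.cpow_const (by fun_prop) fun z hz => ?_
      obtain ⟨c'', hlt, e⟩ := eq_bent_of_mem_leftOf hz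
      rw [e]
      exact bent_sub_mem_slitPlane (hlt.trans_le (hc3 j)) _ _
    · intro c'' hc'' x
      simp only [hH]
      rw [norm_prod]
      refine Finset.prod_le_prod (fun j _ => norm_nonneg _) fun j _ => ?_
      rw [Complex.norm_cpow_real]
      have hj := hmin j
      refine Real.rpow_le_rpow_of_nonpos (div_pos (sub_pos.mpr hj) (by positivity)) ?_ ?_
      · refine le_trans ?_ (le_norm_bent_sub hδ.le _ _)
        gcongr
      · have := mul_pos hq0 (h'.q_pos j)
        nlinarith [h.ρ_neg]
  unfold laguerreIntegral
  rw [← hmp.integral_comp' (g := laguerreDensity ρ δ (1 / q i₀) 0 0 q c)]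
  have hint2 := (hmp.integrable_comp_emb (MeasurableEquiv.measurableEmbedding _)
    (g := laguerreDensity ρ δ (1 / q i₀) 0 0 q c)).mpr hint
  rw [Measure.volume_eq_prod]
  rw [Measure.volume_eq_prod] at hint2
  refine (integral_prod_symm _ hint2).trans ?_
  simp_rw [Function.comp_apply, hfun, hinner]
  rw [integral_const_mul]
  congr 1
  congr 1
  funext y
  simp only [hF, hH, sub_zero, laguerreDensity]
  rw [mul_assoc, ← Finset.prod_mul_distrib]
  congr 1
  refine Finset.prod_congr rfl fun j _ => ?_
  have hz := h'.ne_zero y j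
  unfold oneBody
  -- At z = 0 the interaction reduces to ∏ z_j^{2ρ q_{i₀} q_j}, which lowers s by 2ρ q_{i₀}.
  have : ((-((1 / q i₀ - 2 * ρ * q i₀) * q' j) : ℝ) : ℂ) =
      ((-(1 / q i₀ * q' j) : ℝ) : ℂ) + ((2 * ρ * q i₀ * q' j : ℝ) : ℂ) := by
    push_cast; ring
  rw [this, Complex.cpow_add _ _ hz]
  ring

/-! ### Gamma identities behind the closed form. -/

theorem Gamma_add_nat_eq {x : ℝ} (hx : 0 < x) (k : ℕ) :
    Real.Gamma (x + k) = Real.Gamma x * ∏ l ∈ Finset.range k, (x + l) := by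
  induction k with
  | zero => simp
  | succ k ih =>
    rw [Finset.prod_range_succ, ← mul_assoc, ← ih, Nat.cast_succ, ← add_assoc,
      Real.Gamma_add_one (by positivity)]
    ring

/-- The `s`-dependent part of the value of the Laguerre-type integral with `n` particles of charge
`r = -1/ρ` and `m` particles of charge `1`. -/
def laguerreShape (ρ : ℝ) (n m : ℕ) (s : ℝ) : ℝ :=
  (-1 / ρ) ^ (n * (-1 / ρ) * s) /
    ((∏ i ∈ Finset.range n, Real.Gamma ((s + i) * (-1 / ρ))) *
      ∏ l ∈ Finset.range m, Real.Gamma (s + n - l * ρ))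

/-- The normalisation constant of the Laguerre-type integral. -/
def laguerreConst (ρ : ℝ) (n m : ℕ) : ℝ :=
  (-1 / ρ) ^ (n * (n - 1) * (-1 / ρ) - n) *
    ((∏ i ∈ Finset.range n, Real.Gamma (1 + -1 / ρ) / Real.Gamma (1 + (i + 1) * (-1 / ρ))) *
      ∏ j ∈ Finset.range m, Real.Gamma (1 - ρ) / Real.Gamma (n + 1 - (j + 1) * ρ))

section
variable {ρ : ℝ}

theorem prod_Gamma_pos {k : ℕ} {f : ℕ → ℝ} (hf : ∀ i, 0 < f i) :
    0 < ∏ i ∈ Finset.range k, Real.Gamma (f i) :=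
  Finset.prod_pos fun i _ => Real.Gamma_pos_of_pos (hf i)

/-- Increasing s by 1 shifts the index in the first Gamma product, which telescopes, and raises each
argument of the second by 1. The linear factors so produced match Γ((s + n)r + m)/Γ((s + n)r),
because r(s + n - lρ) = (s + n)r + l. -/
theorem laguerreShape_step_one (hρ : ρ < 0) (n m : ℕ) {s : ℝ} (hs : 0 < s) :
    Real.Gamma (-1 / ρ * s + (m + n * (-1 / ρ))) * laguerreShape ρ n m (s + 1) =
      (-1 / ρ) ^ (m + n * (-1 / ρ)) * (Real.Gamma (-1 / ρ * s) * laguerreShape ρ n m s) := by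
  obtain ⟨r, hr, hrρ⟩ : ∃ r : ℝ, 0 < r ∧ -1 / ρ = r := ⟨_, div_pos_of_neg_of_neg (by norm_num) hρ, rfl⟩
  have hρr : r * ρ = -1 := by rw [← hrρ]; field_simp [hρ.ne]
  have hlρ : ∀ l : ℕ, 0 ≤ -(l * ρ) := fun l => by
    have : (0 : ℝ) ≤ l := Nat.cast_nonneg l
    nlinarith
  unfold laguerreShape
  rw [hrρ]
  have hA : (∏ i ∈ Finset.range n, Real.Gamma ((s + 1 + i) * r)) * Real.Gamma (r * s) =
      (∏ i ∈ Finset.range n, Real.Gamma ((s + i) * r)) * Real.Gamma ((s + n) * r) := by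
    have h1 := Finset.prod_range_succ (fun i : ℕ => Real.Gamma ((s + i) * r)) n
    rw [Finset.prod_range_succ'] at h1
    rw [← h1]
    congr 1
    · refine Finset.prod_congr rfl fun i _ => ?_
      push_cast; ring_nf
    · push_cast; ring_nf
  have hB : (∏ l ∈ Finset.range m, Real.Gamma (s + 1 + n - l * ρ)) =
      (∏ l ∈ Finset.range m, (s + n - l * ρ)) *
        ∏ l ∈ Finset.range m, Real.Gamma (s + n - l * ρ) := by
    rw [← Finset.prod_mul_distrib]
    refine Finset.prod_congr rfl fun l _ => ?_
    have := hlρ l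
    rw [← Real.Gamma_add_one (by have : (0 : ℝ) ≤ n := Nat.cast_nonneg n; linarith)]
    ring_nf
  have hG : Real.Gamma (r * s + (m + n * r)) = Real.Gamma ((s + n) * r) *
      (r ^ m * ∏ l ∈ Finset.range m, (s + n - l * ρ)) := by
    rw [show r * s + (m + n * r) = (s + n) * r + m by ring, Gamma_add_nat_eq (by positivity)]
    congr 1
    rw [← Finset.card_range m, ← Finset.prod_const, Finset.card_range, ← Finset.prod_mul_distrib]
    refine Finset.prod_congr rfl fun l _ => ?_
    linear_combination l * hρr
  have p1 : 0 < ∏ i ∈ Finset.range n, Real.Gamma ((s + 1 + i) * r) :=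
    prod_Gamma_pos fun i => by positivity
  have p2 : 0 < ∏ i ∈ Finset.range n, Real.Gamma ((s + i) * r) :=
    prod_Gamma_pos fun i => by positivity
  have p3 : 0 < ∏ l ∈ Finset.range m, Real.Gamma (s + n - l * ρ) :=
    prod_Gamma_pos fun l => by
      have := hlρ l
      have : (0 : ℝ) ≤ n := Nat.cast_nonneg n
      linarith
  have p4 : 0 < ∏ l ∈ Finset.range m, (s + n - l * ρ) :=
    Finset.prod_pos fun l _ => by
      have := hlρ l
      have : (0 : ℝ) ≤ n := Nat.cast_nonneg n
      linarith
  have p5 : 0 < Real.Gamma (r * s) := Real.Gamma_pos_of_pos (by positivity)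
  rw [hB, hG, Real.rpow_add hr, Real.rpow_natCast,
    show n * r * (s + 1) = n * r + n * r * s by ring, Real.rpow_add hr]
  rw [← mul_div_assoc, ← mul_div_assoc, ← mul_div_assoc, div_eq_div_iff (by positivity) (by positivity)]
  linear_combination (-(r ^ m * (∏ l ∈ Finset.range m, (s + n - l * ρ)) * (r ^ (n * r) *
    r ^ (n * r * s)) * ∏ l ∈ Finset.range m, Real.Gamma (s + n - l * ρ))) * hA

/-- The two products exchange roles: replacing s by s - ρ raises the arguments of the first by 1,
since rρ = -1, and shifts the index of the second. -/
theorem laguerreShape_step_neg_rho (hρ : ρ < 0) (n m : ℕ) {s : ℝ} (hs : 0 < s) :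
    Real.Gamma (s + -ρ * (m + n * (-1 / ρ))) * laguerreShape ρ n m (s - ρ) =
      Real.Gamma s * laguerreShape ρ n m s := by
  obtain ⟨r, hr, hrρ⟩ : ∃ r : ℝ, 0 < r ∧ -1 / ρ = r := ⟨_, div_pos_of_neg_of_neg (by norm_num) hρ, rfl⟩
  have hρr : r * ρ = -1 := by rw [← hrρ]; field_simp [hρ.ne]
  have hlρ : ∀ l : ℕ, 0 ≤ -(l * ρ) := fun l => by
    have : (0 : ℝ) ≤ l := Nat.cast_nonneg l
    nlinarith
  have hn0 : (0 : ℝ) ≤ n := Nat.cast_nonneg n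
  unfold laguerreShape
  rw [hrρ]
  have hA : (∏ i ∈ Finset.range n, Real.Gamma ((s - ρ + i) * r)) =
      r ^ n * (∏ i ∈ Finset.range n, (s + i)) *
        ∏ i ∈ Finset.range n, Real.Gamma ((s + i) * r) := by
    rw [← Finset.card_range n, ← Finset.prod_const, Finset.card_range, ← Finset.prod_mul_distrib,
      ← Finset.prod_mul_distrib]
    refine Finset.prod_congr rfl fun i _ => ?_
    rw [show r * (s + i) = (s + i) * r by ring, ← Real.Gamma_add_one (by positivity)]
    congr 1
    linear_combination -hρr
  have hB : (∏ l ∈ Finset.range m, Real.Gamma (s - ρ + n - l * ρ)) * Real.Gamma (s + n) =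
      (∏ l ∈ Finset.range m, Real.Gamma (s + n - l * ρ)) * Real.Gamma (s + n - m * ρ) := by
    have h1 := Finset.prod_range_succ (fun l : ℕ => Real.Gamma (s + n - l * ρ)) m
    rw [Finset.prod_range_succ'] at h1
    rw [← h1]
    congr 1
    · refine Finset.prod_congr rfl fun i _ => ?_
      push_cast; ring_nf
    · push_cast; ring_nf
  have hG : s + -ρ * (m + n * r) = s + n - m * ρ := by linear_combination (-n : ℝ) * hρr
  have hG2 := Gamma_add_nat_eq hs n
  have hpow : r ^ (n * r * (s - ρ)) = r ^ n * r ^ (n * r * s) := by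
    rw [show n * r * (s - ρ) = n + n * r * s by linear_combination (-n : ℝ) * hρr,
      Real.rpow_add hr, Real.rpow_natCast]
  have p2 : 0 < ∏ i ∈ Finset.range n, Real.Gamma ((s + i) * r) :=
    prod_Gamma_pos fun i => by positivity
  have p1 : 0 < ∏ i ∈ Finset.range n, (s + i) := Finset.prod_pos fun i _ => by positivity
  have p3 : 0 < ∏ l ∈ Finset.range m, Real.Gamma (s + n - l * ρ) :=
    prod_Gamma_pos fun l => by linarith [hlρ l]
  have p4 : 0 < ∏ l ∈ Finset.range m, Real.Gamma (s - ρ + n - l * ρ) :=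
    prod_Gamma_pos fun l => by linarith [hlρ l]
  rw [hG, hpow, hA, ← mul_div_assoc, ← mul_div_assoc, div_eq_div_iff (by positivity) (by positivity)]
  rw [hG2] at hB
  linear_combination (-(r ^ n * r ^ (n * r * s) *
    ∏ i ∈ Finset.range n, Real.Gamma ((s + i) * r))) * hB

/-- Compatibility with removing a particle of charge 1: the collapse takes place at s = 1 and leaves
the smaller system at 1 - 2ρ. -/
theorem laguerre_base_one (hρ : ρ < 0) (n m : ℕ) :
    laguerreConst ρ n (m + 1) * laguerreShape ρ n (m + 1) 1 =
      laguerreConst ρ n m * laguerreShape ρ n m (1 - 2 * ρ) := by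
  obtain ⟨r, hr, hrρ⟩ : ∃ r : ℝ, 0 < r ∧ -1 / ρ = r := ⟨_, div_pos_of_neg_of_neg (by norm_num) hρ, rfl⟩
  have hρr : r * ρ = -1 := by rw [← hrρ]; field_simp [hρ.ne]
  have hlρ : ∀ l : ℕ, 0 ≤ -(l * ρ) := fun l => by
    have : (0 : ℝ) ≤ l := Nat.cast_nonneg l
    nlinarith
  have hn0 : (0 : ℝ) ≤ n := Nat.cast_nonneg n
  unfold laguerreConst laguerreShape
  rw [hrρ, Finset.prod_range_succ (fun j : ℕ => Real.Gamma (1 - ρ) / _)]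
  have hA : (∏ i ∈ Finset.range n, Real.Gamma ((1 - 2 * ρ + i) * r)) =
      r ^ n * r ^ n * ((∏ i ∈ Finset.range n, ((1 : ℝ) + i)) *
        ∏ i ∈ Finset.range n, (1 - ρ + i)) * ∏ i ∈ Finset.range n, Real.Gamma ((1 + i) * r) := by
    rw [← Finset.card_range n, ← Finset.prod_const, Finset.card_range, ← Finset.prod_mul_distrib,
      ← Finset.prod_mul_distrib, ← Finset.prod_mul_distrib, ← Finset.prod_mul_distrib]
    refine Finset.prod_congr rfl fun i _ => ?_
    have e : (1 - 2 * ρ + i) * r = (1 + i) * r + 1 + 1 := by linear_combination (-2) * hρr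
    rw [e, Real.Gamma_add_one (by positivity), Real.Gamma_add_one (by positivity)]
    linear_combination (Real.Gamma ((1 + i) * r) * (1 + i) * r) * hρr
  -- Both sides are the product over l from 0 to m + 1, with l = 0, 1 split off on the left and l =
  -- m + 1 on the right.
  have hB : (∏ l ∈ Finset.range m, Real.Gamma (1 - 2 * ρ + n - l * ρ)) *
      Real.Gamma (1 - ρ + n) * Real.Gamma (1 + n) =
      (∏ l ∈ Finset.range (m + 1), Real.Gamma (1 + n - l * ρ)) *
        Real.Gamma (n + 1 - (m + 1) * ρ) := by
    have h1 := Finset.prod_range_succ (fun l : ℕ => Real.Gamma (1 + n - l * ρ)) (m + 1)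
    rw [Finset.prod_range_succ', Finset.prod_range_succ'] at h1
    have e1 : Real.Gamma (n + 1 - (m + 1) * ρ) = Real.Gamma (1 + n - ((m + 1 : ℕ) : ℝ) * ρ) := by
      push_cast; ring_nf
    rw [e1, ← h1]
    congr 2
    · refine Finset.prod_congr rfl fun i _ => ?_
      push_cast; ring_nf
    · push_cast; ring_nf
    · push_cast; ring_nf
  rw [Gamma_add_nat_eq (by linarith : 0 < 1 - ρ) n, Gamma_add_nat_eq one_pos n, Real.Gamma_one,
    one_mul] at hB
  have hpow : r ^ (n * r * (1 - 2 * ρ)) = r ^ n * r ^ n * r ^ (n * r * 1) := by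
    rw [show n * r * (1 - 2 * ρ) = n + n + n * r * 1 by linear_combination (-2 * n : ℝ) * hρr,
      Real.rpow_add hr, Real.rpow_add hr, Real.rpow_natCast]
  have p1 : 0 < ∏ i ∈ Finset.range n, ((1 : ℝ) + i) := Finset.prod_pos fun i _ => by positivity
  have p2 : 0 < ∏ i ∈ Finset.range n, Real.Gamma ((1 + i) * r) :=
    prod_Gamma_pos fun i => by positivity
  have p3 : 0 < ∏ i ∈ Finset.range n, (1 - ρ + i) := Finset.prod_pos fun i _ => by
    have : (0 : ℝ) ≤ i := Nat.cast_nonneg i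
    linarith
  have p4 : 0 < ∏ l ∈ Finset.range (m + 1), Real.Gamma (1 + n - l * ρ) :=
    prod_Gamma_pos fun l => by linarith [hlρ l]
  have p5 : 0 < ∏ l ∈ Finset.range m, Real.Gamma (1 - 2 * ρ + n - l * ρ) :=
    prod_Gamma_pos fun l => by linarith [hlρ l]
  have p6 : 0 < Real.Gamma (n + 1 - (m + 1) * ρ) := Real.Gamma_pos_of_pos (by
    have := hlρ m; linarith)
  rw [hA, hpow]
  generalize (∏ i ∈ Finset.range n, Real.Gamma (1 + r) / Real.Gamma (1 + (i + 1) * r)) = X at *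
  generalize (∏ j ∈ Finset.range m, Real.Gamma (1 - ρ) / Real.Gamma (n + 1 - (j + 1) * ρ)) = Y at *
  generalize (∏ i ∈ Finset.range n, ((1 : ℝ) + i)) = a1 at *
  generalize (∏ i ∈ Finset.range n, Real.Gamma ((1 + i) * r)) = a2 at *
  generalize (∏ i ∈ Finset.range n, (1 - ρ + i)) = a3 at *
  generalize (∏ l ∈ Finset.range (m + 1), Real.Gamma (1 + n - l * ρ)) = a4 at *
  generalize (∏ l ∈ Finset.range m, Real.Gamma (1 - 2 * ρ + n - l * ρ)) = a5 at *
  generalize Real.Gamma (n + 1 - (m + 1) * ρ) = a6 at *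
  generalize Real.Gamma (1 - ρ) = g at *
  generalize r ^ (n * (n - 1) * r - n) = r1 at *
  generalize r ^ (n * r * 1) = r2 at *
  have e1 : r1 * (X * (Y * (g / a6))) * (r2 / (a2 * a4)) =
      r1 * X * Y * r2 / a2 * (g / (a4 * a6)) := by field_simp
  have e2 : r1 * (X * Y) * (r ^ n * r ^ n * r2 / (r ^ n * r ^ n * (a1 * a3) * a2 * a5)) =
      r1 * X * Y * r2 / a2 * (1 / (a1 * a3 * a5)) := by field_simp
  rw [e1, e2]
  congr 1
  rw [div_eq_div_iff (by positivity) (by positivity)]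
  linear_combination hB

/-- Compatibility with removing a particle of charge -1/ρ: the collapse takes place at s = -ρ and
leaves the smaller system at 2 - ρ. -/
theorem laguerre_base_neg_rho (hρ : ρ < 0) (n m : ℕ) :
    laguerreConst ρ (n + 1) m * laguerreShape ρ (n + 1) m (-ρ) =
      laguerreConst ρ n m * laguerreShape ρ n m (2 - ρ) := by
  obtain ⟨r, hr, hrρ⟩ : ∃ r : ℝ, 0 < r ∧ -1 / ρ = r := ⟨_, div_pos_of_neg_of_neg (by norm_num) hρ, rfl⟩
  have hρr : r * ρ = -1 := by rw [← hrρ]; field_simp [hρ.ne]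
  have hlρ : ∀ l : ℕ, 0 ≤ -(l * ρ) := fun l => by
    have : (0 : ℝ) ≤ l := Nat.cast_nonneg l
    nlinarith
  have hn0 : (0 : ℝ) ≤ n := Nat.cast_nonneg n
  unfold laguerreConst laguerreShape
  rw [hrρ]
  simp only [Finset.prod_div_distrib, Finset.prod_const, Finset.card_range]
  have hA1 : (∏ i ∈ Finset.range (n + 1), Real.Gamma ((-ρ + i) * r)) =
      ∏ i ∈ Finset.range n, Real.Gamma (1 + (i + 1) * r) := by
    rw [Finset.prod_range_succ']
    have e : (-ρ + ((0 : ℕ) : ℝ)) * r = 1 := by push_cast; linear_combination -hρr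
    rw [e, Real.Gamma_one, mul_one]
    refine Finset.prod_congr rfl fun i _ => ?_
    congr 1
    push_cast
    linear_combination -hρr
  have hA2 : (∏ i ∈ Finset.range n, Real.Gamma ((2 - ρ + i) * r)) * Real.Gamma (1 + r) =
      ∏ i ∈ Finset.range (n + 1), Real.Gamma (1 + (i + 1) * r) := by
    rw [Finset.prod_range_succ']
    congr 1
    · refine Finset.prod_congr rfl fun i _ => ?_
      congr 1
      push_cast
      linear_combination -hρr
    · simp
  have hB1 : ∏ l ∈ Finset.range m, Real.Gamma (-ρ + ((n + 1 : ℕ) : ℝ) - l * ρ) =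
      ∏ j ∈ Finset.range m, Real.Gamma (n + 1 - (j + 1) * ρ) :=
    Finset.prod_congr rfl fun i _ => by push_cast; ring_nf
  have hB2 : ∏ l ∈ Finset.range m, Real.Gamma (2 - ρ + n - l * ρ) =
      ∏ j ∈ Finset.range m, Real.Gamma (((n + 1 : ℕ) : ℝ) + 1 - (j + 1) * ρ) :=
    Finset.prod_congr rfl fun i _ => by push_cast; ring_nf
  have hpow : r ^ (((n + 1 : ℕ) : ℝ) * (((n + 1 : ℕ) : ℝ) - 1) * r - ((n + 1 : ℕ) : ℝ)) *
      r ^ (((n + 1 : ℕ) : ℝ) * r * (-ρ)) =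
      r ^ (n * (n - 1) * r - n) * r ^ (n * r * (2 - ρ)) := by
    rw [← Real.rpow_add hr, ← Real.rpow_add hr]
    congr 1
    push_cast
    linear_combination (-1 : ℝ) * hρr
  have p1 : 0 < ∏ i ∈ Finset.range n, Real.Gamma ((2 - ρ + i) * r) :=
    prod_Gamma_pos fun i => mul_pos (by linarith [(Nat.cast_nonneg i : (0 : ℝ) ≤ i)]) hr
  have p2 : 0 < ∏ i ∈ Finset.range n, Real.Gamma (1 + (i + 1) * r) :=
    prod_Gamma_pos fun i => by positivity
  have p3 : 0 < ∏ j ∈ Finset.range m, Real.Gamma (n + 1 - (j + 1) * ρ) :=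
    prod_Gamma_pos fun j => by linarith [hlρ j]
  have p4 : 0 < ∏ j ∈ Finset.range m, Real.Gamma (((n + 1 : ℕ) : ℝ) + 1 - (j + 1) * ρ) :=
    prod_Gamma_pos fun j => by push_cast; linarith [hlρ j]
  have p5 : 0 < Real.Gamma (1 + r) := Real.Gamma_pos_of_pos (by positivity)
  rw [hA1, hB1, hB2, ← hA2]
  generalize (∏ i ∈ Finset.range n, Real.Gamma ((2 - ρ + i) * r)) = a1 at *
  generalize (∏ i ∈ Finset.range n, Real.Gamma (1 + (i + 1) * r)) = a2 at *
  generalize (∏ j ∈ Finset.range m, Real.Gamma (n + 1 - (j + 1) * ρ)) = a3 at *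
  generalize (∏ j ∈ Finset.range m, Real.Gamma (((n + 1 : ℕ) : ℝ) + 1 - (j + 1) * ρ)) = a4 at *
  generalize Real.Gamma (1 + r) = g at *
  generalize r ^ (((n + 1 : ℕ) : ℝ) * (((n + 1 : ℕ) : ℝ) - 1) * r - ((n + 1 : ℕ) : ℝ)) = r1 at *
  generalize r ^ (((n + 1 : ℕ) : ℝ) * r * (-ρ)) = r2 at *
  generalize r ^ (n * (n - 1) * r - n) = r3 at *
  generalize r ^ (n * r * (2 - ρ)) = r4 at *
  generalize Real.Gamma (1 - ρ) ^ m = G at *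
  have e1 : r1 * (g ^ (n + 1) / (a1 * g) * (G / a4)) * (r2 / (a2 * a3)) =
      g ^ n * G / (a1 * a2 * a3 * a4) * (r1 * r2) := by field_simp; ring
  have e2 : r3 * (g ^ n / a2 * (G / a3)) * (r4 / (a1 * a4)) =
      g ^ n * G / (a1 * a2 * a3 * a4) * (r3 * r4) := by field_simp
  rw [e1, e2, hpow]

end

/-! ### Values of the Laguerre-type integral on a lattice, by induction on the particles. -/

/-- The charges of the two species of particles. -/
def charge (ρ : ℝ) (b : Bool) : ℝ := if b then 1 else -1 / ρ

theorem charge_pos {ρ : ℝ} (hρ : ρ < 0) (b : Bool) : 0 < charge ρ b := by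
  cases b
  · exact div_pos_of_neg_of_neg (by norm_num) hρ
  · exact one_pos

/-- The number of particles of a given species. -/
def species {N : ℕ} (σ : Fin N → Bool) (b : Bool) : ℕ := ∑ i, if σ i = b then 1 else 0

theorem species_succAbove {N : ℕ} (σ : Fin (N + 1) → Bool) (i₀ : Fin (N + 1)) (b : Bool) :
    species σ b = species (fun j => σ (i₀.succAbove j)) b + if σ i₀ = b then 1 else 0 := by
  unfold species
  rw [Fin.sum_univ_succAbove _ i₀, add_comm]

theorem sum_charge {N : ℕ} (ρ : ℝ) (σ : Fin N → Bool) :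
    ∑ i, charge ρ (σ i) = species σ true + species σ false * (-1 / ρ) := by
  unfold species
  push_cast
  rw [Finset.sum_mul, ← Finset.sum_add_distrib]
  refine Finset.sum_congr rfl fun i _ => ?_
  cases σ i <;> simp [charge]

section
variable {ρ δ s : ℝ} {N : ℕ} {σ : Fin N → Bool} {c : Fin N → ℝ}

theorem eq_mul_of_same_recursion {G P g F F' : ℝ} {D D' C : ℂ} (hG : G ≠ 0)
    (hD : (G : ℂ) * D' = P * (g * D)) (hF : G * F' = P * (g * F)) (h : D = C * F) :
    D' = C * F' := by
  have h3 := congrArg (fun x : ℝ => (x : ℂ)) hF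
  simp only [Complex.ofReal_mul] at h3
  refine mul_left_cancel₀ (a := (G : ℂ)) (by exact_mod_cast hG) ?_
  rw [hD, h]
  linear_combination (-C) * h3

/-- This is λ = 1 in `Admissible.laguerre_step`: the charge condition factors with roots 1 and -1/ρ,
exactly the two species. -/
theorem Admissible.laguerre_add_one (h : Admissible ρ δ (fun i => charge ρ (σ i)) c) (hs : 0 < s)
    {C : ℂ} (hD : laguerreIntegral ρ δ s (fun i => charge ρ (σ i)) c =
      C * laguerreShape ρ (species σ false) (species σ true) s) :
    laguerreIntegral ρ δ (s + 1) (fun i => charge ρ (σ i)) c =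
      C * laguerreShape ρ (species σ false) (species σ true) (s + 1) := by
  have hr : 0 < -1 / ρ := div_pos_of_neg_of_neg (by norm_num) h.ρ_neg
  have hρ := h.ρ_neg.ne
  have h1 := h.laguerre_step (lam := 1) (s := s + 1) one_pos (by linarith) (fun k => by
    cases σ k <;> simp only [charge, if_true, Bool.false_eq_true, if_false] <;> field_simp <;> ring)
  have h2 := laguerreShape_step_one h.ρ_neg (species σ false) (species σ true) hs
  rw [sum_charge, add_sub_cancel_right, one_mul] at h1
  exact eq_mul_of_same_recursion (Real.Gamma_pos_of_pos (by positivity)).ne' h1 h2 hD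

/-- The choice λ = -ρ gives the same two roots, and R = -λ/ρ = 1, so the power of R drops out. -/
theorem Admissible.laguerre_sub_rho (h : Admissible ρ δ (fun i => charge ρ (σ i)) c) (hs : 0 < s)
    {C : ℂ} (hD : laguerreIntegral ρ δ s (fun i => charge ρ (σ i)) c =
      C * laguerreShape ρ (species σ false) (species σ true) s) :
    laguerreIntegral ρ δ (s - ρ) (fun i => charge ρ (σ i)) c =
      C * laguerreShape ρ (species σ false) (species σ true) (s - ρ) := by
  have hr : 0 < -1 / ρ := div_pos_of_neg_of_neg (by norm_num) h.ρ_neg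
  have hn := h.ρ_neg
  have hρ := h.ρ_neg.ne
  have hρ' : 0 < -ρ := by linarith
  have h1 := h.laguerre_step (lam := -ρ) (s := s - ρ) hρ' (by linarith) (fun k => by
    cases σ k <;> simp only [charge, if_true, Bool.false_eq_true, if_false] <;> field_simp <;> ring)
  have h2 := laguerreShape_step_neg_rho h.ρ_neg (species σ false) (species σ true) hs
  rw [sum_charge, sub_neg_eq_add, sub_add_cancel, neg_neg, div_self hρ, one_mul, Real.one_rpow] at h1
  rw [← one_mul (Real.Gamma s * _)] at h2
  exact eq_mul_of_same_recursion (Real.Gamma_pos_of_pos (by positivity)).ne' h1 h2 hD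

theorem Admissible.laguerre_lattice (h : Admissible ρ δ (fun i => charge ρ (σ i)) c) (hs : 0 < s)
    {C : ℂ} (hD : laguerreIntegral ρ δ s (fun i => charge ρ (σ i)) c =
      C * laguerreShape ρ (species σ false) (species σ true) s) (a b : ℕ) :
    laguerreIntegral ρ δ (s + a - b * ρ) (fun i => charge ρ (σ i)) c =
      C * laguerreShape ρ (species σ false) (species σ true) (s + a - b * ρ) := by
  have hA : ∀ a : ℕ, laguerreIntegral ρ δ (s + a) (fun i => charge ρ (σ i)) c =
      C * laguerreShape ρ (species σ false) (species σ true) (s + a) := by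
    intro a
    induction a with
    | zero => simpa using hD
    | succ a ih =>
      have := h.laguerre_add_one (by positivity) ih
      rwa [add_assoc, ← Nat.cast_succ] at this
  induction b with
  | zero => simpa using hA a
  | succ b ih =>
    have h0 : 0 < s + a - b * ρ := by
      have : (b : ℝ) * ρ ≤ 0 := mul_nonpos_of_nonneg_of_nonpos b.cast_nonneg h.ρ_neg.le
      have : (0 : ℝ) ≤ a := a.cast_nonneg
      linarith
    have := h.laguerre_sub_rho h0 ih
    rwa [show s + a - b * ρ - ρ = s + a - (b + 1 : ℕ) * ρ by push_cast; ring] at this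

/-- The Laguerre-type integral at the points `a - bρ` with positive integers `a`, `b`. -/
theorem laguerreIntegral_eq (δ ρ : ℝ) (hδ : 0 < δ) (hρ : ρ < 0) (N : ℕ) :
    ∀ (σ : Fin N → Bool) (c : Fin N → ℝ), (∀ i, 0 < c i) → Function.Injective c → ∀ a b : ℕ,
      laguerreIntegral ρ δ (a + 1 - (b + 1) * ρ) (fun i => charge ρ (σ i)) c =
        (2 * Real.pi * Complex.I) ^ N * laguerreConst ρ (species σ false) (species σ true) *
          laguerreShape ρ (species σ false) (species σ true) (a + 1 - (b + 1) * ρ) := by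
  induction N with
  | zero =>
    intro σ c _ _ a b
    simp [laguerreIntegral, laguerreDensity, pairWeight, species, laguerreConst, laguerreShape,
      Measure.volume_pi_eq_dirac (0 : Fin 0 → ℝ)]
  | succ N ih =>
    intro σ c hc hinj a b
    have h : Admissible ρ δ (fun i => charge ρ (σ i)) c :=
      ⟨hρ, hδ, fun i => charge_pos hρ _, hc, hinj⟩
    obtain ⟨i₀, hi₀⟩ := Finite.exists_min c
    have hmin : ∀ j, c i₀ < c (i₀.succAbove j) := fun j =>
      lt_of_le_of_ne (hi₀ _) fun e => Fin.ne_succAbove i₀ j (hinj e)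
    have hcol := h.laguerre_collapse i₀ hmin
    have ih' := ih (fun j => σ (i₀.succAbove j)) (fun j => c (i₀.succAbove j)) (fun _ => hc _)
      (hinj.comp Fin.succAbove_right_injective)
    have s1 := species_succAbove σ i₀ false
    have s2 := species_succAbove σ i₀ true
    cases hσ : σ i₀ with
    -- The collapse at s = 1 lands on 1 - 2ρ, the point (0, 1) of the lattice for N particles. From
    -- s = 1, a steps of 1 and b + 1 steps of -ρ reach the target.
    | true =>
      simp only [hσ, if_true, Bool.true_eq_false, if_false, add_zero] at s1 s2
      simp only [hσ, charge, if_true] at hcol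
      have h1 := ih' 0 1
      rw [show 1 / 1 - 2 * ρ * 1 = ((0 : ℕ) : ℝ) + 1 - (((1 : ℕ) : ℝ) + 1) * ρ by push_cast; ring]
        at hcol
      simp only [charge] at h1
      rw [h1, ← s1] at hcol
      have hb := laguerre_base_one hρ (species σ false) (species (fun j => σ (i₀.succAbove j)) true)
      rw [← s2] at hb
      have hb' := congrArg (fun x : ℝ => (x : ℂ)) hb
      simp only [Complex.ofReal_mul] at hb'
      have h2 := h.laguerre_lattice (s := 1) one_pos
        (C := (2 * Real.pi * Complex.I) ^ (N + 1) *
          laguerreConst ρ (species σ false) (species σ true)) (by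
        rw [mul_assoc, hb', ← div_one (1 : ℝ)]
        simp only [charge]
        rw [hcol]
        push_cast
        ring_nf) a (b + 1)
      rw [show (a : ℝ) + 1 - (b + 1) * ρ = 1 + a - (b + 1 : ℕ) * ρ by push_cast; ring]
      exact h2
    -- The collapse at s = -ρ lands on 2 - ρ, the lattice point (1, 0). From s = -ρ, a + 1 steps of
    -- 1 and b steps of -ρ are needed. Restricting to a + 1, b + 1 ≥ 1 makes both starting points
    -- usable.
    | false =>
      simp only [hσ, if_true, Bool.false_eq_true, if_false, add_zero] at s1 s2
      simp only [hσ, charge, Bool.false_eq_true, if_false] at hcol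
      have h1 := ih' 1 0
      have e1 : 1 / (-1 / ρ) = -ρ := by field_simp [hρ.ne]
      have e2 : -ρ - 2 * ρ * (-1 / ρ) = ((1 : ℕ) : ℝ) + 1 - (((0 : ℕ) : ℝ) + 1) * ρ := by
        push_cast; field_simp [hρ.ne]; ring
      rw [e1, e2] at hcol
      simp only [charge] at h1
      rw [h1, ← s2] at hcol
      have hb := laguerre_base_neg_rho hρ (species (fun j => σ (i₀.succAbove j)) false)
        (species σ true)
      rw [← s1] at hb
      have hb' := congrArg (fun x : ℝ => (x : ℂ)) hb
      simp only [Complex.ofReal_mul] at hb'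
      have h2 := h.laguerre_lattice (s := -ρ) (by linarith)
        (C := (2 * Real.pi * Complex.I) ^ (N + 1) *
          laguerreConst ρ (species σ false) (species σ true)) (by
        rw [mul_assoc, hb']
        simp only [charge]
        rw [hcol]
        push_cast
        ring_nf) (a + 1) b
      rw [show (a : ℝ) + 1 - (b + 1) * ρ = -ρ + (a + 1 : ℕ) - b * ρ by push_cast; ring]
      exact h2

end

/-! ### Rescaling at the saddle point and the Gaussian limit. -/

/-- The contour `bent (1/s) (s + √s c) (√s y)`, recentred at `s` and rescaled by `√s`. -/
def scaledBent (s c y : ℝ) : ℂ :=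
  ((c - bend (Real.sqrt s * y) / (s * Real.sqrt s) : ℝ) : ℂ) + y * Complex.I

/-- The exponent z - s log z has its saddle at z = s, with width √s. The slope δ is free in
`laguerreIntegral_eq`; taking it to be 1/s makes the rescaled contour tend to a vertical line. -/
theorem bent_eq_scaledBent {s : ℝ} (hs : 0 < s) (c y : ℝ) :
    bent (1 / s) (s + Real.sqrt s * c) (Real.sqrt s * y) = s + Real.sqrt s * scaledBent s c y := by
  have h1 : Real.sqrt s ≠ 0 := (Real.sqrt_pos.mpr hs).ne'
  have h2 : 1 / s * bend (Real.sqrt s * y) =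
      Real.sqrt s * (bend (Real.sqrt s * y) / (s * Real.sqrt s)) := by
    field_simp
  unfold bent scaledBent
  rw [h2]
  push_cast
  ring

theorem bend_div_le {s : ℝ} (hs : 0 < s) (y : ℝ) :
    bend (Real.sqrt s * y) / (s * Real.sqrt s) ≤ |y| / s := by
  have h1 := Real.sqrt_pos.mpr hs
  rw [div_le_div_iff₀ (by positivity) hs]
  have := bend_le_abs (Real.sqrt s * y)
  rw [abs_mul, abs_of_pos h1] at this
  nlinarith

/-- With u = (a - t) + ib the right side is |1 + u|² e^{-2 Re u}. The inequality e^{-x} ≥ 1 - x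
reduces the claim to a polynomial one, where t ≤ |b|/8 makes the bending harmless. -/
theorem le_exp_of_abs_le {a t b : ℝ} (ha : |a| ≤ 1 / 4) (ht : 0 ≤ t) (htb : t ≤ |b| / 8) :
    (1 - 4 * a ^ 2) * (1 + b ^ 2 / 4) ≤
      ((1 + (a - t)) ^ 2 + b ^ 2) * Real.exp (-(2 * (a - t))) := by
  have ha' := (abs_le.mp ha).2
  have h1 : (1 - (a - t)) ^ 2 ≤ Real.exp (-(2 * (a - t))) := by
    rw [show -(2 * (a - t)) = -(a - t) + -(a - t) by ring, Real.exp_add, ← sq]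
    have := Real.add_one_le_exp (-(a - t))
    exact pow_le_pow_left₀ (by linarith) (by linarith) 2
  have h2 : t ^ 2 ≤ b ^ 2 / 64 := by
    have := pow_le_pow_left₀ ht htb 2
    rw [div_pow, sq_abs] at this
    linarith
  have h3 : (a - t) ^ 2 ≤ 2 * a ^ 2 + b ^ 2 / 32 := by nlinarith [sq_nonneg (a + t)]
  have h4 : (9 : ℝ) / 16 ≤ (1 - (a - t)) ^ 2 := by nlinarith
  calc _ ≤ ((1 + (a - t)) ^ 2 + b ^ 2) * (1 - (a - t)) ^ 2 := by
        nlinarith [mul_nonneg (sq_nonneg b) (sub_nonneg.mpr h4), sq_nonneg ((a - t) ^ 2),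
          mul_nonneg (sq_nonneg a) (sq_nonneg b)]
    _ ≤ _ := mul_le_mul_of_nonneg_left h1 (by positivity)

/-- The one-particle factor of the rescaled Laguerre-type density. -/
def scaledBody (s q c y : ℝ) : ℂ :=
  Complex.exp (q * s * (scaledBent s c y / Real.sqrt s -
    Complex.log (1 + scaledBent s c y / Real.sqrt s))) * bentDeriv (1 / s) (Real.sqrt s * y)

/-- Raise `le_exp_of_abs_le` to the power -qs/2 with a = c/√s and b = y/√s. The first factor
contributes e^{4c²q}, and Bernoulli's inequality bounds the second by (1 + q y²/8)⁻¹, uniformly in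
s. The hypotheses give t ≤ |b|/8, |a| ≤ 1/4 and a Bernoulli exponent at least 1; the leading 2
bounds `bentDeriv`. -/
theorem norm_scaledBody_le {s q c : ℝ} (hq : 0 < q) (hs : 8 ≤ s) (hc : 16 * c ^ 2 ≤ s)
    (hsq : 2 ≤ q * s) (y : ℝ) :
    ‖scaledBody s q c y‖ ≤ 2 * Real.exp (4 * c ^ 2 * q) * (1 + q / 8 * y ^ 2)⁻¹ := by
  have hs0 : 0 < s := by linarith
  have hr := Real.sqrt_pos.mpr hs0
  have hr2 := Real.sq_sqrt hs0.le
  set r := Real.sqrt s with hrdef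
  set u := scaledBent s c y / (r : ℂ) with hu
  set a := c / r with ha
  set t := bend (r * y) / (s * r) / r with ht
  set b := y / r with hb
  have ure : u.re = a - t := by
    rw [hu, Complex.div_ofReal_re, scaledBent, ← hrdef]
    simp only [Complex.add_re, Complex.ofReal_re, Complex.re_ofReal_mul, Complex.I_re, mul_zero,
      add_zero]
    rw [sub_div]
  have uim : u.im = b := by
    rw [hu, Complex.div_ofReal_im, scaledBent, ← hrdef]
    simp only [Complex.add_im, Complex.ofReal_im, Complex.im_ofReal_mul, Complex.I_im, mul_one,
      zero_add]
    exact hb.symm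
  have a2 : a ^ 2 = c ^ 2 / s := by rw [ha, div_pow, hr2]
  have b2 : b ^ 2 = y ^ 2 / s := by rw [hb, div_pow, hr2]
  have ha4 : |a| ≤ 1 / 4 := by
    refine abs_le_of_sq_le_sq ?_ (by norm_num)
    rw [a2, div_le_iff₀ hs0]
    linarith
  have ht0 : 0 ≤ t := div_nonneg (div_nonneg (bend_nonneg _) (by positivity)) hr.le
  have htb : t ≤ |b| / 8 := by
    have h1 : t ≤ |y| / s / r := div_le_div_of_nonneg_right (bend_div_le hs0 y) hr.le
    rw [hb, abs_div, abs_of_pos hr]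
    calc t ≤ |y| / s / r := h1
      _ ≤ |y| / 8 / r := by gcongr
      _ = |y| / r / 8 := by ring
  have key := le_exp_of_abs_le ha4 ht0 htb
  have hx : 4 * a ^ 2 ≤ 1 / 4 := by
    have := abs_le.mp ha4
    nlinarith
  have hx1 : 0 < 1 - 4 * a ^ 2 := by linarith
  have hb1 : 0 < 1 + b ^ 2 / 4 := by positivity
  have hn2 : ‖1 + u‖ ^ 2 = (1 + (a - t)) ^ 2 + b ^ 2 := by
    rw [← Complex.normSq_eq_norm_sq, Complex.normSq_apply]
    simp only [Complex.add_re, Complex.one_re, Complex.add_im, Complex.one_im, ure, uim]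
    ring
  have hpos : 0 < ‖1 + u‖ ^ 2 := by
    rw [hn2]
    exact pos_of_mul_pos_left ((mul_pos hx1 hb1).trans_le key) (Real.exp_pos _).le
  have hlog : Real.log (1 - 4 * a ^ 2) + Real.log (1 + b ^ 2 / 4) ≤
      2 * Real.log ‖1 + u‖ - 2 * (a - t) := by
    have h := Real.log_le_log (mul_pos hx1 hb1) key
    rw [← hn2, Real.log_mul hx1.ne' hb1.ne', Real.log_mul hpos.ne' (Real.exp_pos _).ne',
      Real.log_exp, Real.log_pow] at h
    push_cast at h
    linarith
  have hl1 : -(8 * a ^ 2) ≤ Real.log (1 - 4 * a ^ 2) := by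
    have h := Real.one_sub_inv_le_log_of_pos hx1
    refine le_trans ?_ h
    have : (1 - 4 * a ^ 2)⁻¹ ≤ 1 + 8 * a ^ 2 := by
      rw [inv_le_iff_one_le_mul₀ hx1]
      nlinarith [sq_nonneg a]
    linarith
  have hexp : ‖Complex.exp (q * s * (u - Complex.log (1 + u)))‖ ≤
      Real.exp (4 * c ^ 2 * q) * (1 + q / 8 * y ^ 2)⁻¹ := by
    rw [Complex.norm_exp]
    have e1 : (q * s * (u - Complex.log (1 + u)) : ℂ).re =
        q * s * ((a - t) - Real.log ‖1 + u‖) := by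
      rw [← Complex.ofReal_mul, Complex.re_ofReal_mul, Complex.sub_re, Complex.log_re, ure]
    rw [e1]
    have e2 : q * s * ((a - t) - Real.log ‖1 + u‖) ≤
        4 * c ^ 2 * q + -(Real.log (1 + b ^ 2 / 4) * (q * s / 2)) := by
      have e3 : 4 * c ^ 2 * q = q * s / 2 * (8 * a ^ 2) := by rw [a2]; field_simp; ring
      rw [e3]
      have : 0 ≤ q * s / 2 := by positivity
      nlinarith
    refine (Real.exp_le_exp.mpr e2).trans ?_
    rw [Real.exp_add, Real.exp_neg, ← Real.rpow_def_of_pos hb1]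
    have hB := one_add_mul_self_le_rpow_one_add (s := b ^ 2 / 4) (p := q * s / 2)
      (by linarith [sq_nonneg b]) (by linarith)
    rw [b2] at hB ⊢
    have e4 : q * s / 2 * (y ^ 2 / s / 4) = q / 8 * y ^ 2 := by field_simp; ring
    rw [e4] at hB
    gcongr
  unfold scaledBody
  rw [norm_mul, ← hrdef, ← hu]
  have hd := norm_bentDeriv_le (δ := 1 / s) (by positivity) (r * y)
  have : 1 / s ≤ 1 := by rw [div_le_one hs0]; linarith
  calc _ ≤ (Real.exp (4 * c ^ 2 * q) * (1 + q / 8 * y ^ 2)⁻¹) * 2 := by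
        gcongr
        linarith
    _ = _ := by ring

theorem tendsto_scaledBent (c y : ℝ) :
    Tendsto (fun s => scaledBent s c y) atTop (𝓝 ((c : ℂ) + y * Complex.I)) := by
  unfold scaledBent
  refine Tendsto.add ?_ tendsto_const_nhds
  refine (Complex.continuous_ofReal.tendsto _).comp ?_
  have h : Tendsto (fun s : ℝ => bend (Real.sqrt s * y) / (s * Real.sqrt s)) atTop (𝓝 0) := by
    refine tendsto_of_tendsto_of_tendsto_of_le_of_le' tendsto_const_nhds
      (tendsto_const_nhds.div_atTop tendsto_id : Tendsto (fun s : ℝ => |y| / s) atTop (𝓝 0)) ?_ ?_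
    · filter_upwards [eventually_gt_atTop 0] with s hs
      exact div_nonneg (bend_nonneg _) (by positivity)
    · filter_upwards [eventually_gt_atTop 0] with s hs
      exact bend_div_le hs y
  simpa using tendsto_const_nhds.sub h

theorem tendsto_bentDeriv (y : ℝ) :
    Tendsto (fun s => bentDeriv (1 / s) (Real.sqrt s * y)) atTop (𝓝 Complex.I) := by
  rw [tendsto_iff_norm_sub_tendsto_zero]
  refine squeeze_zero' (Eventually.of_forall fun _ => norm_nonneg _) ?_
    (tendsto_const_nhds.div_atTop tendsto_id : Tendsto (fun s : ℝ => 1 / s) atTop (𝓝 0))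
  filter_upwards [eventually_gt_atTop 0] with s hs
  unfold bentDeriv
  rw [add_sub_cancel_right, Complex.norm_real, Real.norm_eq_abs, abs_neg, abs_mul,
    abs_of_pos (by positivity : 0 < 1 / s)]
  refine mul_le_of_le_one_right (by positivity) ?_
  rw [abs_div, abs_of_nonneg (Real.sqrt_nonneg _), div_le_one (Real.sqrt_pos.mpr (by positivity))]
  exact Real.abs_le_sqrt (by linarith)

/-- Since u - log(1 + u) = u²/2 + O(u³) and √s u → w, the quadratic term gives w²/2 while s u³ → 0.
-/
theorem tendsto_mul_sub_log {u : ℝ → ℂ} {w : ℂ}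
    (hw : Tendsto (fun s : ℝ => (Real.sqrt s : ℂ) * u s) atTop (𝓝 w)) :
    Tendsto (fun s : ℝ => (s : ℂ) * (u s - Complex.log (1 + u s))) atTop (𝓝 (w ^ 2 / 2)) := by
  have hinv : Tendsto (fun s : ℝ => ((Real.sqrt s : ℂ))⁻¹) atTop (𝓝 0) := by
    have : Tendsto (fun s : ℝ => (Real.sqrt s)⁻¹) atTop (𝓝 0) :=
      tendsto_inv_atTop_zero.comp Real.tendsto_sqrt_atTop
    have := (Complex.continuous_ofReal.tendsto _).comp this
    simpa [Function.comp_def] using this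
  have hu : Tendsto u atTop (𝓝 0) := by
    have := hinv.mul hw
    rw [zero_mul] at this
    refine this.congr' ?_
    filter_upwards [eventually_gt_atTop 0] with s hs
    have : (Real.sqrt s : ℂ) ≠ 0 := by exact_mod_cast (Real.sqrt_pos.mpr hs).ne'
    field_simp
  have hO := (Complex.log_sub_logTaylor_isBigO 2).comp_tendsto hu
  have hO2 := (Asymptotics.isBigO_refl (fun s : ℝ => (s : ℂ)) atTop).mul hO
  have hlim : Tendsto (fun s : ℝ => (s : ℂ) * u s ^ 3) atTop (𝓝 0) := by
    have := (hw.pow 2).mul hu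
    rw [mul_zero] at this
    refine this.congr' ?_
    filter_upwards [eventually_gt_atTop 0] with s hs
    have : (Real.sqrt s : ℂ) ^ 2 = s := by exact_mod_cast Real.sq_sqrt hs.le
    rw [mul_pow, this]
    ring
  have hR := hO2.trans_tendsto hlim
  have := ((hw.pow 2).div_const 2).sub hR
  rw [sub_zero] at this
  refine this.congr' ?_
  filter_upwards [eventually_gt_atTop 0] with s hs
  have h2 : (Real.sqrt s : ℂ) ^ 2 = s := by exact_mod_cast Real.sq_sqrt hs.le
  simp only [Function.comp_def, Complex.logTaylor_succ, Complex.logTaylor_zero, Pi.add_apply]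
  rw [mul_pow, h2]
  push_cast
  ring

theorem tendsto_scaledBody (q c y : ℝ) :
    Tendsto (fun s => scaledBody s q c y) atTop
      (𝓝 (Complex.exp (q * ((c : ℂ) + y * Complex.I) ^ 2 / 2) * Complex.I)) := by
  unfold scaledBody
  refine Tendsto.mul ?_ (tendsto_bentDeriv y)
  refine (Complex.continuous_exp.tendsto _).comp ?_
  have h := tendsto_mul_sub_log (u := fun s => scaledBent s c y / Real.sqrt s)
    (w := (c : ℂ) + y * Complex.I) (by
      refine (tendsto_scaledBent c y).congr' ?_
      filter_upwards [eventually_gt_atTop 0] with s hs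
      have : (Real.sqrt s : ℂ) ≠ 0 := by exact_mod_cast (Real.sqrt_pos.mpr hs).ne'
      field_simp)
  have := h.const_mul (q : ℂ)
  rw [mul_div_assoc]
  exact this.congr fun s => by ring

section
variable {ι : Type*} [Fintype ι]

/-- The degree of homogeneity of `pairWeight`. -/
def pairExponent (ρ : ℝ) (q c : ι → ℝ) : ℝ := ∑ i, ∑ j, if c i < c j then 2 * ρ * q i * q j else 0

theorem pairWeight_affine (ρ : ℝ) {q c c' : ι → ℝ} {r : ℝ} (hr : 0 < r) (a : ℂ) {z : ι → ℂ}
    (hc : ∀ i j, c' i < c' j ↔ c i < c j) (hz : ∀ i j, c i < c j → z j - z i ≠ 0) :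
    pairWeight ρ q c' (fun i => a + r * z i) =
      ((r ^ pairExponent ρ q c : ℝ) : ℂ) * pairWeight ρ q c z := by
  unfold pairWeight pairExponent
  rw [Real.rpow_sum_of_pos hr]
  simp_rw [Real.rpow_sum_of_pos hr]
  simp only [Complex.ofReal_prod, ← Finset.prod_mul_distrib, hc]
  refine Finset.prod_congr rfl fun i _ => Finset.prod_congr rfl fun j _ => ?_
  split_ifs with hij
  · rw [add_sub_add_left_eq_sub, ← mul_sub, ofReal_mul_cpow hr (hz i j hij)]
  · simp

theorem scaledBent_sub_mem_slitPlane (s : ℝ) (hs : 0 < s) {c c' : ℝ} (h : c < c') (y y' : ℝ) :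
    scaledBent s c' y' - scaledBent s c y ∈ Complex.slitPlane ∧
      (s ≥ 1 → (c' - c) / 2 ≤ ‖scaledBent s c' y' - scaledBent s c y‖) := by
  have hr := Real.sqrt_pos.mpr hs
  have hr' : (Real.sqrt s : ℂ) ≠ 0 := by exact_mod_cast hr.ne'
  have e : scaledBent s c' y' - scaledBent s c y = ((Real.sqrt s)⁻¹ : ℝ) *
      (bent (1 / s) (s + Real.sqrt s * c') (Real.sqrt s * y') -
        bent (1 / s) (s + Real.sqrt s * c) (Real.sqrt s * y)) := by
    rw [bent_eq_scaledBent hs, bent_eq_scaledBent hs]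
    push_cast
    field_simp
    ring
  rw [e]
  have h' : s + Real.sqrt s * c < s + Real.sqrt s * c' := by gcongr
  constructor
  · have := bent_sub_mem_slitPlane (δ := 1 / s) h' (Real.sqrt s * y) (Real.sqrt s * y')
    rw [Complex.mem_slitPlane_iff] at this ⊢
    rw [Complex.re_ofReal_mul, Complex.im_ofReal_mul]
    refine this.imp (fun h => by positivity) fun h => mul_ne_zero (by positivity) h
  · intro hs1
    have := le_norm_bent_sub (δ := 1 / s) (c := s + Real.sqrt s * c) (c' := s + Real.sqrt s * c')
      (by positivity) (Real.sqrt s * y) (Real.sqrt s * y')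
    rw [norm_mul, Complex.norm_real, Real.norm_eq_abs, abs_of_pos (by positivity)]
    have h1 : 1 / s ≤ 1 := by rw [div_le_one hs]; exact hs1
    have h2 : Real.sqrt s * (c' - c) / 2 ≤ Real.sqrt s * (c' - c) / (1 + 1 / s) := by
      have := sub_pos.mpr h
      have h0 : 0 < 1 / s := by positivity
      apply div_le_div_of_nonneg_left (by positivity) (by positivity) (by linarith)
    rw [add_sub_add_left_eq_sub, ← mul_sub] at this
    calc (c' - c) / 2 = (Real.sqrt s)⁻¹ * (Real.sqrt s * (c' - c) / 2) := by field_simp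
      _ ≤ _ := mul_le_mul_of_nonneg_left (h2.trans this) (by positivity)

/-- The Laguerre-type density near the saddle point, rescaled. -/
def scaledDensity (ρ s : ℝ) (q c y : ι → ℝ) : ℂ :=
  pairWeight ρ q c (fun i => scaledBent s (c i) (y i)) * ∏ i, scaledBody s (q i) (c i) (y i)

theorem oneBody_bent_eq {s q c : ℝ} (hs : 0 < s) (hc : 0 < s + Real.sqrt s * c) (y : ℝ) :
    oneBody s 0 0 q (bent (1 / s) (s + Real.sqrt s * c) (Real.sqrt s * y)) *
        bentDeriv (1 / s) (Real.sqrt s * y) =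
      ((s ^ (-(s * q)) * Real.exp (s * q) : ℝ) : ℂ) * scaledBody s q c y := by
  have hr' : (Real.sqrt s : ℂ) ≠ 0 := by exact_mod_cast (Real.sqrt_pos.mpr hs).ne'
  have hs' : (s : ℂ) ≠ 0 := by exact_mod_cast hs.ne'
  have h2 : (s : ℂ) = (Real.sqrt s : ℂ) ^ 2 := by exact_mod_cast (Real.sq_sqrt hs.le).symm
  have h0 := Complex.slitPlane_ne_zero (bent_mem_slitPlane (δ := 1 / s) hc (Real.sqrt s * y))
  set u := scaledBent s c y / (Real.sqrt s : ℂ) with hu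
  have e : bent (1 / s) (s + Real.sqrt s * c) (Real.sqrt s * y) = (s : ℂ) * (1 + u) := by
    rw [bent_eq_scaledBent hs, hu, h2]
    field_simp
  rw [e] at h0 ⊢
  have hu0 : 1 + u ≠ 0 := right_ne_zero_of_mul h0
  unfold oneBody scaledBody
  rw [← hu, zero_mul, Complex.ofReal_zero, Complex.cpow_zero, mul_one, ofReal_mul_cpow hs hu0,
    Complex.cpow_def_of_ne_zero hu0]
  have key : Complex.exp (Complex.log (1 + u) * ((-(s * q) : ℝ) : ℂ)) *
      Complex.exp (q * (s * (1 + u))) =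
      Complex.exp (s * q) * Complex.exp (q * s * (u - Complex.log (1 + u))) := by
    rw [← Complex.exp_add, ← Complex.exp_add]
    congr 1
    push_cast
    ring
  push_cast at key ⊢
  linear_combination ((s ^ (-(s * q)) : ℝ) : ℂ) * bentDeriv (1 / s) (Real.sqrt s * y) * key

theorem laguerreDensity_scaled {ρ s : ℝ} {q c : ι → ℝ} (hs : 0 < s)
    (hc : ∀ i, 0 < s + Real.sqrt s * c i) (y : ι → ℝ) :
    laguerreDensity ρ (1 / s) s 0 0 q (fun i => s + Real.sqrt s * c i) (Real.sqrt s • y) =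
      ((Real.sqrt s ^ pairExponent ρ q c * ∏ i, (s ^ (-(s * q i)) * Real.exp (s * q i)) : ℝ) : ℂ) *
        scaledDensity ρ s q c y := by
  have hr := Real.sqrt_pos.mpr hs
  unfold laguerreDensity scaledDensity bentPoint
  simp only [Pi.smul_apply, smul_eq_mul, oneBody_bent_eq hs (hc _), Finset.prod_mul_distrib]
  simp only [bent_eq_scaledBent hs]
  rw [pairWeight_affine ρ hr s (fun i j => by
      rw [add_lt_add_iff_left, mul_lt_mul_iff_right₀ hr])
    fun i j hij => Complex.slitPlane_ne_zero (scaledBent_sub_mem_slitPlane s hs hij _ _).1]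
  push_cast
  rw [Finset.prod_mul_distrib]
  ring

theorem laguerreIntegral_scaled {ρ s : ℝ} {q c : ι → ℝ} (hs : 0 < s)
    (hc : ∀ i, 0 < s + Real.sqrt s * c i) :
    laguerreIntegral ρ (1 / s) s q (fun i => s + Real.sqrt s * c i) =
      ((Real.sqrt s ^ Fintype.card ι * (Real.sqrt s ^ pairExponent ρ q c *
        ∏ i, (s ^ (-(s * q i)) * Real.exp (s * q i))) : ℝ) : ℂ) * ∫ y, scaledDensity ρ s q c y := by
  have hr := Real.sqrt_pos.mpr hs
  have h := Measure.integral_comp_smul (volume : Measure (ι → ℝ))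
    (laguerreDensity ρ (1 / s) s 0 0 q (fun i => s + Real.sqrt s * c i)) (Real.sqrt s)
  simp only [laguerreDensity_scaled hs hc] at h
  rw [integral_const_mul, Module.finrank_fintype_fun_eq_card,
    abs_of_pos (by positivity), Complex.real_smul] at h
  unfold laguerreIntegral
  rw [Complex.ofReal_mul, mul_assoc, h, ← mul_assoc, ← Complex.ofReal_mul, mul_inv_cancel₀ (by positivity)]
  simp

/-- The Gaussian density obtained from the Laguerre-type density near its saddle point. -/
def gaussDensity (ρ : ℝ) (q c y : ι → ℝ) : ℂ :=
  pairWeight ρ q c (fun i => (c i : ℂ) + y i * Complex.I) *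
    ∏ i, Complex.exp (q i * ((c i : ℂ) + y i * Complex.I) ^ 2 / 2)

theorem measurable_scaledDensity (ρ s : ℝ) (q c : ι → ℝ) : Measurable (scaledDensity ρ s q c) := by
  have hb : ∀ i, Measurable fun y : ι → ℝ => scaledBent s (c i) (y i) := fun i => by
    unfold scaledBent
    fun_prop
  unfold scaledDensity pairWeight scaledBody
  refine Measurable.mul (Finset.measurable_fun_prod _ fun i _ => Finset.measurable_fun_prod _ fun j _ => ?_)
    (Finset.measurable_fun_prod _ fun i _ => ?_)
  · split_ifs
    · exact ((hb j).sub (hb i)).pow_const _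
    · exact measurable_const
  · have := hb i
    have h2 : Measurable fun y : ι → ℝ => bentDeriv (1 / s) (Real.sqrt s * y i) := by fun_prop
    refine Measurable.mul ?_ h2
    fun_prop

theorem integrable_inv_one_add_mul_sq {a : ℝ} (ha : 0 < a) :
    Integrable fun y : ℝ => (1 + a * y ^ 2)⁻¹ := by
  have := integrable_inv_one_add_sq.comp_mul_left' (R := Real.sqrt a) (Real.sqrt_pos.mpr ha).ne'
  simpa only [mul_pow, Real.sq_sqrt ha.le] using this

/-- Dominated convergence with the majorant of `norm_scaledBody_le`; the power of i is the limit of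
the contour Jacobians. -/
theorem tendsto_integral_scaledDensity {ρ : ℝ} (hρ : ρ < 0) {q : ι → ℝ} (hq : ∀ i, 0 < q i)
    (c : ι → ℝ) :
    Tendsto (fun s => ∫ y, scaledDensity ρ s q c y) atTop
      (𝓝 (Complex.I ^ Fintype.card ι * ∫ y, gaussDensity ρ q c y)) := by
  rw [← integral_const_mul]
  refine tendsto_integral_filter_of_dominated_convergence
    (fun y => (∏ i, ∏ j, if c i < c j then ((c j - c i) / 2) ^ (2 * ρ * q i * q j) else 1) *
      ∏ i, 2 * Real.exp (4 * c i ^ 2 * q i) * (1 + q i / 8 * y i ^ 2)⁻¹)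
    (Eventually.of_forall fun s => (measurable_scaledDensity ρ s q c).aestronglyMeasurable) ?_ ?_ ?_
  · have h1 : ∀ᶠ s : ℝ in atTop, ∀ i, 16 * c i ^ 2 ≤ s := eventually_all.mpr fun i =>
      eventually_ge_atTop _
    have h2 : ∀ᶠ s : ℝ in atTop, ∀ i, 2 ≤ q i * s := eventually_all.mpr fun i =>
      (tendsto_id.const_mul_atTop (hq i)).eventually_ge_atTop 2
    filter_upwards [h1, h2, eventually_ge_atTop 8] with s h1 h2 h3
    refine Eventually.of_forall fun y => ?_
    unfold scaledDensity
    rw [norm_mul, norm_prod]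
    refine mul_le_mul (norm_pairWeight_le hρ hq (fun i j hij => by linarith) fun i j hij =>
      (scaledBent_sub_mem_slitPlane s (by linarith) hij _ _).2 (by linarith)) ?_
      (Finset.prod_nonneg fun i _ => norm_nonneg _)
      (Finset.prod_nonneg fun i _ => Finset.prod_nonneg fun j _ => ?_)
    · exact Finset.prod_le_prod (fun i _ => norm_nonneg _) fun i _ =>
        norm_scaledBody_le (hq i) h3 (h1 i) (h2 i) (y i)
    · split_ifs with hij
      · exact Real.rpow_nonneg (by linarith) _
      · exact zero_le_one
  · refine Integrable.const_mul ?_ _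
    exact Integrable.fintype_prod (f := fun i (y : ℝ) =>
      2 * Real.exp (4 * c i ^ 2 * q i) * (1 + q i / 8 * y ^ 2)⁻¹) fun i =>
        (integrable_inv_one_add_mul_sq (by have := hq i; positivity)).const_mul _
  · refine Eventually.of_forall fun y => ?_
    unfold scaledDensity gaussDensity
    have e : Complex.I ^ Fintype.card ι * (pairWeight ρ q c (fun i => (c i : ℂ) + y i * Complex.I) *
        ∏ i, Complex.exp (q i * ((c i : ℂ) + y i * Complex.I) ^ 2 / 2)) =
        pairWeight ρ q c (fun i => (c i : ℂ) + y i * Complex.I) *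
        ∏ i, (Complex.exp (q i * ((c i : ℂ) + y i * Complex.I) ^ 2 / 2) * Complex.I) := by
      rw [Finset.prod_mul_distrib, Finset.prod_const, Finset.card_univ]
      ring
    rw [e]
    refine Tendsto.mul ?_ (tendsto_finsetProd _ fun i _ => tendsto_scaledBody _ _ _)
    unfold pairWeight
    refine tendsto_finsetProd _ fun i _ => tendsto_finsetProd _ fun j _ => ?_
    split_ifs with hij
    · have hs : ((c j : ℂ) + y j * Complex.I) - ((c i : ℂ) + y i * Complex.I) ∈
          Complex.slitPlane := by
        left
        simpa using hij
      exact (continuousAt_cpow_const hs).tendsto.comp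
        ((tendsto_scaledBent (c j) (y j)).sub (tendsto_scaledBent (c i) (y i)))
    · exact tendsto_const_nhds

end

/-! ### Asymptotics of Gamma ratios. -/

theorem tendsto_one_add_div_rpow (a b : ℝ) :
    Tendsto (fun x : ℝ => (1 + a / x) ^ b) atTop (𝓝 1) := by
  have h : Tendsto (fun x : ℝ => 1 + a / x) atTop (𝓝 (1 + 0)) :=
    tendsto_const_nhds.add (tendsto_const_nhds.div_atTop tendsto_id)
  rw [add_zero] at h
  simpa using h.rpow_const (p := b) (Or.inl one_ne_zero)

/-- `Γ(x+a) ~ x^a Γ(x)` for `a ∈ (0,1)`, from the log-convexity of `Γ`. -/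
theorem tendsto_Gamma_add_div_of_lt_one {a : ℝ} (h0 : 0 < a) (h1 : a < 1) :
    Tendsto (fun x => Real.Gamma (x + a) / (Real.Gamma x * x ^ a)) atTop (𝓝 1) := by
  refine tendsto_of_tendsto_of_tendsto_of_le_of_le' (tendsto_one_add_div_rpow a (a - 1))
    tendsto_const_nhds ?_ ?_
  · filter_upwards [eventually_gt_atTop 0] with x hx
    have hG := Real.Gamma_pos_of_pos hx
    have hGa := Real.Gamma_pos_of_pos (show 0 < x + a by positivity)
    -- Interpolating x + 1 between x + a and x + a + 1 bounds Γ(x + a) from below; the second bullet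
    -- interpolates x + a between x and x + 1 for the upper bound.
    have h := Real.Gamma_mul_add_mul_le_rpow_Gamma_mul_rpow_Gamma (s := x + a) (t := x + a + 1)
      (a := a) (b := 1 - a) (by positivity) (by positivity) h0 (by linarith) (by ring)
    rw [show a * (x + a) + (1 - a) * (x + a + 1) = x + 1 by ring, Real.Gamma_add_one hx.ne',
      Real.Gamma_add_one (by positivity), Real.mul_rpow (by positivity) hGa.le, mul_left_comm,
      ← Real.rpow_add hGa, add_sub_cancel, Real.rpow_one] at h
    rw [le_div_iff₀ (by positivity)]
    have hx' : 1 + a / x = (x + a) / x := by field_simp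
    rw [hx', Real.div_rpow (by positivity) hx.le]
    have e1 : (x + a) ^ (a - 1) = ((x + a) ^ (1 - a))⁻¹ := by
      rw [← Real.rpow_neg (by positivity), neg_sub]
    have e2 : x ^ (a - 1) = x ^ a / x := by rw [Real.rpow_sub hx, Real.rpow_one]
    have p1 : 0 < (x + a) ^ (1 - a) := by positivity
    have p2 : 0 < x ^ a := by positivity
    rw [e1, e2]
    calc _ = (x * Real.Gamma x) / (x + a) ^ (1 - a) := by field_simp
      _ ≤ _ := by rw [div_le_iff₀ p1]; linarith
  · filter_upwards [eventually_gt_atTop 0] with x hx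
    have hG := Real.Gamma_pos_of_pos hx
    have h := Real.Gamma_mul_add_mul_le_rpow_Gamma_mul_rpow_Gamma (s := x) (t := x + 1)
      (a := 1 - a) (b := a) hx (by positivity) (by linarith) h0 (by ring)
    rw [show (1 - a) * x + a * (x + 1) = x + a by ring, Real.Gamma_add_one hx.ne',
      Real.mul_rpow hx.le hG.le, mul_left_comm, ← Real.rpow_add hG, sub_add_cancel,
      Real.rpow_one] at h
    rw [div_le_one (by positivity)]
    linarith

theorem tendsto_Gamma_add_div {a : ℝ} (h0 : 0 ≤ a) :
    Tendsto (fun x => Real.Gamma (x + a) / (Real.Gamma x * x ^ a)) atTop (𝓝 1) := by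
  have h : ∀ k : ℕ, ∀ b : ℝ, 0 ≤ b → b < 1 →
      Tendsto (fun x => Real.Gamma (x + (b + k)) / (Real.Gamma x * x ^ (b + k))) atTop (𝓝 1) := by
    intro k b hb hb1
    induction k with
    | zero =>
      rcases hb.eq_or_lt with rfl | hb
      · refine tendsto_const_nhds.congr' ?_
        filter_upwards [eventually_gt_atTop 0] with x hx
        have := (Real.Gamma_pos_of_pos hx).ne'
        simp [this]
      · simpa using tendsto_Gamma_add_div_of_lt_one hb hb1
    | succ k ih =>
      have := ih.mul (tendsto_one_add_div_rpow (b + k) 1)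
      rw [one_mul] at this
      refine this.congr' ?_
      filter_upwards [eventually_gt_atTop 0] with x hx
      have hG := Real.Gamma_pos_of_pos hx
      rw [Real.rpow_one, Nat.cast_succ, ← add_assoc b, ← add_assoc x (b + k) 1,
        Real.Gamma_add_one (by positivity), Real.rpow_add_one hx.ne']
      have : x ^ (b + k) ≠ 0 := by positivity
      field_simp
  have := h ⌊a⌋₊ (a - ⌊a⌋₊) (by linarith [Nat.floor_le h0]) (by linarith [Nat.lt_floor_add_one a])
  simpa using this

theorem tendsto_Gamma_div_mul_rpow {a : ℝ} (h0 : 0 ≤ a) :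
    Tendsto (fun x => Real.Gamma x / Real.Gamma (x + a) * x ^ a) atTop (𝓝 1) := by
  have h := (tendsto_Gamma_add_div h0).inv₀ one_ne_zero
  rw [inv_one] at h
  refine h.congr fun x => ?_
  rw [inv_div]
  ring

/-- Dividing by the one-particle shapes cancels r^{nrs} and leaves the ratios Γ(sr)/Γ((s + i)r) and
Γ(s)/Γ(s + n - lρ). Thus Γ(x + a) ~ x^a Γ(x) replaces Stirling's formula. -/
theorem tendsto_laguerreShape_ratio {ρ : ℝ} (hρ : ρ < 0) (n m : ℕ) :
    Tendsto (fun s => laguerreShape ρ n m s /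
        (laguerreShape ρ 1 0 s ^ n * laguerreShape ρ 0 1 s ^ m) *
        s ^ (n * (n - 1) / 2 * (-1 / ρ) + n * m - m * (m - 1) / 2 * ρ)) atTop
      (𝓝 ((-1 / ρ) ^ (-(n * (n - 1) / 2 * (-1 / ρ))))) := by
  obtain ⟨r, hr, hrρ⟩ : ∃ r : ℝ, 0 < r ∧ -1 / ρ = r := ⟨_, div_pos_of_neg_of_neg (by norm_num) hρ, rfl⟩
  have hgauss : ∀ k : ℕ, ∑ i ∈ Finset.range k, (i : ℝ) = k * (k - 1) / 2 := by
    intro k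
    induction k with
    | zero => simp
    | succ k ih => rw [Finset.sum_range_succ, ih]; push_cast; ring
  have h1 : ∀ i : ℕ, Tendsto (fun s : ℝ => Real.Gamma (s * r) / Real.Gamma ((s + i) * r) *
      s ^ (i * r)) atTop (𝓝 (r ^ (-(i * r)))) := by
    intro i
    have h := ((tendsto_Gamma_div_mul_rpow (a := i * r) (by positivity)).comp
      (tendsto_id.atTop_mul_const hr)).mul_const (r ^ (-(i * r)))
    rw [one_mul] at h
    refine h.congr' ?_
    filter_upwards [eventually_gt_atTop 0] with s hs
    simp only [Function.comp_def, id]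
    rw [Real.mul_rpow hs.le hr.le, Real.rpow_neg hr.le, ← add_mul]
    have : r ^ (i * r) ≠ 0 := by positivity
    field_simp
  have h2 : ∀ l : ℕ, Tendsto (fun s : ℝ => Real.Gamma s / Real.Gamma (s + n - l * ρ) *
      s ^ (n - l * ρ)) atTop (𝓝 1) := by
    intro l
    have h3 : (l : ℝ) * ρ ≤ 0 := mul_nonpos_of_nonneg_of_nonpos l.cast_nonneg hρ.le
    have h4 : (0 : ℝ) ≤ n := n.cast_nonneg
    simpa only [← add_sub_assoc] using tendsto_Gamma_div_mul_rpow (a := n - l * ρ) (by linarith)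
  have h3 := (tendsto_finsetProd (Finset.range n) fun i _ => h1 i).mul
    (tendsto_finsetProd (Finset.range m) fun l _ => h2 l)
  rw [hrρ]
  have e1 : (∏ i ∈ Finset.range n, r ^ (-(i * r))) * ∏ l ∈ Finset.range m, (1 : ℝ) =
      r ^ (-(n * (n - 1) / 2 * r)) := by
    rw [← Real.rpow_sum_of_pos hr, Finset.prod_const_one, mul_one, Finset.sum_neg_distrib,
      ← Finset.sum_mul, hgauss]
  rw [e1] at h3
  refine h3.congr' ?_
  filter_upwards [eventually_gt_atTop 0] with s hs
  unfold laguerreShape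
  rw [hrρ]
  have e2 : n * (n - 1) / 2 * r + n * m - m * (m - 1) / 2 * ρ =
      ∑ i ∈ Finset.range n, i * r + ∑ l ∈ Finset.range m, (n - l * ρ) := by
    rw [← Finset.sum_mul, hgauss, Finset.sum_sub_distrib, ← Finset.sum_mul, hgauss]
    simp
    ring
  have e3 : r ^ (n * r * s) = (r ^ (r * s)) ^ n := by
    rw [← Real.rpow_natCast, ← Real.rpow_mul hr.le]
    ring_nf
  rw [e2, Real.rpow_add hs, Real.rpow_sum_of_pos hs, Real.rpow_sum_of_pos hs, e3]
  simp only [Finset.prod_mul_distrib, Finset.prod_div_distrib, Finset.prod_const, Finset.card_range,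
    Finset.prod_range_one, Finset.prod_range_zero, Nat.cast_zero, Nat.cast_one, zero_mul, one_mul,
    mul_one, add_zero, sub_zero, Real.rpow_zero]
  have p1 : 0 < Real.Gamma s := Real.Gamma_pos_of_pos hs
  have p2 : 0 < Real.Gamma (s * r) := Real.Gamma_pos_of_pos (by positivity)
  have p3 : 0 < r ^ (r * s) := by positivity
  rw [div_pow, div_pow, one_pow]
  generalize ∏ l ∈ Finset.range m, Real.Gamma (s + n - l * ρ) = X
  generalize ∏ l ∈ Finset.range m, s ^ (n - l * ρ) = Y
  field_simp

/-! ### Evaluation of the two-species Gaussian integral. -/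

theorem sum_pairs_of_symm {ι : Type*} [Fintype ι] {c : ι → ℝ} (hc : Function.Injective c)
    {A : ι → ι → ℝ} (hA : ∀ i j, A i j = A j i) :
    2 * (∑ i, ∑ j, if c i < c j then A i j else 0) = (∑ i, ∑ j, A i j) - ∑ i, A i i := by
  classical
  have h1 : (∑ i, ∑ j, if c i < c j then A i j else 0) = ∑ i, ∑ j, if c j < c i then A i j else 0 := by
    rw [Finset.sum_comm]
    simp only [fun i j => hA j i]
  have h2 : ∑ i, A i i = ∑ i, ∑ j, if i = j then A i j else 0 := by simp
  rw [two_mul]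
  nth_rw 2 [h1]
  rw [h2, ← Finset.sum_add_distrib, ← Finset.sum_sub_distrib]
  refine Finset.sum_congr rfl fun i _ => ?_
  rw [← Finset.sum_add_distrib, ← Finset.sum_sub_distrib]
  refine Finset.sum_congr rfl fun j _ => ?_
  rcases lt_trichotomy (c i) (c j) with h | h | h
  · rw [if_pos h, if_neg h.not_gt, if_neg (fun e => by subst e; exact lt_irrefl _ h)]; ring
  · rw [if_neg h.not_lt, if_neg h.not_gt, if_pos (hc h)]; ring
  · rw [if_neg h.not_gt, if_pos h, if_neg (fun e => by subst e; exact lt_irrefl _ h)]; ring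

theorem prod_species {N : ℕ} {M : Type*} [CommMonoid M] (σ : Fin N → Bool) (f : Bool → M) :
    ∏ i, f (σ i) = f false ^ species σ false * f true ^ species σ true := by
  unfold species
  rw [← Finset.prod_pow_eq_pow_sum, ← Finset.prod_pow_eq_pow_sum, ← Finset.prod_mul_distrib]
  refine Finset.prod_congr rfl fun i _ => ?_
  cases σ i <;> simp

theorem sum_species {N : ℕ} (σ : Fin N → Bool) (f : Bool → ℝ) :
    ∑ i, f (σ i) = species σ false * f false + species σ true * f true := by
  unfold species
  push_cast
  rw [Finset.sum_mul, Finset.sum_mul, ← Finset.sum_add_distrib]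
  refine Finset.sum_congr rfl fun i _ => ?_
  cases σ i <;> simp

/-- The exponent is ρ((∑q)² - ∑q²), hence depends on the numbers of particles of each species but
not on their order. -/
theorem pairExponent_charge {ρ : ℝ} (hρ : ρ < 0) {N : ℕ} (σ : Fin N → Bool) {c : Fin N → ℝ}
    (hc : Function.Injective c) :
    pairExponent ρ (fun i => charge ρ (σ i)) c =
      -2 * (species σ false * (species σ false - 1) / 2 * (-1 / ρ) + species σ false * species σ true -
        species σ true * (species σ true - 1) / 2 * ρ) := by
  have h := sum_pairs_of_symm hc (A := fun i j => 2 * ρ * charge ρ (σ i) * charge ρ (σ j))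
    fun i j => by ring
  change 2 * pairExponent ρ (fun i => charge ρ (σ i)) c = _ at h
  generalize pairExponent ρ (fun i => charge ρ (σ i)) c = S at h ⊢
  simp only [mul_assoc, ← Finset.mul_sum, ← Finset.sum_mul] at h
  rw [sum_species σ (charge ρ), sum_species σ fun b => charge ρ b * charge ρ b] at h
  simp only [charge, Bool.false_eq_true, if_false, if_true] at h ⊢
  have hρ' := hρ.ne
  field_simp at h ⊢
  linear_combination h

/-- The Gaussian integral that the one-particle Laguerre-type integral tends to. -/
theorem integral_gaussDensity_fin_one {q : ℝ} (ρ : ℝ) :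
    ∫ y, gaussDensity ρ (fun _ : Fin 1 => q) (fun _ => 0) y =
      ((Real.sqrt (2 * Real.pi / q) : ℝ) : ℂ) := by
  have e : ∀ y : Fin 1 → ℝ, gaussDensity ρ (fun _ : Fin 1 => q) (fun _ => 0) y =
      ∏ i, ((Real.exp (-(q / 2) * y i ^ 2) : ℝ) : ℂ) := by
    intro y
    simp only [gaussDensity, pairWeight, lt_irrefl, if_false, Finset.prod_const_one, one_mul]
    refine Finset.prod_congr rfl fun i _ => ?_
    rw [Complex.ofReal_exp]
    congr 1
    push_cast
    rw [zero_add, mul_pow, Complex.I_sq]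
    ring
  simp only [e]
  rw [integral_fintype_prod_volume_eq_pow (ι := Fin 1)
    (fun y : ℝ => ((Real.exp (-(q / 2) * y ^ 2) : ℝ) : ℂ)), Fintype.card_fin, pow_one,
    integral_complex_ofReal, integral_gaussian]
  congr 2
  field_simp

theorem pairExponent_fin_one (ρ q c : ℝ) :
    pairExponent ρ (fun _ : Fin 1 => q) (fun _ => c) = 0 := by
  simp [pairExponent]

theorem laguerreConst_one_zero {ρ : ℝ} (hρ : ρ < 0) : laguerreConst ρ 1 0 = (-1 / ρ)⁻¹ := by
  have hr : 0 < -1 / ρ := div_pos_of_neg_of_neg (by norm_num) hρ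
  have h : Real.Gamma (1 + -1 / ρ) ≠ 0 := (Real.Gamma_pos_of_pos (by positivity)).ne'
  simp [laguerreConst, Real.rpow_neg_one, div_self h]

theorem laguerreConst_zero_one {ρ : ℝ} (hρ : ρ < 0) : laguerreConst ρ 0 1 = 1 := by
  have h : Real.Gamma (1 - ρ) ≠ 0 := (Real.Gamma_pos_of_pos (by linarith)).ne'
  simp [laguerreConst, div_self h]

theorem laguerreShape_pos {ρ s : ℝ} (hρ : ρ < 0) (hs : 0 < s) (n m : ℕ) :
    0 < laguerreShape ρ n m s := by
  have hr : 0 < -1 / ρ := div_pos_of_neg_of_neg (by norm_num) hρ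
  refine div_pos (Real.rpow_pos_of_pos hr _) (mul_pos (prod_Gamma_pos fun i => by positivity)
    (prod_Gamma_pos fun l => ?_))
  have : (l : ℝ) * ρ ≤ 0 := mul_nonpos_of_nonneg_of_nonpos l.cast_nonneg hρ.le
  have : (0 : ℝ) ≤ n := n.cast_nonneg
  linarith

/-- The product of Gamma quotients in the evaluation of the deformed Macdonald-Mehta integral. -/
def mehtaGamma (ρ : ℝ) (n m : ℕ) : ℝ :=
  (∏ i ∈ Finset.range n, Real.Gamma (1 + -1 / ρ) / Real.Gamma (1 + (i + 1) * (-1 / ρ))) *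
    ∏ j ∈ Finset.range m, Real.Gamma (1 - ρ) / Real.Gamma (n + 1 - (j + 1) * ρ)

/-- The one-particle constant and shape of each species. -/
def oneParticle (ρ s : ℝ) (b : Bool) : ℝ :=
  if b then laguerreShape ρ 0 1 s else (-1 / ρ)⁻¹ * laguerreShape ρ 1 0 s

theorem laguerreIntegral_fin_one {ρ δ c : ℝ} (hρ : ρ < 0) (hδ : 0 < δ) (hc : 0 < c) (b : Bool)
    (a : ℕ) :
    laguerreIntegral ρ δ (a + 1 - ρ) (fun _ : Fin 1 => charge ρ b) (fun _ => c) =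
      2 * Real.pi * Complex.I * oneParticle ρ (a + 1 - ρ) b := by
  have h := laguerreIntegral_eq δ ρ hδ hρ 1 (fun _ => b) (fun _ => c) (fun _ => hc)
    (Function.injective_of_subsingleton _) a 0
  rw [Nat.cast_zero, zero_add, one_mul] at h
  rw [h]
  cases b
  · have h1 : species (fun _ : Fin 1 => false) false = 1 := by simp [species]
    have h2 : species (fun _ : Fin 1 => false) true = 0 := by simp [species]
    rw [h1, h2, laguerreConst_one_zero hρ]
    simp [oneParticle, mul_assoc]
  · have h1 : species (fun _ : Fin 1 => true) false = 0 := by simp [species]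
    have h2 : species (fun _ : Fin 1 => true) true = 1 := by simp [species]
    rw [h1, h2, laguerreConst_zero_one hρ]
    simp [oneParticle]

/-- Evaluation of the Gaussian integral for an arbitrary ordering of the two species. -/
theorem integral_gaussDensity {ρ : ℝ} (hρ : ρ < 0) {N : ℕ} (σ : Fin N → Bool) {c : Fin N → ℝ}
    (hc : Function.Injective c) :
    ∫ y, gaussDensity ρ (fun i => charge ρ (σ i)) c y =
      (((-1 / ρ) ^ ((species σ false : ℝ) * (species σ false - 1) / 2 * (-1 / ρ)) *
        mehtaGamma ρ (species σ false) (species σ true) *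
        ∏ i, Real.sqrt (2 * Real.pi / charge ρ (σ i)) : ℝ) : ℂ) := by
  have hr : 0 < -1 / ρ := div_pos_of_neg_of_neg (by norm_num) hρ
  set n := species σ false with hn
  set m := species σ true with hm
  set q : Fin N → ℝ := fun i => charge ρ (σ i) with hq
  have hq0 : ∀ i, 0 < q i := fun i => charge_pos hρ _
  set P := pairExponent ρ q c with hP
  have hPe := pairExponent_charge hρ σ hc
  rw [← hq, ← hP, ← hn, ← hm] at hPe
  set Z := ∏ i, Real.sqrt (2 * Real.pi / charge ρ (σ i)) with hZ
  -- The lattice points with b = 0: an unbounded sequence along which the integral is known exactly.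
  let u : ℕ → ℝ := fun k => k + 1 - ρ
  have hu : Tendsto u atTop atTop :=
    tendsto_atTop_add_const_right _ _ (tendsto_atTop_add_const_right _ _ tendsto_natCast_atTop_atTop)
  have hu0 : ∀ k, 0 < u k := fun k => by
    have : (0 : ℝ) ≤ k := k.cast_nonneg
    simp only [u]; linarith
  set E : ℝ → ℂ := fun s => ∫ y, scaledDensity ρ s q c y with hE
  set E₁ : ℝ → Fin N → ℂ := fun s i => ∫ y, scaledDensity ρ s (fun _ : Fin 1 => q i) (fun _ => 0) y
    with hE₁
  have hElim : Tendsto E atTop (𝓝 (Complex.I ^ N * ∫ y, gaussDensity ρ q c y)) := by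
    simpa using tendsto_integral_scaledDensity hρ hq0 c
  have hE₁lim : Tendsto (fun s => ∏ i, E₁ s i) atTop (𝓝 (Complex.I ^ N * Z)) := by
    have h : ∀ i, Tendsto (fun s => E₁ s i) atTop
        (𝓝 (Complex.I * ((Real.sqrt (2 * Real.pi / q i) : ℝ) : ℂ))) := fun i => by
      have := tendsto_integral_scaledDensity hρ (q := fun _ : Fin 1 => q i) (fun _ => hq0 i)
        (fun _ => 0)
      rw [integral_gaussDensity_fin_one, Fintype.card_fin, pow_one] at this
      exact this
    have := tendsto_finsetProd Finset.univ fun i _ => h i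
    rw [Finset.prod_mul_distrib, Finset.prod_const, Finset.card_univ, Fintype.card_fin] at this
    rw [hZ]
    push_cast at this ⊢
    exact this
  -- At lattice points R is the exact quotient of the scaled N-particle integral by the product of
  -- the scaled one-particle integrals; the powers of 2πi, of s^{-sq} e^{sq} and of the Jacobian √s
  -- cancel.
  set R : ℝ → ℝ := fun s => laguerreConst ρ n m * laguerreShape ρ n m s /
    (Real.sqrt s ^ P * ∏ i, oneParticle ρ s (σ i)) with hR
  have hRlim : Tendsto R atTop (𝓝 ((-1 / ρ) ^ ((n : ℝ) * (n - 1) / 2 * (-1 / ρ)) *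
      mehtaGamma ρ n m)) := by
    have h := (tendsto_laguerreShape_ratio hρ n m).const_mul
      ((-1 / ρ) ^ ((n : ℝ) * (n - 1) * (-1 / ρ)) * mehtaGamma ρ n m)
    have e : (-1 / ρ) ^ ((n : ℝ) * (n - 1) * (-1 / ρ)) * mehtaGamma ρ n m *
        (-1 / ρ) ^ (-((n : ℝ) * (n - 1) / 2 * (-1 / ρ))) =
        (-1 / ρ) ^ ((n : ℝ) * (n - 1) / 2 * (-1 / ρ)) * mehtaGamma ρ n m := by
      rw [mul_right_comm, ← Real.rpow_add hr]
      congr 2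
      ring
    rw [e] at h
    refine h.congr' ?_
    filter_upwards [eventually_gt_atTop 0] with s hs
    simp only [hR]
    have e1 : Real.sqrt s ^ P = (s ^ ((n : ℝ) * (n - 1) / 2 * (-1 / ρ) + n * m -
        m * (m - 1) / 2 * ρ))⁻¹ := by
      rw [hPe, Real.sqrt_eq_rpow, ← Real.rpow_mul hs.le, ← Real.rpow_neg hs.le]
      congr 1
      ring
    have e2 : laguerreConst ρ n m = (-1 / ρ) ^ ((n : ℝ) * (n - 1) * (-1 / ρ)) *
        ((-1 / ρ) ^ n)⁻¹ * mehtaGamma ρ n m := by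
      unfold laguerreConst mehtaGamma
      rw [Real.rpow_sub hr, Real.rpow_natCast, div_eq_mul_inv]
    rw [prod_species σ (oneParticle ρ s), e1, e2]
    simp only [oneParticle, Bool.false_eq_true, if_false, if_true]
    rw [mul_pow, ← hn, ← hm, inv_pow]
    have p1 := laguerreShape_pos hρ hs 1 0
    have p2 := laguerreShape_pos hρ hs 0 1
    have p3 := pow_pos hr n
    generalize (-1 / ρ) ^ n = A at *
    generalize (-1 / ρ) ^ ((n : ℝ) * (n - 1) * (-1 / ρ)) = B at *
    generalize laguerreShape ρ n m s = C at *
    generalize s ^ ((n : ℝ) * (n - 1) / 2 * (-1 / ρ) + n * m - m * (m - 1) / 2 * ρ) = D at *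
    field_simp
  -- For s > c_i² the shifted contours lie to the right of the origin, as `laguerreIntegral_eq`
  -- requires.
  have hpos : ∀ᶠ s : ℝ in atTop, ∀ i, 0 < s + Real.sqrt s * c i := by
    refine eventually_all.mpr fun i => ?_
    filter_upwards [eventually_gt_atTop (c i ^ 2), eventually_gt_atTop 0] with s hs hs0
    have h1 := Real.sqrt_pos.mpr hs0
    have h2 : |c i| < Real.sqrt s := (Real.lt_sqrt (abs_nonneg _)).mpr (by rwa [sq_abs])
    have h3 := (abs_lt.mp h2).1
    nlinarith [Real.mul_self_sqrt hs0.le]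
  have hEq : ∀ᶠ k in atTop, E (u k) = R (u k) * ∏ i, E₁ (u k) i := by
    filter_upwards [hu.eventually hpos] with k hk
    have hs := hu0 k
    have hsq := Real.sqrt_pos.mpr hs
    have h1 := laguerreIntegral_eq (1 / u k) ρ (by positivity) hρ N σ _ hk
      (fun i j hij => hc (by
        have := add_left_cancel hij
        exact mul_left_cancel₀ hsq.ne' this)) k 0
    rw [Nat.cast_zero, zero_add, one_mul, ← hn, ← hm] at h1
    have h2 := laguerreIntegral_scaled (ρ := ρ) (q := q) hs hk
    change laguerreIntegral ρ (1 / u k) (u k) q _ = _ at h1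
    rw [h1, Fintype.card_fin, ← hP] at h2
    have h3 : ∀ i, 2 * Real.pi * Complex.I * oneParticle ρ (u k) (σ i) =
        ((Real.sqrt (u k) * (u k ^ (-(u k * q i)) * Real.exp (u k * q i)) : ℝ) : ℂ) *
          E₁ (u k) i := fun i => by
      have h4 := laguerreIntegral_scaled (ρ := ρ) (q := fun _ : Fin 1 => q i) (c := fun _ => 0) hs
        (fun _ => by rw [mul_zero, add_zero]; exact hs)
      have h5 := laguerreIntegral_fin_one (δ := 1 / u k) (c := u k + Real.sqrt (u k) * 0) hρ
        (by positivity) (by rw [mul_zero, add_zero]; exact hs) (σ i) k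
      change laguerreIntegral ρ (1 / u k) (u k) _ _ = _ at h5
      rw [h5, pairExponent_fin_one] at h4
      simp only [Fintype.card_fin, pow_one, Real.rpow_zero, one_mul, Finset.univ_unique,
        Finset.prod_singleton] at h4
      exact h4
    have h6 := Finset.prod_congr (rfl : (Finset.univ : Finset (Fin N)) = Finset.univ)
      fun i _ => h3 i
    simp only [Finset.prod_mul_distrib, Finset.prod_const, Finset.card_univ, Fintype.card_fin,
      Complex.ofReal_mul, Complex.ofReal_prod, Complex.ofReal_pow] at h2 h6
    simp only [hR, Complex.ofReal_div, Complex.ofReal_mul, Complex.ofReal_prod]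
    have q1 : (∏ i, (oneParticle ρ (u k) (σ i) : ℂ)) ≠ 0 := Finset.prod_ne_zero_iff.mpr fun i _ => by
      have : 0 < oneParticle ρ (u k) (σ i) := by
        unfold oneParticle
        split_ifs
        · exact laguerreShape_pos hρ hs _ _
        · exact mul_pos (inv_pos.mpr hr) (laguerreShape_pos hρ hs _ _)
      exact_mod_cast this.ne'
    have q2 : ((Real.sqrt (u k) ^ P : ℝ) : ℂ) ≠ 0 := by
      exact_mod_cast (Real.rpow_pos_of_pos hsq _).ne'
    have q3 : ((Real.sqrt (u k) : ℝ) : ℂ) ^ N ≠ 0 := pow_ne_zero _ (by exact_mod_cast hsq.ne')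
    have q4 : (∏ i, ((u k ^ (-(u k * q i)) : ℝ) : ℂ)) ≠ 0 := Finset.prod_ne_zero_iff.mpr fun i _ => by
      exact_mod_cast (Real.rpow_pos_of_pos hs _).ne'
    have q5 : (∏ i, ((Real.exp (u k * q i) : ℝ) : ℂ)) ≠ 0 := Finset.prod_ne_zero_iff.mpr fun i _ => by
      exact_mod_cast (Real.exp_pos _).ne'
    have q6 : ((2 : ℂ) * Real.pi) ^ N * Complex.I ^ N ≠ 0 := mul_ne_zero (pow_ne_zero _ (by
      exact_mod_cast Real.two_pi_pos.ne')) (pow_ne_zero _ Complex.I_ne_zero)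
    rw [div_mul_eq_mul_div, eq_div_iff (mul_ne_zero q2 q1)]
    change _ = _ * E (u k) at h2
    simp only [mul_pow] at h2 h6 q6
    generalize (∏ i, (oneParticle ρ (u k) (σ i) : ℂ)) = X1 at *
    generalize ((Real.sqrt (u k) ^ P : ℝ) : ℂ) = X2 at *
    generalize ((Real.sqrt (u k) : ℝ) : ℂ) ^ N = X3 at *
    generalize (∏ i, ((u k ^ (-(u k * q i)) : ℝ) : ℂ)) = X4 at *
    generalize (∏ i, ((Real.exp (u k * q i) : ℝ) : ℂ)) = X5 at *
    generalize (2 : ℂ) ^ N * (Real.pi : ℂ) ^ N * Complex.I ^ N = X6 at *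
    generalize (∏ i, E₁ (u k) i) = X7 at *
    generalize E (u k) = X8 at *
    have : X3 * X4 * X5 * X6 ≠ 0 := by
      refine mul_ne_zero (mul_ne_zero (mul_ne_zero ?_ ?_) ?_) ?_ <;> assumption
    refine mul_left_cancel₀ this ?_
    linear_combination X6 * X1 * (-h2) +
      (laguerreConst ρ n m * laguerreShape ρ n m (u k) : ℂ) * X6 * h6
  have hlim1 := hElim.comp hu
  have hlim2 := (((Complex.continuous_ofReal.tendsto _).comp hRlim).comp hu).mul (hE₁lim.comp hu)
  have hfin := tendsto_nhds_unique (hlim1.congr' (by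
    filter_upwards [hEq] with k hk
    exact hk)) hlim2
  have hI : Complex.I ^ N ≠ 0 := pow_ne_zero _ Complex.I_ne_zero
  refine mul_left_cancel₀ hI ?_
  rw [hfin]
  push_cast
  ring

/-! ### Reindexing, integrability and splitting of the Gaussian integral. -/

section
variable {ι κ : Type*} [Fintype ι] [Fintype κ]

theorem pairWeight_comp_equiv (ρ : ℝ) (e : ι ≃ κ) (q c : κ → ℝ) (z : κ → ℂ) :
    pairWeight ρ (q ∘ e) (c ∘ e) (z ∘ e) = pairWeight ρ q c z := by
  unfold pairWeight
  rw [← Equiv.prod_comp e]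
  refine Finset.prod_congr rfl fun i _ => ?_
  rw [← Equiv.prod_comp e]
  rfl

theorem gaussDensity_comp_equiv (ρ : ℝ) (e : ι ≃ κ) (q c y : κ → ℝ) :
    gaussDensity ρ (q ∘ e) (c ∘ e) (y ∘ e) = gaussDensity ρ q c y := by
  unfold gaussDensity
  rw [← pairWeight_comp_equiv ρ e, ← Equiv.prod_comp e]
  rfl

theorem integral_gaussDensity_comp_equiv (ρ : ℝ) (e : ι ≃ κ) (q c : κ → ℝ) :
    ∫ y, gaussDensity ρ (q ∘ e) (c ∘ e) y = ∫ y, gaussDensity ρ q c y := by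
  have h := (volume_measurePreserving_piCongrLeft (fun _ : κ => ℝ) e).integral_comp'
    (gaussDensity ρ q c)
  rw [← h]
  refine integral_congr_ae (Eventually.of_forall fun y => ?_)
  dsimp only
  rw [← gaussDensity_comp_equiv ρ e]
  congr 1
  ext i
  rw [Function.comp_apply, MeasurableEquiv.coe_piCongrLeft, Equiv.piCongrLeft_apply_apply]

theorem continuous_gaussDensity (ρ : ℝ) (q c : ι → ℝ) : Continuous (gaussDensity ρ q c) := by
  unfold gaussDensity
  refine (continuous_pairWeight_comp (fun i => by fun_prop) fun y i j hij => ?_).mul (by fun_prop)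
  left
  simpa using hij

theorem norm_gaussDensity_le {ρ : ℝ} (hρ : ρ < 0) {q : ι → ℝ} (hq : ∀ i, 0 < q i) (c y : ι → ℝ) :
    ‖gaussDensity ρ q c y‖ ≤
      (∏ i, ∏ j, if c i < c j then (c j - c i) ^ (2 * ρ * q i * q j) else 1) *
        ∏ i, Real.exp (q i * c i ^ 2 / 2) * Real.exp (-(q i / 2) * y i ^ 2) := by
  unfold gaussDensity
  rw [norm_mul]
  refine mul_le_mul (norm_pairWeight_le hρ hq (fun i j hij => by linarith) fun i j hij => ?_)
    (le_of_eq ?_) (norm_nonneg _)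
    (Finset.prod_nonneg fun i _ => Finset.prod_nonneg fun j _ => ?_)
  · refine le_trans (le_of_eq ?_) (Complex.re_le_norm _)
    simp
  · rw [norm_prod]
    refine Finset.prod_congr rfl fun i _ => ?_
    rw [Complex.norm_exp, ← Real.exp_add]
    congr 1
    have : (q i : ℂ) * ((c i : ℂ) + y i * Complex.I) ^ 2 / 2 =
        ((q i * (c i ^ 2 - y i ^ 2) / 2 : ℝ) : ℂ) + ((q i * c i * y i : ℝ) : ℂ) * Complex.I := by
      push_cast
      linear_combination (q i * y i ^ 2 / 2 : ℂ) * Complex.I_sq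
    rw [this, Complex.add_re, Complex.re_ofReal_mul, Complex.ofReal_re, Complex.I_re]
    ring
  · split_ifs with hij
    · exact Real.rpow_nonneg (by linarith) _
    · exact zero_le_one

theorem integrable_gaussDensity_sumElim {ρ : ℝ} (hρ : ρ < 0) {q : ι ⊕ κ → ℝ} (hq : ∀ i, 0 < q i)
    (c : ι ⊕ κ → ℝ) {k : ℝ} (hk : k ≠ 0) :
    Integrable fun p : (ι → ℝ) × (κ → ℝ) => gaussDensity ρ q c (Sum.elim (k • p.1) p.2) := by
  have hcont : Continuous fun p : (ι → ℝ) × (κ → ℝ) => (Sum.elim (k • p.1) p.2 : ι ⊕ κ → ℝ) := by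
    refine continuous_pi fun i => ?_
    cases i <;> simp only [Sum.elim_inl, Sum.elim_inr, Pi.smul_apply] <;> fun_prop
  have h1 : Integrable fun x : ι → ℝ => ∏ i, Real.exp (q (.inl i) * c (.inl i) ^ 2 / 2) *
      Real.exp (-(q (.inl i) / 2) * (k * x i) ^ 2) :=
    Integrable.fintype_prod (f := fun i (x : ℝ) => Real.exp (q (.inl i) * c (.inl i) ^ 2 / 2) *
      Real.exp (-(q (.inl i) / 2) * (k * x) ^ 2)) fun i =>
        ((integrable_exp_neg_mul_sq (by have := hq (.inl i); positivity)).comp_mul_left' hk).const_mul _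
  have h2 : Integrable fun y : κ → ℝ => ∏ i, Real.exp (q (.inr i) * c (.inr i) ^ 2 / 2) *
      Real.exp (-(q (.inr i) / 2) * y i ^ 2) :=
    Integrable.fintype_prod (f := fun i (y : ℝ) => Real.exp (q (.inr i) * c (.inr i) ^ 2 / 2) *
      Real.exp (-(q (.inr i) / 2) * y ^ 2)) fun i =>
        (integrable_exp_neg_mul_sq (by have := hq (.inr i); positivity)).const_mul _
  refine ((h1.mul_prod h2).const_mul
    (∏ i, ∏ j, if c i < c j then (c j - c i) ^ (2 * ρ * q i * q j) else 1)).mono'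
    ((continuous_gaussDensity ρ q c).comp hcont).aestronglyMeasurable
    (Eventually.of_forall fun p => ?_)
  have h := norm_gaussDensity_le hρ hq c (Sum.elim (k • p.1) p.2)
  exact h.trans_eq (congrArg _ (Fintype.prod_sum_type _))

theorem integral_gaussDensity_sumElim {ρ : ℝ} (hρ : ρ < 0) {q : ι ⊕ κ → ℝ} (hq : ∀ i, 0 < q i)
    (c : ι ⊕ κ → ℝ) {k : ℝ} (hk : 0 < k) :
    ∫ x : ι → ℝ, ∫ y : κ → ℝ, gaussDensity ρ q c (Sum.elim (k • x) y) =
      ((k ^ Fintype.card ι)⁻¹ : ℝ) * ∫ z, gaussDensity ρ q c z := by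
  rw [Measure.integral_comp_smul volume
    (fun x : ι → ℝ => ∫ y : κ → ℝ, gaussDensity ρ q c (Sum.elim x y)) k,
    Module.finrank_fintype_fun_eq_card, abs_of_pos (by positivity), Complex.real_smul]
  congr 1
  have h1 := integrable_gaussDensity_sumElim hρ hq c one_ne_zero
  simp only [one_smul] at h1
  have h2 := integral_prod _ h1
  rw [← h2]
  have h3 := (volume_measurePreserving_sumPiEquivProdPi_symm
    (fun _ : ι ⊕ κ => ℝ)).integral_comp' (gaussDensity ρ q c)
  rw [← h3]
  rfl

end

/-! ### Rotation of the Macdonald–Mehta integrand to the Gaussian gas. -/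

/-- The charges and contour positions attached to the deformed Macdonald-Mehta integral. -/
def mehtaCharge (ρ : ℝ) (n m : ℕ) : Fin n ⊕ Fin m → ℝ := Sum.elim (fun _ => -1 / ρ) fun _ => 1

/-- The contour positions attached to the deformed Macdonald-Mehta integral. -/
def mehtaPosition (ρ : ℝ) {n m : ℕ} (ξ : Fin n → ℝ) (η : Fin m → ℝ) : Fin n ⊕ Fin m → ℝ :=
  Sum.elim (fun i => -(Real.sqrt (-ρ) * ξ i)) fun j => -η j

section
variable {ρ : ℝ} {n m : ℕ} {ξ : Fin n → ℝ} {η : Fin m → ℝ}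

theorem mehtaPosition_injective (hρ : ρ < 0) (hξ : StrictMono ξ) (hη : StrictMono η)
    (hne : ∀ i j, Real.sqrt (-ρ) * ξ i ≠ η j) : Function.Injective (mehtaPosition ρ ξ η) := by
  have hk : Real.sqrt (-ρ) ≠ 0 := (Real.sqrt_pos.mpr (by linarith)).ne'
  rintro (i | i) (j | j) h
  · simp only [mehtaPosition, Sum.elim_inl, neg_inj] at h
    rw [hξ.injective (mul_left_cancel₀ hk h)]
  · simp only [mehtaPosition, Sum.elim_inl, Sum.elim_inr, neg_inj] at h
    exact absurd h (hne i j)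
  · simp only [mehtaPosition, Sum.elim_inl, Sum.elim_inr, neg_inj] at h
    exact absurd h.symm (hne j i)
  · simp only [mehtaPosition, Sum.elim_inr, neg_inj] at h
    rw [hη.injective h]

theorem mehtaCharge_pos (hρ : ρ < 0) (n m : ℕ) (i : Fin n ⊕ Fin m) : 0 < mehtaCharge ρ n m i := by
  cases i
  · exact div_pos_of_neg_of_neg (by norm_num) hρ
  · exact one_pos

theorem integral_gaussDensity_mehta (hρ : ρ < 0) (hξ : StrictMono ξ) (hη : StrictMono η)
    (hne : ∀ i j, Real.sqrt (-ρ) * ξ i ≠ η j) :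
    ∫ z, gaussDensity ρ (mehtaCharge ρ n m) (mehtaPosition ρ ξ η) z =
      (((-1 / ρ) ^ ((n : ℝ) * (n - 1) / 2 * (-1 / ρ)) * mehtaGamma ρ n m *
        (Real.sqrt (2 * Real.pi / (-1 / ρ)) ^ n * Real.sqrt (2 * Real.pi) ^ m) : ℝ) : ℂ) := by
  -- The two blocks of variables are listed as one family indexed by `Fin (n + m)`, because
  -- `integral_gaussDensity` is stated for `Fin N`.
  set σ : Fin (n + m) → Bool := (Sum.elim (fun _ => false) fun _ => true) ∘ finSumFinEquiv.symm
    with hσ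
  have hspec : ∀ b, species σ b = (∑ _i : Fin n, if false = b then 1 else 0) +
      ∑ _j : Fin m, if true = b then 1 else 0 := by
    intro b
    unfold species
    rw [← Equiv.sum_comp finSumFinEquiv, Fintype.sum_sum_type]
    simp [hσ]
  have hn : species σ false = n := by rw [hspec]; simp
  have hm : species σ true = m := by rw [hspec]; simp
  have h := integral_gaussDensity hρ σ (c := mehtaPosition ρ ξ η ∘ finSumFinEquiv.symm)
    ((mehtaPosition_injective hρ hξ hη hne).comp finSumFinEquiv.symm.injective)
  have hq : (fun i => charge ρ (σ i)) = mehtaCharge ρ n m ∘ finSumFinEquiv.symm := by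
    ext i
    simp only [hσ, Function.comp_apply]
    cases finSumFinEquiv.symm i <;> simp [charge, mehtaCharge]
  rw [prod_species σ fun b => Real.sqrt (2 * Real.pi / charge ρ b), hq,
    integral_gaussDensity_comp_equiv, hn, hm] at h
  simpa [charge] using h

/-- In the lower half-plane arg z lies in (-π, 0), so adding π/2 does not cross the cut and the
principal logarithms add. -/
theorem cpow_I_mul {z : ℂ} (hz : z.im < 0) (a : ℝ) :
    (Complex.I * z) ^ (a : ℂ) = Complex.exp (Real.pi * Complex.I / 2 * a) * z ^ (a : ℂ) := by
  have hz0 : z ≠ 0 := fun h => by simp [h] at hz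
  have hI : Complex.log (Complex.I * z) = Real.pi / 2 * Complex.I + Complex.log z := by
    have h1 := Complex.arg_neg_iff.mpr hz
    have h2 := Complex.neg_pi_lt_arg z
    rw [Complex.log_mul Complex.I_ne_zero hz0, Complex.log_I]
    rw [Complex.arg_I]
    constructor <;> linarith [Real.pi_pos]
  rw [Complex.cpow_def_of_ne_zero (mul_ne_zero Complex.I_ne_zero hz0),
    Complex.cpow_def_of_ne_zero hz0, hI, ← Complex.exp_add]
  congr 1
  ring

theorem sum_card_Ioi_fin (k : ℕ) :
    (((∑ i : Fin k, (Finset.Ioi i).card : ℕ)) : ℝ) = k * (k - 1) / 2 := by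
  simp only [Fin.card_Ioi]
  rw [Fin.sum_univ_eq_sum_range (fun i => k - 1 - i) k, Finset.sum_range_reflect (fun i => i) k]
  have := Finset.sum_range_id_mul_two k
  rcases k with _ | k
  · simp
  · have h := congrArg (fun x : ℕ => (x : ℝ)) this
    rw [Nat.add_sub_cancel] at h
    push_cast at h ⊢
    linarith

theorem prod_Ioi_const (k : ℕ) (C : ℂ) :
    ∏ i : Fin k, ∏ _j ∈ Finset.Ioi i, C = C ^ (∑ i : Fin k, (Finset.Ioi i).card) := by
  simp only [Finset.prod_const, Finset.prod_pow_eq_pow_sum]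

theorem prod_ite_eq_prod_Ioi {k : ℕ} {x : Fin k → ℝ} (hx : StrictAnti x) (f : Fin k → Fin k → ℂ) :
    (∏ i, ∏ j, if x i < x j then f i j else 1) = ∏ i, ∏ j ∈ Finset.Ioi i, f j i := by
  rw [Finset.prod_comm]
  refine Finset.prod_congr rfl fun i _ => ?_
  simp only [hx.lt_iff_gt]
  rw [← Finset.prod_filter]
  congr 1
  ext j
  simp

end

/-- Multiplication by i sends ℝ + iξ to the line Re z = -ξ and so reverses the order. Each
admissible pair then has its base t_i - t_j, i < j, in the lower half-plane, and `cpow_I_mul` gives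
every pair the same constant. -/
theorem prod_shiftedPoint_cpow {k : ℕ} {ξ : Fin k → ℝ} (hξ : StrictMono ξ) {a : ℝ} (ha : 0 < a)
    (b : ℝ) (x : Fin k → ℝ) :
    (∏ i, ∏ j, if -(a * ξ i) < -(a * ξ j) then
        (a * (Complex.I * shiftedPoint ξ x j) - a * (Complex.I * shiftedPoint ξ x i)) ^ (b : ℂ)
        else 1) =
      (((a ^ b : ℝ) : ℂ) * Complex.exp (Real.pi * Complex.I / 2 * b)) ^
          (∑ i : Fin k, (Finset.Ioi i).card) *
        ∏ i, ∏ j ∈ Finset.Ioi i, (shiftedPoint ξ x i - shiftedPoint ξ x j) ^ (b : ℂ) := by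
  have hanti : StrictAnti fun i => -(a * ξ i) := fun i j hij =>
    neg_lt_neg (mul_lt_mul_of_pos_left (hξ hij) ha)
  rw [prod_ite_eq_prod_Ioi hanti fun i j =>
    (a * (Complex.I * shiftedPoint ξ x j) - a * (Complex.I * shiftedPoint ξ x i)) ^ (b : ℂ),
    ← prod_Ioi_const, ← Finset.prod_mul_distrib]
  refine Finset.prod_congr rfl fun i _ => ?_
  rw [← Finset.prod_mul_distrib]
  refine Finset.prod_congr rfl fun j hj => ?_
  have him : (shiftedPoint ξ x i - shiftedPoint ξ x j).im < 0 := by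
    have := hξ (Finset.mem_Ioi.mp hj)
    simpa [shiftedPoint] using this
  have h0 : Complex.I * (shiftedPoint ξ x i - shiftedPoint ξ x j) ≠ 0 :=
    mul_ne_zero Complex.I_ne_zero fun h => by simp [h] at him
  rw [← mul_sub, ← mul_sub, ofReal_mul_cpow ha h0, cpow_I_mul him, mul_assoc]

/-- The exponent is the even integer -2, so neither the branch nor the order of the two lines
matters. Each of the nm pairs contributes i⁻² = -1. -/
theorem prod_cross_cpow {n m : ℕ} {a : Fin n → ℝ} {b : Fin m → ℝ} (hab : ∀ i j, a i ≠ b j)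
    (t : Fin n → ℂ) (τ : Fin m → ℂ) {ρ : ℝ} (hρ : ρ < 0) :
    (∏ i, ∏ j, if a i < b j then
        (Complex.I * τ j - Complex.I * t i) ^ ((2 * ρ * (-1 / ρ) * 1 : ℝ) : ℂ) else 1) *
      (∏ j, ∏ i, if b j < a i then
        (Complex.I * t i - Complex.I * τ j) ^ ((2 * ρ * 1 * (-1 / ρ) : ℝ) : ℂ) else 1) =
      (-1) ^ (n * m) * (∏ j, ∏ i, (t i - τ j) ^ 2)⁻¹ := by
  have e1 : 2 * ρ * (-1 / ρ) * 1 = -2 := by field_simp [hρ.ne]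
  have e2 : 2 * ρ * 1 * (-1 / ρ) = -2 := by field_simp [hρ.ne]
  have hpow : ∀ z : ℂ, z ^ ((-2 : ℝ) : ℂ) = (z ^ 2)⁻¹ := fun z => by
    have : ((-2 : ℝ) : ℂ) = ((-2 : ℤ) : ℂ) := by norm_num
    rw [this, Complex.cpow_intCast, zpow_neg]
    rfl
  rw [e1, e2, Finset.prod_comm, ← Finset.prod_mul_distrib, mul_comm n m, ← Finset.prod_inv_distrib]
  have hc : ((-1 : ℂ) ^ (m * n)) = ∏ _j : Fin m, ∏ _i : Fin n, (-1 : ℂ) := by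
    simp [mul_comm m n, pow_mul]
  rw [hc, ← Finset.prod_mul_distrib]
  refine Finset.prod_congr rfl fun j _ => ?_
  rw [← Finset.prod_mul_distrib, ← Finset.prod_inv_distrib, ← Finset.prod_mul_distrib]
  refine Finset.prod_congr rfl fun i _ => ?_
  rw [hpow, hpow, ← mul_sub, ← mul_sub, mul_pow, mul_pow, Complex.I_sq]
  rcases lt_or_gt_of_ne (hab i j) with h | h
  · rw [if_pos h, if_neg h.not_gt, mul_one, ← neg_sub (t i), neg_sq, mul_inv]
    norm_num
  · rw [if_pos h, if_neg h.not_gt, one_mul, mul_inv]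
    norm_num

section
variable {ρ : ℝ} {n m : ℕ} {ξ : Fin n → ℝ} {η : Fin m → ℝ}

/-- With k = √(-ρ), the substitution is z = ikt, z = iτ. Since (-1/ρ)k² = 1, both Gaussians become
standard. The phase undoes (-1)^{nm} and the rotations e^{πi/ρ}, e^{πiρ} per pair within a species;
the real power undoes the k^{2/ρ}. -/
theorem mehtaIntegrand_eq (hρ : ρ < 0) (hξ : StrictMono ξ) (hη : StrictMono η)
    (hne : ∀ i j, Real.sqrt (-ρ) * ξ i ≠ η j) (x : Fin n → ℝ) (y : Fin m → ℝ) :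
    mehtaIntegrand n m ρ (shiftedPoint ξ x) (shiftedPoint η y) =
      mehtaPhase n m ρ * (((-1 / ρ) ^ (-((n : ℝ) * (n - 1) / 2 * (-1 / ρ))) : ℝ) : ℂ) *
        gaussDensity ρ (mehtaCharge ρ n m) (mehtaPosition ρ ξ η)
          (Sum.elim (Real.sqrt (-ρ) • x) y) := by
  have hr : 0 < -1 / ρ := div_pos_of_neg_of_neg (by norm_num) hρ
  have hk : 0 < Real.sqrt (-ρ) := Real.sqrt_pos.mpr (by linarith)
  have hk2 : Real.sqrt (-ρ) ^ 2 = -ρ := Real.sq_sqrt (by linarith)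
  set k := Real.sqrt (-ρ) with hkdef
  set t := shiftedPoint ξ x with ht
  set τ := shiftedPoint η y with hτ
  have ep : (fun i => ((mehtaPosition ρ ξ η i : ℝ) : ℂ) +
      ((Sum.elim (k • x) y : Fin n ⊕ Fin m → ℝ) i : ℂ) * Complex.I) =
      Sum.elim (fun i => (k : ℂ) * (Complex.I * t i)) fun j => Complex.I * τ j := by
    ext i
    rcases i with i | i
    · simp only [mehtaPosition, Sum.elim_inl, Pi.smul_apply, smul_eq_mul, ht, shiftedPoint,
        ← hkdef]
      push_cast
      linear_combination (-(k : ℂ) * ξ i) * Complex.I_sq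
    · simp only [mehtaPosition, Sum.elim_inr, hτ, shiftedPoint]
      push_cast
      linear_combination (-(η i : ℂ)) * Complex.I_sq
  have hexp : ∏ i, Complex.exp (mehtaCharge ρ n m i * (((mehtaPosition ρ ξ η i : ℝ) : ℂ) +
      ((Sum.elim (k • x) y : Fin n ⊕ Fin m → ℝ) i : ℂ) * Complex.I) ^ 2 / 2) =
      Complex.exp (-(1 / 2) * (∑ j : Fin m, τ j ^ 2) - (1 / 2) * (∑ i : Fin n, t i ^ 2)) := by
    have ep' := fun i => congrFun ep i
    simp only [ep']
    rw [← Complex.exp_sum, Fintype.sum_sum_type]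
    congr 1
    rw [sub_eq_add_neg, add_comm, ← neg_mul, Finset.mul_sum, Finset.mul_sum]
    have hkr : ((-1 / ρ : ℝ) : ℂ) * (k : ℂ) ^ 2 = 1 := by
      have : -1 / ρ * k ^ 2 = 1 := by rw [hk2]; field_simp [hρ.ne]
      rw [← Complex.ofReal_pow, ← Complex.ofReal_mul, this, Complex.ofReal_one]
    congr 1
    · refine Finset.sum_congr rfl fun j _ => ?_
      simp only [mehtaCharge, Sum.elim_inr, Complex.ofReal_one]
      linear_combination (τ j ^ 2 / 2) * Complex.I_sq
    · refine Finset.sum_congr rfl fun i _ => ?_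
      simp only [mehtaCharge, Sum.elim_inl]
      linear_combination (Complex.I ^ 2 * t i ^ 2 / 2) * hkr + (t i ^ 2 / 2) * Complex.I_sq
  have hr2 : 2 * ρ * (-1 / ρ) * (-1 / ρ) = 2 / ρ := by field_simp [hρ.ne]
  have h1 := prod_shiftedPoint_cpow hξ hk (2 / ρ) x
  have h2 := prod_shiftedPoint_cpow hη one_pos (2 * ρ) y
  have h3 := prod_cross_cpow (a := fun i => -(k * ξ i)) (b := fun j => -η j)
    (fun i j h => hne i j (neg_inj.mp h)) (fun i => (k : ℂ) * t i) τ hρ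
  simp only [one_mul, Real.one_rpow, Complex.ofReal_one, ← hτ] at h2
  simp only [← ht] at h1
  have hw : pairWeight ρ (mehtaCharge ρ n m) (mehtaPosition ρ ξ η) (fun i =>
      ((mehtaPosition ρ ξ η i : ℝ) : ℂ) +
      ((Sum.elim (k • x) y : Fin n ⊕ Fin m → ℝ) i : ℂ) * Complex.I) =
      ((((k ^ (2 / ρ) : ℝ) : ℂ) * Complex.exp (Real.pi * Complex.I / 2 * ((2 / ρ : ℝ) : ℂ))) ^
          (∑ i : Fin n, (Finset.Ioi i).card) *
        ∏ i, ∏ j ∈ Finset.Ioi i, (t i - t j) ^ ((2 / ρ : ℝ) : ℂ)) *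
      ((-1) ^ (n * m) * (∏ j, ∏ i, ((k : ℂ) * t i - τ j) ^ 2)⁻¹) *
      (Complex.exp (Real.pi * Complex.I / 2 * ((2 * ρ : ℝ) : ℂ)) ^
          (∑ i : Fin m, (Finset.Ioi i).card) *
        ∏ i, ∏ j ∈ Finset.Ioi i, (τ i - τ j) ^ ((2 * ρ : ℝ) : ℂ)) := by
    rw [← h1, ← h2, ← h3, ep]
    unfold pairWeight
    simp only [Fintype.prod_sum_type, Finset.prod_mul_distrib, mehtaCharge, mehtaPosition,
      Sum.elim_inl, Sum.elim_inr, ← hkdef, hr2, mul_one, mul_left_comm Complex.I (k : ℂ)]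
    ring_nf
  unfold gaussDensity
  rw [hw, hexp]
  unfold mehtaIntegrand mehtaPhase
  rw [← hkdef]
  have hN1 := sum_card_Ioi_fin n
  have hN2 := sum_card_Ioi_fin m
  set N1 := ∑ i : Fin n, (Finset.Ioi i).card
  set N2 := ∑ i : Fin m, (Finset.Ioi i).card
  have hc1 : (((-1 / ρ) ^ (-((n : ℝ) * (n - 1) / 2 * (-1 / ρ))) : ℝ) : ℂ) *
      ((k ^ (2 / ρ) : ℝ) : ℂ) ^ N1 = 1 := by
    have hkr : k = (-1 / ρ) ^ (-(1 / 2) : ℝ) := by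
      rw [hkdef, Real.sqrt_eq_rpow, Real.rpow_neg hr.le, ← Real.inv_rpow hr.le]
      congr 1
      field_simp
    have : (-1 / ρ) ^ (-((n : ℝ) * (n - 1) / 2 * (-1 / ρ))) * (k ^ (2 / ρ)) ^ N1 = 1 := by
      rw [← Real.rpow_natCast, hkr, ← Real.rpow_mul hr.le, ← Real.rpow_mul hr.le,
        ← Real.rpow_add hr, hN1]
      convert! Real.rpow_zero (-1 / ρ) using 2
      field_simp
      ring
    exact_mod_cast this
  have hc2 : Complex.exp (-(Real.pi : ℂ) * Complex.I *
      ((((m : ℝ) * ((m : ℝ) - 1) * ρ / 2 + (n : ℝ) * ((n : ℝ) - 1) / (2 * ρ) : ℝ)) : ℂ)) *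
      (Complex.exp (Real.pi * Complex.I / 2 * ((2 / ρ : ℝ) : ℂ)) ^ N1 *
        Complex.exp (Real.pi * Complex.I / 2 * ((2 * ρ : ℝ) : ℂ)) ^ N2) = 1 := by
    rw [← Complex.exp_nat_mul, ← Complex.exp_nat_mul, ← Complex.exp_add, ← Complex.exp_add]
    convert! Complex.exp_zero using 2
    have e : (m : ℝ) * ((m : ℝ) - 1) * ρ / 2 + (n : ℝ) * ((n : ℝ) - 1) / (2 * ρ) =
        N1 / ρ + N2 * ρ := by
      rw [hN1, hN2]
      field_simp [hρ.ne]
      ring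
    rw [e]
    push_cast
    ring
  have hc3 : ((-1 : ℂ) ^ (n * m)) * (-1) ^ (n * m) = 1 := by
    rw [← mul_pow]
    norm_num
  rw [mul_pow]
  generalize ((k ^ (2 / ρ) : ℝ) : ℂ) ^ N1 = A1 at *
  generalize (((-1 / ρ) ^ (-((n : ℝ) * (n - 1) / 2 * (-1 / ρ))) : ℝ) : ℂ) = A2 at *
  generalize Complex.exp (Real.pi * Complex.I / 2 * ((2 / ρ : ℝ) : ℂ)) ^ N1 = A3 at *
  generalize Complex.exp (Real.pi * Complex.I / 2 * ((2 * ρ : ℝ) : ℂ)) ^ N2 = A4 at *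
  generalize Complex.exp (-(Real.pi : ℂ) * Complex.I *
      ((((m : ℝ) * ((m : ℝ) - 1) * ρ / 2 + (n : ℝ) * ((n : ℝ) - 1) / (2 * ρ) : ℝ)) : ℂ)) = A5 at *
  generalize (-1 : ℂ) ^ (n * m) = A6 at *
  rw [div_eq_mul_inv]
  generalize (∏ j, ∏ i, ((k : ℂ) * t i - τ j) ^ 2)⁻¹ = B1
  generalize (∏ i, ∏ j ∈ Finset.Ioi i, (t i - t j) ^ ((2 / ρ : ℝ) : ℂ)) = B2
  generalize (∏ i, ∏ j ∈ Finset.Ioi i, (τ i - τ j) ^ ((2 * ρ : ℝ) : ℂ)) = B3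
  generalize Complex.exp (-(1 / 2) * (∑ j : Fin m, τ j ^ 2) - (1 / 2) * (∑ i : Fin n, t i ^ 2)) = B4
  have : A6 * A6 * (A2 * A1) * (A5 * (A3 * A4)) = 1 := by rw [hc1, hc2, hc3]; ring
  linear_combination (-(B1 * B2 * B3 * B4)) * this

end

section
variable {ρ : ℝ} {n m : ℕ} {ξ : Fin n → ℝ} {η : Fin m → ℝ}

theorem integrable_mehtaIntegrand (hρ : ρ < 0) (hξ : StrictMono ξ) (hη : StrictMono η)
    (hne : ∀ i j, Real.sqrt (-ρ) * ξ i ≠ η j) :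
    Integrable fun p : (Fin n → ℝ) × (Fin m → ℝ) =>
      mehtaIntegrand n m ρ (shiftedPoint ξ p.1) (shiftedPoint η p.2) := by
  simp only [mehtaIntegrand_eq hρ hξ hη hne]
  exact (integrable_gaussDensity_sumElim hρ (mehtaCharge_pos hρ n m) _
    (Real.sqrt_pos.mpr (by linarith)).ne').const_mul _

theorem mehtaIntegral_eq (hρ : ρ < 0) (hξ : StrictMono ξ) (hη : StrictMono η)
    (hne : ∀ i j, Real.sqrt (-ρ) * ξ i ≠ η j) :
    mehtaIntegral n m ρ ξ η = mehtaPhase n m ρ * (mehtaGamma ρ n m : ℝ) := by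
  have hr : 0 < -1 / ρ := div_pos_of_neg_of_neg (by norm_num) hρ
  have hk : 0 < Real.sqrt (-ρ) := Real.sqrt_pos.mpr (by linarith)
  unfold mehtaIntegral
  simp only [mehtaIntegrand_eq hρ hξ hη hne, integral_const_mul]
  rw [integral_gaussDensity_sumElim hρ (mehtaCharge_pos hρ n m) _ hk,
    integral_gaussDensity_mehta hρ hξ hη hne, Fintype.card_fin]
  -- The factor √(-ρ) of each Gaussian normalisation cancels the Jacobian of x ↦ √(-ρ) x.
  have e1 : Real.sqrt (2 * Real.pi / (-1 / ρ)) = Real.sqrt (2 * Real.pi) * Real.sqrt (-ρ) := by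
    rw [← Real.sqrt_mul Real.two_pi_pos.le]
    congr 1
    field_simp
  have e2 : (2 * Real.pi) ^ (((m : ℝ) + n) / 2) = Real.sqrt (2 * Real.pi) ^ m *
      Real.sqrt (2 * Real.pi) ^ n := by
    rw [← pow_add, Real.sqrt_eq_rpow, ← Real.rpow_natCast, ← Real.rpow_mul Real.two_pi_pos.le]
    push_cast
    ring_nf
  have e3 : 1 / (2 * Real.pi) ^ (((m : ℝ) + n) / 2) *
      ((-1 / ρ) ^ (-((n : ℝ) * (n - 1) / 2 * (-1 / ρ))) * ((Real.sqrt (-ρ) ^ n)⁻¹ *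
        ((-1 / ρ) ^ ((n : ℝ) * (n - 1) / 2 * (-1 / ρ)) * mehtaGamma ρ n m *
          (Real.sqrt (2 * Real.pi / (-1 / ρ)) ^ n * Real.sqrt (2 * Real.pi) ^ m)))) =
      mehtaGamma ρ n m := by
    rw [e1, e2, Real.rpow_neg hr.le]
    have p1 : 0 < (-1 / ρ) ^ ((n : ℝ) * (n - 1) / 2 * (-1 / ρ)) := Real.rpow_pos_of_pos hr _
    have p2 : 0 < Real.sqrt (2 * Real.pi) := Real.sqrt_pos.mpr Real.two_pi_pos
    generalize (-1 / ρ) ^ ((n : ℝ) * (n - 1) / 2 * (-1 / ρ)) = A at *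
    generalize Real.sqrt (2 * Real.pi) = B at *
    generalize Real.sqrt (-ρ) = C at *
    rw [mul_pow]
    field_simp
  have h := congrArg (fun x : ℝ => (x : ℂ)) e3
  simp only [Complex.ofReal_mul, Complex.ofReal_div, Complex.ofReal_one] at h
  simp only [Complex.ofReal_mul]
  linear_combination mehtaPhase n m ρ * h

theorem mehtaGamma_eq_prod_Icc (ρ : ℝ) (n m : ℕ) :
    mehtaGamma ρ n m =
      (∏ i ∈ Finset.Icc 1 n, Real.Gamma (1 - 1 / ρ) / Real.Gamma (1 - (i : ℝ) / ρ)) *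
        ∏ j ∈ Finset.Icc 1 m, Real.Gamma (1 - ρ) / Real.Gamma ((n : ℝ) + 1 - (j : ℝ) * ρ) := by
  unfold mehtaGamma
  rw [← Finset.Ico_add_one_right_eq_Icc, ← Finset.Ico_add_one_right_eq_Icc,
    Finset.prod_Ico_eq_prod_range, Finset.prod_Ico_eq_prod_range]
  simp only [Nat.add_sub_cancel]
  congr 1
  · refine Finset.prod_congr rfl fun i _ => ?_
    push_cast
    ring_nf
  · refine Finset.prod_congr rfl fun j _ => ?_
    push_cast
    ring_nf

theorem prod_Gamma_div_eq (hρ : ρ < 0) (n m : ℕ) :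
    ∏ j ∈ Finset.Icc 1 m, Real.Gamma (1 - ρ) / Real.Gamma ((n : ℝ) + 1 - (j : ℝ) * ρ) =
      (∏ j ∈ Finset.Icc 1 m, ∏ i ∈ Finset.Icc 1 n, 1 / ((i : ℝ) - (j : ℝ) * ρ)) *
        ∏ j ∈ Finset.Icc 1 m, Real.Gamma (1 - ρ) / Real.Gamma (1 - (j : ℝ) * ρ) := by
  rw [← Finset.prod_mul_distrib]
  refine Finset.prod_congr rfl fun j _ => ?_
  have hj : (j : ℝ) * ρ ≤ 0 := mul_nonpos_of_nonneg_of_nonpos j.cast_nonneg hρ.le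
  have h := Gamma_add_nat_eq (show 0 < 1 - (j : ℝ) * ρ by linarith) n
  have e : ∏ l ∈ Finset.range n, (1 - (j : ℝ) * ρ + l) =
      ∏ i ∈ Finset.Icc 1 n, ((i : ℝ) - (j : ℝ) * ρ) := by
    rw [← Finset.Ico_add_one_right_eq_Icc, Finset.prod_Ico_eq_prod_range, Nat.add_sub_cancel]
    refine Finset.prod_congr rfl fun i _ => ?_
    push_cast
    ring
  rw [show (n : ℝ) + 1 - j * ρ = 1 - j * ρ + n by ring, h, e, Finset.prod_div_distrib,
    Finset.prod_const_one, div_mul_div_comm, one_mul, mul_comm (Real.Gamma (1 - j * ρ))]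

end

end

theorem mainTheorem4 (n m : ℕ) (ρ : ℝ) (hρ : ρ < 0)
    (ξ : Fin n → ℝ) (η : Fin m → ℝ)
    (hξ : StrictMono ξ) (hη : StrictMono η) (hξη : ∀ i j, η j < ξ i)
    (hne : ∀ i j, Real.sqrt (-ρ) * ξ i ≠ η j) :
    Integrable (fun p : (Fin n → ℝ) × (Fin m → ℝ) =>
        mehtaIntegrand n m ρ (shiftedPoint ξ p.1) (shiftedPoint η p.2)) ∧
    mehtaIntegral n m ρ ξ η =
      mehtaPhase n m ρ *
        (((∏ i ∈ Finset.Icc 1 n, Real.Gamma (1 - 1 / ρ) / Real.Gamma (1 - (i : ℝ) / ρ)) *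
          (∏ j ∈ Finset.Icc 1 m,
            Real.Gamma (1 - ρ) / Real.Gamma ((n : ℝ) + 1 - (j : ℝ) * ρ)) : ℝ) : ℂ) ∧
    mehtaIntegral n m ρ ξ η =
      mehtaPhase n m ρ *
        (((∏ j ∈ Finset.Icc 1 m, ∏ i ∈ Finset.Icc 1 n, 1 / ((i : ℝ) - (j : ℝ) * ρ)) *
          (∏ i ∈ Finset.Icc 1 n, Real.Gamma (1 - 1 / ρ) / Real.Gamma (1 - (i : ℝ) / ρ)) *
          (∏ j ∈ Finset.Icc 1 m, Real.Gamma (1 - ρ) / Real.Gamma (1 - (j : ℝ) * ρ)) : ℝ) : ℂ) := by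
  refine ⟨integrable_mehtaIntegrand hρ hξ hη hne, ?_, ?_⟩
  · rw [mehtaIntegral_eq hρ hξ hη hne, mehtaGamma_eq_prod_Icc]
  · rw [mehtaIntegral_eq hρ hξ hη hne, mehtaGamma_eq_prod_Icc, prod_Gamma_div_eq hρ]
    congr 2
    ring
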